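/- Let $E$ be a finite-dimensional real Euclidean space and let $W\subset O(E)$ be a finite group generated by reflections. Let $S\subset W$ be the set of all reflections in $W$, and let $\mathfrak h=\mathbb C\otimes_{\mathbb R}E$. For each $s\in S$ choose a nonzero real linear function $\alpha_s\in\mathfrak h^*$ vanishing on the reflection hyperplane of $s$, with coroot $\alpha_s^\vee=2(\alpha_s,-)/(\alpha_s,\alpha_s)\in\mathfrak h$, and let $c:S\to\mathbb C$ be a function invariant under conjugation by $W$. The rational Cherednik algebra $\mathsf H_c$ is the unital associative $\mathbb C$-algebra generated by the vector spaces $\mathfrak h$, $\mathfrak h^*$ and the group $W$ with defining relations, for $x,x_1,x_2\in\mathfrak h^*$, $y,y_1,y_2\in\mathfrak h$, $w\in W$, $$w x w^{-1}=w(x),\quad w y w^{-1}=w(y),\quad x_1x_2=x_2x_1,\quad y_1y_2=y_2y_1,$$ $$yx-xy=\langle y,x\rangle+\sum_{s\in S}c_s\,\langle y,\alpha_s\rangle\langle\alpha_s^\vee,x\rangle\, s .$$ Let $A^+\subset\mathsf H_c$ (resp. $A^-\subset\mathsf H_c$) be the non-unital subalgebra of $W$-invariant polynomials without constant term in the elements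 of $\mathfrak h^*$ (resp. of $\mathfrak h$). Let ${}^\uparrow\mathscr O$ (resp. $\mathscr O_\downarrow$) be the category of finitely generated left (resp. right) $\mathsf H_c$-modules $M$ on which $A^-$ (resp. $A^+$) acts locally nilpotently, i.e. for each $m\in M$ there is an $n$ such that every product of $n$ elements of $A^-$ (resp. $A^+$) kills $m$. For an irreducible complex representation $\sigma$ of $W$ let $L_\sigma$ be the quotient of the standard module $\mathsf H_c\otimes_{\mathbb C[\mathfrak h^*]\# W}\sigma$ (with $\mathfrak h$ acting on $\sigma$ by $0$) by the sum of all its proper submodules. Then: 1. For every two-sided ideal $I\subsetneq\mathsf H_c$ the following are equivalent: (i) $I$ is primitive (the annihilator of a simple left module); (ii) $I$ is prime (for two-sided ideals $J_1,J_2$, $J_1J_2\subset I$ implies $J_1\subset I$ or $J_2\subset I$); (iii) $I$ is the annihilator of a simple object of ${}^\uparrow\mathscr O$; (iv) $I$ is the (right) annihilator of a simple object of $\mathscr O_\downarrow$. 2. Every primitive ideal of $\mathsf H_c$ is the annihilator of a simple highest weight module: it equals $\mathrm{Ann}(L_\sigma)$ for some irreducible representation $\sigma$ of $W$ such that $L_\sigma$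 is simple. 3. The set $\mathrm{Prim}(\mathsf H_c)$ of primitive ideals is finite. 4. $\mathsf H_c$ has finite length as an $\mathsf H_c\otimes_{\mathbb C}\mathsf H_c^{\mathrm{op}}$-module, i.e. as a bimodule over itself. -/

import Mathlib

open scoped TensorProduct

universe u

noncomputable section

/-! ### Ring-theoretic notions -/

section Rings

variable {A : Type u} [Ring A]

/-- A primitive ideal: the annihilator of a simple left module. -/
def IsPrimitiveIdeal (I : Ideal A) : Prop :=
  ∃ (L : Type u) (_ : AddCommGroup L) (_ : Module A L),
    IsSimpleModule A L ∧ I = Module.annihilator A L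

/-- A prime ideal of a noncommutative ring, tested on products of two-sided ideals
(`Ideal.IsPrime` would mean completely prime). -/
def IsPrimeTwoSidedIdeal (I : Ideal A) : Prop :=
  I.IsTwoSided ∧ I ≠ ⊤ ∧
    ∀ J₁ J₂ : Ideal A, J₁.IsTwoSided → J₂.IsTwoSided → J₁ * J₂ ≤ I → J₁ ≤ I ∨ J₂ ≤ I

/-- The set `T` acts locally nilpotently on the left module `M`: every `m` is killed by all
products of `n = n(m)` elements of `T`. -/
def LeftLocallyNilpotent (T : Set A) (M : Type u) [AddCommGroup M] [Module A M] : Prop :=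
  ∀ m : M, ∃ n : ℕ, ∀ l : List A, l.length = n → (∀ a ∈ l, a ∈ T) → l.prod • m = 0

/-- The set `T` acts locally nilpotently on the right module `M`. Right `A`-modules are
modules over `Aᵐᵒᵖ`. -/
def RightLocallyNilpotent (T : Set A) (M : Type u) [AddCommGroup M] [Module Aᵐᵒᵖ M] : Prop :=
  ∀ m : M, ∃ n : ℕ, ∀ l : List A, l.length = n → (∀ a ∈ l, a ∈ T) →
    MulOpposite.op l.prod • m = 0

/-- `A` has finite length as a module over `A ⊗ Aᵐᵒᵖ`, i.e. as an `A`-bimodule, the action being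
`(a ⊗ b) • x = a * x * b`. -/
def HasFiniteLengthAsBimodule (A : Type u) [Ring A] [Algebra ℂ A] : Prop :=
  letI : Module (A ⊗[ℂ] Aᵐᵒᵖ) A := TensorProduct.Algebra.module
  IsFiniteLength (A ⊗[ℂ] Aᵐᵒᵖ) A

end Rings

/-! ### Finite reflection groups and rational Cherednik algebras -/

namespace Cherednik

variable {E : Type u} [NormedAddCommGroup E] [InnerProductSpace ℝ E] [FiniteDimensional ℝ E]

/-- `W` is a finite Coxeter group: it is finite and generated by the orthogonal reflections
in hyperplanes of the Euclidean space `E` that it contains. -/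
def IsFiniteCoxeterGroup (W : Subgroup (E ≃ₗᵢ[ℝ] E)) : Prop :=
  Finite W ∧
    W = Subgroup.closure {s | s ∈ W ∧ ∃ a : E, a ≠ 0 ∧ s = (Submodule.span ℝ {a})ᗮ.reflection}

/-- The set `S` of all reflections contained in `W`. -/
abbrev Refl (W : Subgroup (E ≃ₗᵢ[ℝ] E)) : Type u :=
  {s : W // ∃ a : E, a ≠ 0 ∧ (s : E ≃ₗᵢ[ℝ] E) = (Submodule.span ℝ {a})ᗮ.reflection}

/-- A choice of roots: for every reflection `s ∈ S`, a nonzero vector of `E` orthogonal to the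
hyperplane `H_s` of `s`. -/
def IsRootChoice (W : Subgroup (E ≃ₗᵢ[ℝ] E)) (a : Refl W → E) : Prop :=
  ∀ s : Refl W, a s ≠ 0 ∧ (s.1 : E ≃ₗᵢ[ℝ] E) = (Submodule.span ℝ {a s})ᗮ.reflection

/-- The function `c` on `S` is invariant under conjugation by `W`. -/
def IsInvariant (W : Subgroup (E ≃ₗᵢ[ℝ] E)) (c : Refl W → ℂ) : Prop :=
  ∀ (w : W) (s s' : Refl W), s'.1 = w * s.1 * w⁻¹ → c s' = c s

variable (E) in
/-- The complexification `𝔥` of `E`. -/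
abbrev 𝔥 : Type u := ℂ ⊗[ℝ] E

variable (E) in
/-- The dual space `𝔥*`. -/
abbrev 𝔥Dual : Type u := Module.Dual ℂ (𝔥 E)

/-- The action of an isometry of `E` on `𝔥`. -/
def act (w : E ≃ₗᵢ[ℝ] E) : 𝔥 E →ₗ[ℂ] 𝔥 E :=
  LinearMap.baseChange ℂ (w.toLinearEquiv : E →ₗ[ℝ] E)

/-- The contragredient action of an isometry of `E` on `𝔥*`. -/
def actDual (w : E ≃ₗᵢ[ℝ] E) (x : 𝔥Dual E) : 𝔥Dual E :=
  x ∘ₗ act w⁻¹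

/-- The root `α ∈ 𝔥*` given by `a : E`: the complex-linear extension of `(a, -)`. -/
def root (a : E) : 𝔥Dual E :=
  Module.Dual.baseChange ℂ (innerₛₗ ℝ a : E →ₗ[ℝ] ℝ)

/-- The coroot `α^∨ = 2 a / (a, a) ∈ 𝔥`. -/
def coroot (a : E) : 𝔥 E :=
  (1 : ℂ) ⊗ₜ[ℝ] ((2 / inner ℝ a a) • a)

/-- Generators of the rational Cherednik algebra: the elements of `𝔥`, `𝔥*` and `W`. -/
inductive Gen (W : Subgroup (E ≃ₗᵢ[ℝ] E)) : Type u
  | y : 𝔥 E → Gen W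
  | x : 𝔥Dual E → Gen W
  | w : W → Gen W

variable {W : Subgroup (E ≃ₗᵢ[ℝ] E)}

/-- The generator of the free algebra given by `y ∈ 𝔥`. -/
abbrev gY (W : Subgroup (E ≃ₗᵢ[ℝ] E)) (y : 𝔥 E) : FreeAlgebra ℂ (Gen W) :=
  FreeAlgebra.ι ℂ (Gen.y y)

/-- The generator of the free algebra given by `x ∈ 𝔥*`. -/
abbrev gX (W : Subgroup (E ≃ₗᵢ[ℝ] E)) (x : 𝔥Dual E) : FreeAlgebra ℂ (Gen W) :=
  FreeAlgebra.ι ℂ (Gen.x x)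

/-- The generator of the free algebra given by `w ∈ W`. -/
abbrev gW (W : Subgroup (E ≃ₗᵢ[ℝ] E)) (w : W) : FreeAlgebra ℂ (Gen W) :=
  FreeAlgebra.ι ℂ (Gen.w w)

/-- The defining relations. The first six say that `𝔥` and `𝔥*` are mapped linearly and that
the product of `W` is kept; the other ones are the relations of the rational Cherednik algebra. -/
inductive Rel (W : Subgroup (E ≃ₗᵢ[ℝ] E)) (a : Refl W → E) (c : Refl W → ℂ) :
    FreeAlgebra ℂ (Gen W) → FreeAlgebra ℂ (Gen W) → Prop
  | y_add (y₁ y₂ : 𝔥 E) : Rel W a c (gY W (y₁ + y₂)) (gY W y₁ + gY W y₂)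
  | y_smul (z : ℂ) (y : 𝔥 E) : Rel W a c (gY W (z • y)) (z • gY W y)
  | x_add (x₁ x₂ : 𝔥Dual E) : Rel W a c (gX W (x₁ + x₂)) (gX W x₁ + gX W x₂)
  | x_smul (z : ℂ) (x : 𝔥Dual E) : Rel W a c (gX W (z • x)) (z • gX W x)
  | w_one : Rel W a c (gW W 1) 1
  | w_mul (w₁ w₂ : W) : Rel W a c (gW W (w₁ * w₂)) (gW W w₁ * gW W w₂)
  | w_x (w : W) (x : 𝔥Dual E) : Rel W a c (gW W w * gX W x * gW W w⁻¹) (gX W (actDual w.1 x))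
  | w_y (w : W) (y : 𝔥 E) : Rel W a c (gW W w * gY W y * gW W w⁻¹) (gY W (act w.1 y))
  | x_comm (x₁ x₂ : 𝔥Dual E) : Rel W a c (gX W x₁ * gX W x₂) (gX W x₂ * gX W x₁)
  | y_comm (y₁ y₂ : 𝔥 E) : Rel W a c (gY W y₁ * gY W y₂) (gY W y₂ * gY W y₁)
  | y_x (y : 𝔥 E) (x : 𝔥Dual E) : Rel W a c (gY W y * gX W x - gX W x * gY W y)
      (algebraMap ℂ _ (x y) +
        ∑ᶠ s : Refl W, (c s * root (a s) y * x (coroot (a s))) • gW W s.1)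

/-- The rational Cherednik algebra `H_c`. -/
def H (W : Subgroup (E ≃ₗᵢ[ℝ] E)) (a : Refl W → E) (c : Refl W → ℂ) : Type u :=
  RingQuot (Rel W a c)

variable {a : Refl W → E} {c : Refl W → ℂ}

instance : Ring (H W a c) := inferInstanceAs (Ring (RingQuot (Rel W a c)))

instance : Algebra ℂ (H W a c) := inferInstanceAs (Algebra ℂ (RingQuot (Rel W a c)))

/-- The class in `H_c` of an element of the free algebra. -/
def mk (W : Subgroup (E ≃ₗᵢ[ℝ] E)) (a : Refl W → E) (c : Refl W → ℂ) :
    FreeAlgebra ℂ (Gen W) →ₐ[ℂ] H W a c :=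
  RingQuot.mkAlgHom ℂ (Rel W a c)

variable (W a c) in
/-- The element of `H_c` given by `y ∈ 𝔥`. -/
def ofY (y : 𝔥 E) : H W a c := mk W a c (gY W y)

variable (W a c) in
/-- The element of `H_c` given by `x ∈ 𝔥*`. -/
def ofX (x : 𝔥Dual E) : H W a c := mk W a c (gX W x)

variable (W a c) in
/-- The element of `H_c` given by `w ∈ W`. -/
def ofW (w : W) : H W a c := mk W a c (gW W w)

variable (W a c) in
/-- `A⁺ = ℂ^{>0}[𝔥]^W`: the `W`-invariant elements of the non-unital subalgebra generated
by `𝔥*`. Invariance under `w` means commuting with `w`. -/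
def APlus : NonUnitalSubalgebra ℂ (H W a c) :=
  NonUnitalAlgebra.adjoin ℂ (Set.range (ofX W a c)) ⊓
    NonUnitalSubalgebra.centralizer ℂ (Set.range (ofW W a c))

variable (W a c) in
/-- `A⁻ = ℂ^{>0}[𝔥*]^W`: the `W`-invariant elements of the non-unital subalgebra generated
by `𝔥`. -/
def AMinus : NonUnitalSubalgebra ℂ (H W a c) :=
  NonUnitalAlgebra.adjoin ℂ (Set.range (ofY W a c)) ⊓
    NonUnitalSubalgebra.centralizer ℂ (Set.range (ofW W a c))

/-- `M` belongs to the category of finitely generated left modules with locally nilpotent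
action of `A⁻`. -/
def InOUp (W : Subgroup (E ≃ₗᵢ[ℝ] E)) (a : Refl W → E) (c : Refl W → ℂ)
    (M : Type u) [AddCommGroup M] [Module (H W a c) M] : Prop :=
  Module.Finite (H W a c) M ∧ LeftLocallyNilpotent (AMinus W a c : Set (H W a c)) M

/-- `M` belongs to the category of finitely generated right modules with locally nilpotent
action of `A⁺`. -/
def InODown (W : Subgroup (E ≃ₗᵢ[ℝ] E)) (a : Refl W → E) (c : Refl W → ℂ)
    (M : Type u) [AddCommGroup M] [Module (H W a c)ᵐᵒᵖ M] : Prop :=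
  Module.Finite (H W a c)ᵐᵒᵖ M ∧ RightLocallyNilpotent (APlus W a c : Set (H W a c)) M

/-! ### Standard modules and simple highest weight modules -/

variable {V : Type u} [AddCommGroup V] [Module ℂ V]

variable (a c) in
/-- The relations of the standard module: `h w ⊗ v = h ⊗ w v` for `w ∈ W`, and `h y ⊗ v = 0`
for `y ∈ 𝔥`. -/
def standardRel (σ : Representation ℂ W V) : Submodule (H W a c) (H W a c ⊗[ℂ] V) :=
  Submodule.span (H W a c)
    ({t | ∃ (w : W) (v : V), t = ofW W a c w ⊗ₜ[ℂ] v - (1 : H W a c) ⊗ₜ[ℂ] σ w v} ∪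
      {t | ∃ (y : 𝔥 E) (v : V), t = ofY W a c y ⊗ₜ[ℂ] v})

variable (a c) in
/-- The standard module `H_c ⊗_{ℂ[𝔥*] # W} σ`, where `𝔥` acts on `σ` by zero. -/
abbrev Standard (σ : Representation ℂ W V) : Type u :=
  (H W a c ⊗[ℂ] V) ⧸ standardRel a c σ

variable (a c) in
/-- The highest weight module `L_σ`: the quotient of the standard module by the sum of all its
proper submodules. -/
abbrev L (σ : Representation ℂ W V) : Type u :=
  Standard a c σ ⧸ sSup {N : Submodule (H W a c) (Standard a c σ) | N ≠ ⊤}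

end Cherednik

end

/-! Everything rests on the Euler element `δ = ∑ xᵢyᵢ + κ`, where `κ` lies in the span of the group:
it satisfies `[δ, x] = x` and `[δ, y] = -y`. `TriangularData` records this together with generation
by two polynomial algebras and a group. The structure passes to opposite algebras and to tensor
products, so one theorem on left modules also serves right modules and bimodules. Of the PBW theorem
only the spanning half, `span_triangular`, is needed.

The central result is `Compatible.isFiniteLength`: a module `M` that is finitely generated over the
polynomials in the `x` has finite length. With `𝔪` the ideal of the origin, some nonzero `p` has
`p(δ)M ⊆ 𝔪M`, so the weights of `δ` on `𝔪ᵏM/𝔪ᵏ⁺¹M` are roots of `p` shifted by `k`. In a submodule a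
lowest weight vector is killed by all `y`, hence its weight is an eigenvalue of `κ`, and these are
finitely many. For large `n` no such weight occurs in `𝔪ⁿM`, so a submodule inside `𝔪ⁿM` is zero
(`Compatible.eq_bot_of_le_fil`). As `n` also works for all quotients of `M`, submodules of `M` are
separated by their images in the finite-dimensional space `M/𝔪ⁿM`. Weights are handled modulo powers
of `𝔪`, and `Compatible.iInf_fil` gives `⋂ 𝔪ⁿM = 0`.

Since `A` is spanned by products `x…w…y`, it is finitely generated over the positive part of `A ⊗
Aᵒᵖ` (left `x`, right `y`), which gives finite length as a bimodule.

For a prime `I`, let `K` be the intersection of the finitely many annihilators of simple locally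
nilpotent modules that contain `I`. Each `A/(I + Aψ(𝔪ᵏ))` has finite length with locally nilpotent
factors, so a power of `K` kills it. The chain `Kⁿ + I` stabilizes, and `⋂ₖ (I + Aψ(𝔪ᵏ)) = I` by
separatedness of the bimodule `A/I`; hence `Kⁿ ⊆ I`, and primeness makes `I` one of these
annihilators (`mem_simpleAnn_of_isPrime`). The opposite algebra gives the right-handed version.

A simple locally nilpotent module contains an irreducible representation of `W` killed by `𝔥`. On
the corresponding standard module `δ` acts with a single lowest weight, so its proper submodules
have a proper sum and the given module is `L_σ` (`exists_L_equiv`). -/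

noncomputable section

/-! ### Polynomials at the origin -/

section PolynomialRing

open MvPolynomial

/-- The ideal of polynomials without constant term. -/
def augIdeal (ι : Type*) : Ideal (MvPolynomial ι ℂ) := Ideal.span (Set.range X)

theorem X_mem_augIdeal {ι : Type*} (i : ι) : (X i : MvPolynomial ι ℂ) ∈ augIdeal ι :=
  Ideal.subset_span ⟨i, rfl⟩

theorem mem_augIdeal_iff {ι : Type*} {p : MvPolynomial ι ℂ} :
    p ∈ augIdeal ι ↔ constantCoeff p = 0 := by
  rw [augIdeal, ← Set.image_univ, mem_ideal_span_X_image]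
  constructor
  · intro h
    by_contra h0
    obtain ⟨i, -, hi⟩ := h 0 (by simpa [constantCoeff_eq] using h0)
    exact hi rfl
  · intro h m hm
    by_contra! h0
    have : m = 0 := by ext i; simpa using h0 i
    subst this
    simp [← constantCoeff_eq, h] at hm

theorem mem_augIdeal_smul {ι M : Type*} [Fintype ι] [AddCommGroup M] [Module (MvPolynomial ι ℂ) M]
    {N : Submodule (MvPolynomial ι ℂ) M} {m : M} :
    m ∈ augIdeal ι • N ↔ ∃ f : ι → M, (∀ i, f i ∈ N) ∧ m = ∑ i, (X i : MvPolynomial ι ℂ) • f i := by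
  constructor
  · intro h
    induction h using Submodule.smul_induction_on' with
    | smul r hr n hn =>
      obtain ⟨c, rfl⟩ := (Ideal.mem_span_range_iff_exists_fun).1 hr
      refine ⟨fun i => c i • n, fun i => N.smul_mem _ hn, ?_⟩
      rw [Finset.sum_smul]
      exact Finset.sum_congr rfl fun i _ => by rw [smul_smul, mul_comm]
    | add x _ y _ hx hy =>
      obtain ⟨f, hf, rfl⟩ := hx
      obtain ⟨g, hg, rfl⟩ := hy
      exact ⟨f + g, fun i => N.add_mem (hf i) (hg i), by simp [Finset.sum_add_distrib]⟩
  · rintro ⟨f, hf, rfl⟩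
    exact Submodule.sum_mem _ fun i _ => Submodule.smul_mem_smul (X_mem_augIdeal i) (hf i)

/-- Peeling off the constant term and one variable at a time raises the exponent by one, at the cost
of finitely many new generators. -/
theorem exists_finite_complement_augIdeal_pow (ι : Type*) [Fintype ι] (n : ℕ) :
    ∃ U : Submodule ℂ (MvPolynomial ι ℂ), U.FG ∧
      ∀ p, ∃ u ∈ U, p - u ∈ augIdeal ι ^ n := by
  induction n with
  | zero => exact ⟨⊥, Submodule.fg_bot, fun p => ⟨0, by simp⟩⟩
  | succ n ih =>
    obtain ⟨U, hU, h⟩ := ih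
    refine ⟨Submodule.span ℂ {1} ⊔ ⨆ i : ι, U.map (LinearMap.mulLeft ℂ (X i)),
      (Submodule.fg_span_singleton _).sup (Submodule.fg_iSup _ fun i => hU.map _), fun p => ?_⟩
    have hp : p - C (constantCoeff p) ∈ augIdeal ι • (⊤ : Submodule (MvPolynomial ι ℂ) _) := by
      rw [smul_eq_mul, Ideal.mul_top, mem_augIdeal_iff]; simp
    obtain ⟨f, -, hf⟩ := mem_augIdeal_smul.1 hp
    choose v hv hv' using fun i => h (f i)
    refine ⟨constantCoeff p • 1 + ∑ i, X i * v i, Submodule.add_mem_sup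
      (Submodule.smul_mem _ _ (Submodule.mem_span_singleton_self _))
      (Submodule.sum_mem _ fun i _ => Submodule.mem_iSup_of_mem i ⟨v i, hv i, rfl⟩), ?_⟩
    have : p - (constantCoeff p • 1 + ∑ i, X i * v i) = ∑ i, X i * (f i - v i) := by
      rw [← sub_sub, ← MvPolynomial.C_eq_smul_one, hf, ← Finset.sum_sub_distrib]
      simp [mul_sub]
    rw [this, pow_succ']
    exact Submodule.sum_mem _ fun i _ => Ideal.mul_mem_mul (X_mem_augIdeal i) (hv' i)

theorem finite_quotient_augIdeal_pow_smul {ι M : Type*} [Fintype ι] [AddCommGroup M] [Module ℂ M]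
    [Module (MvPolynomial ι ℂ) M] [IsScalarTower ℂ (MvPolynomial ι ℂ) M]
    [Module.Finite (MvPolynomial ι ℂ) M] (n : ℕ) :
    Module.Finite ℂ (M ⧸ (augIdeal ι ^ n • ⊤ : Submodule (MvPolynomial ι ℂ) M)) := by
  obtain ⟨U, hU, h⟩ := exists_finite_complement_augIdeal_pow ι n
  obtain ⟨s, hs⟩ := Module.Finite.fg_top (R := MvPolynomial ι ℂ) (M := M)
  set F := (augIdeal ι ^ n • ⊤ : Submodule (MvPolynomial ι ℂ) M)
  have key : ∀ (p : MvPolynomial ι ℂ) (m : M), F.mkQ (p • m) ∈ ⨆ v : s, U.map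
      ((F.mkQ.restrictScalars ℂ) ∘ₗ
        (LinearMap.toSpanSingleton (MvPolynomial ι ℂ) M v.1).restrictScalars ℂ) := by
    intro p m
    have hm : m ∈ Submodule.span (MvPolynomial ι ℂ) (s : Set M) := hs ▸ Submodule.mem_top
    induction hm using Submodule.span_induction generalizing p with
    | mem x hx =>
      obtain ⟨u, hu, hu'⟩ := h p
      refine Submodule.mem_iSup_of_mem ⟨x, hx⟩ ⟨u, hu, ?_⟩
      symm
      refine (Submodule.Quotient.eq F).2 ?_
      have := Submodule.smul_mem_smul hu' (Submodule.mem_top (x := x))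
      simpa [sub_smul] using this
    | zero => simp
    | add x y _ _ hx hy => rw [smul_add, map_add]; exact add_mem (hx p) (hy p)
    | smul q x _ hx => rw [smul_smul]; exact hx _
  refine ⟨?_⟩
  have : (⊤ : Submodule ℂ (M ⧸ F)) = ⨆ v : s, U.map ((F.mkQ.restrictScalars ℂ) ∘ₗ
      (LinearMap.toSpanSingleton (MvPolynomial ι ℂ) M v.1).restrictScalars ℂ) := by
    refine (eq_top_iff.2 fun x _ => ?_).symm
    obtain ⟨m, rfl⟩ := F.mkQ_surjective x
    simpa using key 1 m
  rw [this]
  exact Submodule.fg_iSup _ fun v => hU.map _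

end PolynomialRing

/-! ### Triangular data with an Euler element -/

open MvPolynomial in
/-- An algebra generated by two polynomial algebras and a finite group, with an Euler element. -/
structure TriangularData (A : Type*) [Ring A] [Algebra ℂ A] (ι G : Type*) [Fintype ι]
    [Group G] where
  /-- the polynomial algebra of positive weight -/
  φ : MvPolynomial ι ℂ →ₐ[ℂ] A
  /-- the polynomial algebra of negative weight -/
  ψ : MvPolynomial ι ℂ →ₐ[ℂ] A
  /-- the group -/
  w : G →* A
  /-- the group part of the Euler element -/
  κ : A
  w_φ : ∀ g i, ∃ m : ι → ℂ, w g * φ (X i) = φ (∑ j, m j • X j) * w g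
  w_ψ : ∀ g i, ∃ m : ι → ℂ, w g * ψ (X i) = ψ (∑ j, m j • X j) * w g
  comm : ∀ i j, ψ (X i) * φ (X j) - φ (X j) * ψ (X i) ∈ Submodule.span ℂ (Set.range w)
  κ_mem : κ ∈ Submodule.span ℂ (Set.range w)
  euler_φ : ∀ i, (∑ j, φ (X j) * ψ (X j) + κ) * φ (X i) =
    φ (X i) * (∑ j, φ (X j) * ψ (X j) + κ) + φ (X i)
  euler_ψ : ∀ i, (∑ j, φ (X j) * ψ (X j) + κ) * ψ (X i) =
    ψ (X i) * (∑ j, φ (X j) * ψ (X j) + κ) - ψ (X i)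
  generate : Algebra.adjoin ℂ
    (Set.range (fun i => φ (X i)) ∪ Set.range (fun i => ψ (X i)) ∪ Set.range w) = ⊤

namespace TriangularData

open MvPolynomial

variable {A : Type*} [Ring A] [Algebra ℂ A] {ι G : Type*} [Fintype ι] [Group G]
  (T : TriangularData A ι G)

/-- The Euler element. -/
def δ : A := ∑ j, T.φ (X j) * T.ψ (X j) + T.κ

theorem δ_φ (i : ι) : T.δ * T.φ (X i) = T.φ (X i) * (T.δ + 1) := by
  rw [mul_add, mul_one]; exact T.euler_φ i

theorem ψ_δ (i : ι) : T.ψ (X i) * T.δ = (T.δ + 1) * T.ψ (X i) := by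
  have := T.euler_ψ i
  rw [add_mul, one_mul, δ, this, sub_add_cancel]

/-- Multiplication by a positive generator raises the weight by one, at the level of polynomials in
`δ`; no eigenvectors have to exist. -/
theorem aeval_δ_φ (p : Polynomial ℂ) (i : ι) :
    Polynomial.aeval T.δ p * T.φ (X i) = T.φ (X i) * Polynomial.aeval (T.δ + 1) p := by
  have h : SemiconjBy (T.φ (X i)) (T.δ + 1) T.δ := (T.δ_φ i).symm
  induction p using Polynomial.induction_on' with
  | add p q hp hq => simp [add_mul, mul_add, hp, hq]
  | monomial n z =>
    simp only [Polynomial.aeval_monomial]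
    rw [mul_assoc, ← (h.pow_right n).eq, ← mul_assoc, ← mul_assoc, Algebra.commutes]

theorem w_inv_mul (g : G) : T.w g⁻¹ * T.w g = 1 := by rw [← map_mul]; simp

theorem w_mul_inv (g : G) : T.w g * T.w g⁻¹ = 1 := by rw [← map_mul]; simp

theorem φ_w (g : G) (i : ι) : ∃ m : ι → ℂ, T.φ (X i) * T.w g = T.w g * T.φ (∑ j, m j • X j) := by
  obtain ⟨m, hm⟩ := T.w_φ g⁻¹ i
  refine ⟨m, ?_⟩
  have : T.w g * (T.w g⁻¹ * T.φ (X i)) * T.w g = T.w g * (T.φ (∑ j, m j • X j) * T.w g⁻¹) * T.w g := by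
    rw [hm]
  rwa [← mul_assoc, w_mul_inv, one_mul, mul_assoc, mul_assoc, w_inv_mul, mul_one] at this

theorem ψ_w (g : G) (i : ι) : ∃ m : ι → ℂ, T.ψ (X i) * T.w g = T.w g * T.ψ (∑ j, m j • X j) := by
  obtain ⟨m, hm⟩ := T.w_ψ g⁻¹ i
  refine ⟨m, ?_⟩
  have : T.w g * (T.w g⁻¹ * T.ψ (X i)) * T.w g = T.w g * (T.ψ (∑ j, m j • X j) * T.w g⁻¹) * T.w g := by
    rw [hm]
  rwa [← mul_assoc, w_mul_inv, one_mul, mul_assoc, mul_assoc, w_inv_mul, mul_one] at this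

/-- An additive subgroup stable under the generators is stable under the algebra. -/
theorem smul_mem_of_generators {M : Type*} [AddCommGroup M] [Module ℂ M] [Module A M]
    [IsScalarTower ℂ A M] (N : Submodule ℂ M)
    (hφ : ∀ i, ∀ m ∈ N, T.φ (X i) • m ∈ N) (hψ : ∀ i, ∀ m ∈ N, T.ψ (X i) • m ∈ N)
    (hw : ∀ g, ∀ m ∈ N, T.w g • m ∈ N) (a : A) : ∀ m ∈ N, a • m ∈ N := by
  have ha : a ∈ Algebra.adjoin ℂ
    (Set.range (fun i => T.φ (X i)) ∪ Set.range (fun i => T.ψ (X i)) ∪ Set.range T.w) :=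
    T.generate ▸ Algebra.mem_top
  induction ha using Algebra.adjoin_induction with
  | mem x hx =>
    rcases hx with (⟨i, rfl⟩ | ⟨i, rfl⟩) | ⟨g, rfl⟩
    exacts [hφ i, hψ i, hw g]
  | algebraMap r => intro m hm; rw [algebraMap_smul]; exact N.smul_mem _ hm
  | add x y _ _ hx hy => intro m hm; rw [add_smul]; exact N.add_mem (hx m hm) (hy m hm)
  | mul x y _ _ hx hy => intro m hm; rw [mul_smul]; exact hx _ (hy m hm)

/-! ### Action of the generators on the adic filtration -/

section Filtration

set_option linter.unusedSectionVars false

variable {M : Type*} [AddCommGroup M] [Module ℂ M] [Module A M] [IsScalarTower ℂ A M]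
  [Module (MvPolynomial ι ℂ) M]

/-- The polynomial ring acts on the `A`-module `M` through `φ`. -/
def Compatible (M : Type*) [AddCommGroup M] [Module A M] [Module (MvPolynomial ι ℂ) M] : Prop :=
  ∀ (p : MvPolynomial ι ℂ) (m : M), p • m = T.φ p • m

variable (ι M) in
/-- The adic filtration of the augmentation ideal. -/
def fil (n : ℕ) : Submodule (MvPolynomial ι ℂ) M := augIdeal ι ^ n • ⊤

theorem fil_succ (n : ℕ) : fil ι M (n + 1) = augIdeal ι • fil ι M n := by
  rw [fil, fil, pow_succ', Submodule.mul_smul]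

theorem fil_zero : fil ι M 0 = ⊤ := by simp [fil]

theorem fil_antitone : Antitone (fil ι M) := fun _ _ h =>
  Submodule.smul_mono_left (Ideal.pow_le_pow_right h)

variable {T}

theorem Compatible.isScalarTower (hT : T.Compatible M) : IsScalarTower ℂ (MvPolynomial ι ℂ) M :=
  ⟨fun z p m => by rw [hT, hT, map_smul, smul_assoc]⟩

theorem Compatible.fil_smul (hT : T.Compatible M) {n : ℕ} (z : ℂ) {m : M} (hm : m ∈ fil ι M n) : z • m ∈ fil ι M n := by
  have : z • m = (C z : MvPolynomial ι ℂ) • m := by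
    rw [hT, ← algebraMap_eq, AlgHom.commutes, algebraMap_smul]
  rw [this]; exact Submodule.smul_mem _ _ hm

theorem Compatible.mem_fil_succ (hT : T.Compatible M) {n : ℕ} {m : M} : m ∈ fil ι M (n + 1) ↔
    ∃ f : ι → M, (∀ i, f i ∈ fil ι M n) ∧ m = ∑ i, T.φ (X i) • f i := by
  have h : ∀ (i : ι) (m : M), (X i : MvPolynomial ι ℂ) • m = T.φ (X i) • m := fun i => hT (X i)
  simp_rw [fil_succ, mem_augIdeal_smul, h]

theorem Compatible.φ_fil (hT : T.Compatible M) {n : ℕ} (i : ι) {m : M} (hm : m ∈ fil ι M n) :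
    T.φ (X i) • m ∈ fil ι M (n + 1) := by
  rw [← hT, fil_succ]; exact Submodule.smul_mem_smul (X_mem_augIdeal i) hm

theorem Compatible.w_fil (hT : T.Compatible M) {n : ℕ} (g : G) {m : M} (hm : m ∈ fil ι M n) :
    T.w g • m ∈ fil ι M n := by
  induction n generalizing m with
  | zero => simp [fil_zero]
  | succ n ih =>
    obtain ⟨f, hf, rfl⟩ := hT.mem_fil_succ.1 hm
    rw [Finset.smul_sum]
    refine Submodule.sum_mem _ fun i _ => ?_
    obtain ⟨c, hc⟩ := T.w_φ g i
    rw [smul_smul, hc, map_sum, Finset.sum_mul, Finset.sum_smul]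
    refine Submodule.sum_mem _ fun j _ => ?_
    rw [map_smul, smul_mul_assoc, smul_assoc, mul_smul]
    exact hT.fil_smul _ (hT.φ_fil j (ih (hf i)))

theorem Compatible.span_w_fil (hT : T.Compatible M) {n : ℕ} {k : A} (hk : k ∈ Submodule.span ℂ (Set.range T.w)) {m : M}
    (hm : m ∈ fil ι M n) : k • m ∈ fil ι M n := by
  induction hk using Submodule.span_induction with
  | mem x hx => obtain ⟨g, rfl⟩ := hx; exact hT.w_fil g hm
  | zero => simp
  | add x y _ _ hx hy => rw [add_smul]; exact add_mem hx hy
  | smul z x _ hx => rw [smul_assoc]; exact hT.fil_smul _ hx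

/-- Commuting `ψ` past one factor `φ` leaves a group term, which preserves the filtration. The loss
is thus one step, exactly what a `φ` regains, so `δ` preserves every step. -/
theorem Compatible.ψ_fil (hT : T.Compatible M) {n : ℕ} (i : ι) {m : M} (hm : m ∈ fil ι M (n + 1)) :
    T.ψ (X i) • m ∈ fil ι M n := by
  induction n generalizing m with
  | zero => simp [fil_zero]
  | succ n ih =>
    obtain ⟨f, hf, rfl⟩ := hT.mem_fil_succ.1 hm
    rw [Finset.smul_sum]
    refine Submodule.sum_mem _ fun j _ => ?_
    have : T.ψ (X i) • T.φ (X j) • f j = T.φ (X j) • T.ψ (X i) • f j +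
        (T.ψ (X i) * T.φ (X j) - T.φ (X j) * T.ψ (X i)) • f j := by
      rw [sub_smul, mul_smul, mul_smul]; abel
    rw [this]
    exact add_mem (hT.φ_fil j (ih (hf j))) (hT.span_w_fil (T.comm i j) (hf j))

theorem Compatible.δ_fil (hT : T.Compatible M) {n : ℕ} {m : M} (hm : m ∈ fil ι M n) : T.δ • m ∈ fil ι M n := by
  rw [δ, add_smul, Finset.sum_smul]
  refine add_mem (Submodule.sum_mem _ fun i _ => ?_) (hT.span_w_fil T.κ_mem hm)
  rw [mul_smul]
  cases n with
  | zero => simp [fil_zero]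
  | succ n => exact hT.φ_fil i (hT.ψ_fil i hm)

/-- Shifting a polynomial by `k` compensates for the weight of `𝔪 ^ k`. -/
theorem Compatible.aeval_comp_fil (hT : T.Compatible M) {p : Polynomial ℂ}
    (hp : ∀ m : M, Polynomial.aeval T.δ p • m ∈ fil ι M 1) (k : ℕ) {m : M}
    (hm : m ∈ fil ι M k) :
    Polynomial.aeval T.δ (p.comp (Polynomial.X - Polynomial.C (k : ℂ))) • m ∈ fil ι M (k + 1) := by
  induction k generalizing m with
  | zero => simpa using hp m
  | succ k ih =>
    obtain ⟨f, hf, rfl⟩ := hT.mem_fil_succ.1 hm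
    rw [Finset.smul_sum]
    refine Submodule.sum_mem _ fun j _ => ?_
    have : Polynomial.aeval (T.δ + 1) (p.comp (Polynomial.X - Polynomial.C ((k + 1 : ℕ) : ℂ))) =
        Polynomial.aeval T.δ (p.comp (Polynomial.X - Polynomial.C (k : ℂ))) := by
      simp only [Polynomial.aeval_comp]
      congr 1
      simp
    rw [smul_smul, T.aeval_δ_φ, this, mul_smul]
    exact hT.φ_fil j (ih (hf j))

end Filtration

end TriangularData

end

/-! ### Separatedness and finite length over the positive part -/

noncomputable section

namespace TriangularData

open MvPolynomial

variable {A : Type*} [Ring A] [Algebra ℂ A] {ι G : Type*} [Fintype ι] [Group G]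
  {T : TriangularData A ι G}

section

variable (T)

/-- Both sides are derivations in `p` that agree on the variables. The point is that annihilators of
`δ`-stable spaces become stable under the Euler field. -/
theorem δ_φ_sub (p : MvPolynomial ι ℂ) :
    T.δ * T.φ p - T.φ p * T.δ = T.φ (∑ i, X i * pderiv i p) := by
  induction p using MvPolynomial.induction_on with
  | C z =>
    rw [← algebraMap_eq, AlgHom.commutes, Algebra.commutes]
    simp
  | add p q hp hq =>
    simp only [map_add, mul_add, add_mul, Finset.sum_add_distrib, ← hp, ← hq]
    abel
  | mul_X p j hp =>
    have h1 : ∑ i, X i * pderiv i (p * X j) = (∑ i, X i * pderiv i p) * X j + p * X j := by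
      classical
      simp only [Derivation.leibniz, pderiv_X, smul_eq_mul, mul_add, Finset.sum_add_distrib]
      rw [add_comm]
      congr 1
      · rw [Finset.sum_mul]
        exact Finset.sum_congr rfl fun i _ => by ring
      · rw [Finset.sum_eq_single j]
        · simp [mul_comm]
        · intro i _ hij; simp [hij.symm]
        · simp
    have h2 : T.δ * T.φ (p * X j) - T.φ (p * X j) * T.δ =
        (T.δ * T.φ p - T.φ p * T.δ) * T.φ (X j) +
          T.φ p * (T.δ * T.φ (X j) - T.φ (X j) * T.δ) := by
      rw [map_mul]; noncomm_ring
    rw [h1, h2, hp, T.δ_φ, mul_add, mul_one, add_sub_cancel_left]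
    simp only [map_add, map_mul]

/-- The span of the image of a finite group is a finite-dimensional subalgebra. The resulting
polynomial bounds the possible lowest weights. -/
theorem isIntegral_κ [Finite G] : IsIntegral ℂ T.κ := by
  have h : Subalgebra.toSubmodule (Algebra.adjoin ℂ (Set.range T.w)) =
      Submodule.span ℂ (Set.range T.w) := by
    refine Algebra.adjoin_eq_span_of_subset _ ?_
    rw [← MonoidHom.coe_mrange, Submonoid.closure_eq]
    exact Submodule.subset_span
  refine IsIntegral.of_mem_of_fg _ (h ▸ Submodule.fg_span (Set.finite_range _)) _ ?_
  rw [← Subalgebra.mem_toSubmodule, h]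
  exact T.κ_mem

end

/-- An Euler-stable space of polynomials which contains a polynomial with constant term `1`
contains `1`. -/
theorem one_mem_of_euler_stable (N : Submodule ℂ (MvPolynomial ι ℂ))
    (hN : ∀ p ∈ N, ∑ i, X i * pderiv i p ∈ N) {r : MvPolynomial ι ℂ} (hr : r ∈ N)
    (h1 : constantCoeff r = 1) : (1 : MvPolynomial ι ℂ) ∈ N := by
  set D : Module.End ℂ (MvPolynomial ι ℂ) :=
    ∑ i, LinearMap.mulLeft ℂ (X i) ∘ₗ (pderiv i).toLinearMap with hD
  have hDa : ∀ p, D p = ∑ i, X i * pderiv i p := fun p => by simp [hD]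
  have hq : ∀ q : Polynomial ℂ, Polynomial.aeval D q r ∈ N := by
    intro q
    induction q using Polynomial.induction_on with
    | C z => simpa using N.smul_mem z hr
    | add p q hp hq => simpa using N.add_mem hp hq
    | monomial k z ih =>
      rw [pow_succ', ← mul_assoc, mul_comm _ Polynomial.X, mul_assoc, map_mul, Polynomial.aeval_X,
        Module.End.mul_apply, hDa]
      exact hN _ ih
  set d := r.totalDegree
  -- The roots `1, …, d` are the positive degrees that may occur in `r`, and `0` is not a root:
  -- `q(D)` isolates the constant term.
  set q : Polynomial ℂ := ∏ j ∈ Finset.range d, (Polynomial.X - Polynomial.C ((j + 1 : ℕ) : ℂ))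
  have hev : ∀ i, Polynomial.aeval D q (homogeneousComponent i r) =
      q.eval (i : ℂ) • homogeneousComponent i r := fun i =>
    Module.End.aeval_apply_of_mem_apply_eq_smul (by
      rw [hDa, (homogeneousComponent_isHomogeneous i r).sum_X_mul_pderiv, Nat.cast_smul_eq_nsmul])
  have hsum : Polynomial.aeval D q r = q.eval 0 • 1 := by
    conv_lhs => rw [← sum_homogeneousComponent r]
    rw [map_sum, Finset.sum_eq_single 0]
    · rw [hev, homogeneousComponent_zero, ← constantCoeff_eq, h1]; simp
    · intro i hi h0
      rw [hev]
      have : q.eval (i : ℂ) = 0 := by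
        rw [Polynomial.eval_prod]
        refine Finset.prod_eq_zero (i := i - 1) (by simp at hi ⊢; omega) ?_
        rw [Nat.sub_add_cancel (by omega)]; simp
      rw [this, zero_smul]
    · simp
  have hq0 : q.eval 0 ≠ 0 := by
    rw [Polynomial.eval_prod, Finset.prod_ne_zero_iff]
    intro j _
    simp only [Polynomial.eval_sub, Polynomial.eval_X, Polynomial.eval_C, zero_sub, ne_eq,
      neg_eq_zero, Nat.cast_eq_zero]
    omega
  have := N.smul_mem (q.eval 0)⁻¹ (hq q)
  rwa [hsum, smul_smul, inv_mul_cancel₀ hq0, one_smul] at this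

section Module

set_option linter.unusedSectionVars false

variable {M : Type*} [AddCommGroup M] [Module ℂ M] [Module A M] [IsScalarTower ℂ A M]
  [Module (MvPolynomial ι ℂ) M]

/-- A finitely generated module is separated in the adic topology. -/
theorem Compatible.iInf_fil (hT : T.Compatible M) [Module.Finite (MvPolynomial ι ℂ) M] :
    ⨅ n, fil ι M n = ⊥ := by
  set J := ⨅ n, fil ι M n with hJ
  have hmem : ∀ {m : M}, m ∈ J ↔ ∀ n, m ∈ fil ι M n := by simp [hJ]
  -- Krull's intersection theorem: each `m ∈ J` satisfies `r m = m` for some `r` in the augmentation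
  -- ideal.
  have hle : J ≤ augIdeal ι • J := by
    intro m hm
    obtain ⟨r, hr⟩ := ((augIdeal ι).mem_iInf_smul_pow_eq_bot_iff m).1 hm
    rw [← hr]
    exact Submodule.smul_mem_smul r.2 hm
  have : IsNoetherian (MvPolynomial ι ℂ) M := isNoetherian_of_isNoetherianRing_of_finite _ _
  obtain ⟨r, hr1, hr⟩ := Submodule.exists_sub_one_mem_and_smul_eq_zero_of_fg_of_le_smul _ J
    (IsNoetherian.noetherian J) hle
  let JC : Submodule ℂ M :=
    { carrier := J, add_mem' := J.add_mem, zero_mem' := J.zero_mem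
      smul_mem' := fun z m hm => hmem.2 fun n => hT.fil_smul z (hmem.1 hm n) }
  have hst := T.smul_mem_of_generators JC
    (fun i m hm => hmem.2 fun n => fil_antitone n.le_succ (hT.φ_fil i (hmem.1 hm n)))
    (fun i m hm => hmem.2 fun n => hT.ψ_fil i (hmem.1 hm (n + 1)))
    (fun g m hm => hmem.2 fun n => hT.w_fil g (hmem.1 hm n))
  -- Nakayama only yields an annihilating `r` with constant term `1`, since the ring is not local.
  -- The annihilator of the `A`-stable space `J` is Euler-stable, which upgrades `r` to `1`.
  let N : Submodule ℂ (MvPolynomial ι ℂ) :=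
    { carrier := {p | ∀ m ∈ J, T.φ p • m = 0}
      add_mem' := fun {p q} hp hq m hm => by rw [map_add, add_smul, hp m hm, hq m hm, add_zero]
      zero_mem' := fun m _ => by simp
      smul_mem' := fun z p hp m hm => by rw [map_smul, smul_assoc, hp m hm, smul_zero] }
  have hone : (1 : MvPolynomial ι ℂ) ∈ N := by
    refine one_mem_of_euler_stable N (fun p hp m hm => ?_) (r := r)
      (fun m hm => by rw [← hT]; exact hr m hm) ?_
    · rw [← T.δ_φ_sub, sub_smul, mul_smul, mul_smul, hp m hm, hp _ (hst T.δ m hm)]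
      simp
    · have := mem_augIdeal_iff.1 hr1
      simpa [sub_eq_zero] using this
  refine (Submodule.eq_bot_iff _).2 fun m hm => ?_
  simpa using hone m hm

theorem fil_aeval {n : ℕ} (hT : T.Compatible M) {a : A}
    (ha : ∀ m ∈ fil ι M n, a • m ∈ fil ι M n) (p : Polynomial ℂ) {m : M} (hm : m ∈ fil ι M n) :
    Polynomial.aeval a p • m ∈ fil ι M n := by
  induction p using Polynomial.induction_on with
  | C z => rw [Polynomial.aeval_C, algebraMap_smul]; exact hT.fil_smul _ hm
  | add p q hp hq => rw [map_add, add_smul]; exact add_mem hp hq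
  | monomial k z ih =>
    rw [pow_succ', ← mul_assoc, mul_comm _ Polynomial.X, mul_assoc, map_mul, Polynomial.aeval_X,
      mul_smul]
    exact ha _ ih

/-- If `v` is an eigenvector of `a` modulo the filtration, so it is for polynomials in `a`. -/
theorem fil_aeval_sub_eval {n : ℕ} (hT : T.Compatible M) {a : A}
    (ha : ∀ m ∈ fil ι M n, a • m ∈ fil ι M n) {z : ℂ} {v : M} (hv : a • v - z • v ∈ fil ι M n)
    (p : Polynomial ℂ) : Polynomial.aeval a p • v - p.eval z • v ∈ fil ι M n := by
  obtain ⟨h, hh⟩ := Polynomial.X_sub_C_dvd_sub_C_eval (a := z) (p := p)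
  have h1 := congrArg (fun r => Polynomial.aeval a r • v) hh
  simp only [mul_comm _ h, map_sub, map_mul, Polynomial.aeval_C, Polynomial.aeval_X, sub_smul,
    mul_smul, algebraMap_smul] at h1
  rw [h1]
  exact fil_aeval hT ha h hv

theorem fil_of_smul {n : ℕ} (hT : T.Compatible M) {z : ℂ} (hz : z ≠ 0) {v : M}
    (hv : z • v ∈ fil ι M n) : v ∈ fil ι M n := by
  have := hT.fil_smul z⁻¹ hv
  rwa [smul_smul, inv_mul_cancel₀ hz, one_smul] at this

/-- The operator `δ - z` is injective on all quotients of `Q` by the adic filtration. -/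
def Regular (T : TriangularData A ι G) (Q : Submodule A M) (z : ℂ) : Prop :=
  ∀ k, ∀ v ∈ Q, T.δ • v - z • v ∈ fil ι M k → v ∈ fil ι M k

theorem Regular.pow {Q : Submodule A M} {z : ℂ} (h : T.Regular Q z) {k : ℕ} (m : ℕ) {v : M}
    (hv : v ∈ Q) (hz : Polynomial.aeval T.δ ((Polynomial.X - Polynomial.C z) ^ m) • v ∈ fil ι M k) :
    v ∈ fil ι M k := by
  induction m with
  | zero => simpa using hz
  | succ m ih =>
    refine ih (h k _ (Q.smul_mem _ hv) ?_)
    rw [pow_succ', map_mul, mul_smul] at hz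
    simpa [sub_smul, algebraMap_smul] using hz

/-- On an eigenvector modulo `𝔪ᵏM` the operator `g(δ)` is the nonzero scalar `g(z)`, yet it maps `Q`
into `𝔪ᵏM`. -/
theorem Regular.of_aeval (hT : T.Compatible M) {Q : Submodule A M} {z : ℂ}
    (hg : ∀ k, ∃ g : Polynomial ℂ, g.eval z ≠ 0 ∧
      ∀ v ∈ Q, Polynomial.aeval T.δ g • v ∈ fil ι M k) : T.Regular Q z := by
  intro k v hv h
  obtain ⟨g, hgz, hg⟩ := hg k
  have := fil_aeval_sub_eval hT (fun m hm => hT.δ_fil hm) h g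
  exact fil_of_smul hT hgz ((Submodule.sub_mem_iff_right _ (hg v hv)).1 this)

/-- If the weight `z - 1` is absent, vectors of weight `z` are killed by every `ψ`, so `δ` acts on
them as `κ`; then `z` would be a root of `q`. -/
theorem Regular.step (hT : T.Compatible M) {Q : Submodule A M} {z : ℂ}
    (h : T.Regular Q (z - 1)) {q : Polynomial ℂ} (hq : Polynomial.aeval T.κ q = 0)
    (hqz : q.eval z ≠ 0) (hg : ∀ k, ∃ g : Polynomial ℂ, g ≠ 0 ∧
      ∀ v ∈ Q, Polynomial.aeval T.δ g • v ∈ fil ι M k) : T.Regular Q z := by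
  intro k v hv hz
  -- One step beyond `k`, because `ψ` will lower the filtration by one.
  obtain ⟨g, hg0, hg⟩ := hg (k + 1)
  obtain ⟨f, hgf, hf⟩ := Polynomial.exists_eq_pow_rootMultiplicity_mul_and_not_dvd g hg0 z
  -- Applying `f(δ)` turns `v` into an honest generalized eigenvector modulo `𝔪ᵏ⁺¹M`, and changes it
  -- only by the nonzero scalar `f(z)` modulo `𝔪ᵏM`.
  rw [Polynomial.dvd_iff_isRoot, Polynomial.IsRoot.def] at hf
  set v' := Polynomial.aeval T.δ f • v with hv'
  have hv'Q : v' ∈ Q := Q.smul_mem _ hv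
  have h1 : v' - f.eval z • v ∈ fil ι M k :=
    fil_aeval_sub_eval hT (fun m hm => hT.δ_fil hm) hz f
  have h2 : ∀ i, T.ψ (X i) • v' ∈ fil ι M k := by
    intro i
    refine h.pow (g.rootMultiplicity z) (Q.smul_mem _ hv'Q) ?_
    have hcomm : Polynomial.aeval T.δ ((Polynomial.X - Polynomial.C (z - 1)) ^
        g.rootMultiplicity z) * T.ψ (X i) =
        T.ψ (X i) * Polynomial.aeval T.δ ((Polynomial.X - Polynomial.C z) ^
          g.rootMultiplicity z) := by
      have hs : SemiconjBy (T.ψ (X i)) (T.δ - algebraMap ℂ A z)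
          (T.δ - algebraMap ℂ A (z - 1)) := by
        simp only [SemiconjBy, mul_sub, sub_mul, T.ψ_δ, map_sub, map_one, add_mul,
          Algebra.commutes]
        abel
      simpa using (hs.pow_right (g.rootMultiplicity z)).eq.symm
    rw [smul_smul, hcomm, mul_smul]
    refine hT.ψ_fil i ?_
    rw [hv', smul_smul, ← map_mul, ← hgf]
    exact hg v hv
  -- All `ψ (X i) • v'` vanish modulo `𝔪ᵏM`, so only the group part of `δ` survives.
  have h3 : T.δ • v' - T.κ • v' ∈ fil ι M k := by
    rw [δ, add_smul, add_sub_cancel_right, Finset.sum_smul]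
    refine Submodule.sum_mem _ fun i _ => ?_
    rw [mul_smul]
    exact fil_antitone k.le_succ (hT.φ_fil i (h2 i))
  have h4 : T.δ • v' - z • v' ∈ fil ι M k := by
    have := fil_aeval hT (fun m hm => hT.δ_fil hm) f hz
    rw [smul_sub, smul_smul, smul_algebra_smul_comm] at this
    have hc : Polynomial.aeval T.δ f * T.δ = T.δ * Polynomial.aeval T.δ f := by
      simpa using congrArg (Polynomial.aeval T.δ) (mul_comm f Polynomial.X)
    rwa [hc, mul_smul] at this
  have h5 : T.κ • v' - z • v' ∈ fil ι M k := by
    have := sub_mem h4 h3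
    rwa [sub_sub_sub_cancel_left] at this
  have h6 := fil_aeval_sub_eval hT (fun m hm => hT.span_w_fil T.κ_mem hm) h5 q
  rw [hq, zero_smul, zero_sub, neg_mem_iff] at h6
  have h7 := fil_of_smul hT hqz h6
  exact fil_of_smul hT hf ((Submodule.sub_mem_iff_right _ h7).1 h1)

theorem finite_nat_roots {p : Polynomial ℂ} (hp : p ≠ 0) (z : ℂ) :
    {k : ℕ | p.eval (z - k) = 0}.Finite := by
  have h := p.roots.toFinset.finite_toSet
  refine (h.preimage (f := fun k : ℕ => z - (k : ℂ)) ?_).subset ?_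
  · intro a _ b _ hab
    simpa using hab
  · intro k hk
    simpa [hp] using hk

/-- Beyond some depth, the roots of `p` shifted upwards no longer meet the roots of `q`: each of the
finitely many pairs of roots excludes at most one shift. -/
theorem exists_forall_eval_sub_ne_zero {p q : Polynomial ℂ} (hp : p ≠ 0) (hq : q ≠ 0) :
    ∃ n : ℕ, ∀ k ≥ n, ∀ z, q.eval z = 0 → p.eval (z - k) ≠ 0 := by
  have h : (⋃ z ∈ q.roots.toFinset, {k : ℕ | p.eval (z - k) = 0}).Finite :=
    q.roots.toFinset.finite_toSet.biUnion fun z _ => finite_nat_roots hp z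
  obtain ⟨n, hn⟩ := h.bddAbove
  refine ⟨n + 1, fun k hk z hz h0 => ?_⟩
  have := hn (Set.mem_biUnion (show z ∈ (q.roots.toFinset : Set ℂ) by simpa [hq] using hz) h0)
  omega

/-- A submodule deep enough in the adic filtration vanishes. -/
theorem Compatible.eq_bot_of_le_fil (hT : T.Compatible M) [Module.Finite (MvPolynomial ι ℂ) M]
    {p q : Polynomial ℂ} (hp0 : p ≠ 0) (hp : ∀ m : M, Polynomial.aeval T.δ p • m ∈ fil ι M 1)
    (hq : Polynomial.aeval T.κ q = 0) {n : ℕ}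
    (hn : ∀ k ≥ n, ∀ z, q.eval z = 0 → p.eval (z - k) ≠ 0) (Q : Submodule A M)
    (hQ : ∀ v ∈ Q, v ∈ fil ι M n) : Q = ⊥ := by
  -- The factor with shift `n + j` moves `𝔪ⁿ⁺ʲM` one step deeper, so `g k` carries `Q` from `𝔪ⁿM`
  -- into `𝔪ⁿ⁺ᵏM`.
  set g : ℕ → Polynomial ℂ := fun k => ∏ j ∈ Finset.range k,
    p.comp (Polynomial.X - Polynomial.C ((n + j : ℕ) : ℂ)) with hg
  have hgQ' : ∀ k, ∀ v ∈ Q, Polynomial.aeval T.δ (g k) • v ∈ fil ι M (n + k) := by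
    intro k v hv
    induction k with
    | zero => simpa [hg] using hQ v hv
    | succ k ih =>
      simp only [hg, Finset.prod_range_succ]
      rw [mul_comm, map_mul, mul_smul]
      exact hT.aeval_comp_fil hp _ ih
  have hgQ : ∀ k, ∀ v ∈ Q, Polynomial.aeval T.δ (g k) • v ∈ fil ι M k := fun k v hv =>
    fil_antitone (Nat.le_add_left k n) (hgQ' k v hv)
  have hgev : ∀ k z, (g k).eval z = ∏ j ∈ Finset.range k, p.eval (z - (n + j : ℕ)) := by
    intro k z; simp [hg, Polynomial.eval_prod, Polynomial.eval_comp]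
  have hbase : ∀ z : ℂ, (∀ k : ℕ, k ≥ n → p.eval (z - k) ≠ 0) → T.Regular Q z := fun z hz =>
    Regular.of_aeval hT fun k => ⟨g k, by
      rw [hgev, Finset.prod_ne_zero_iff]; exact fun j _ => hz _ (Nat.le_add_right n j), hgQ k⟩
  have hg0 : ∀ k, g k ≠ 0 := by
    intro k
    rw [hg, Finset.prod_ne_zero_iff]
    intro j _ h0
    rw [Polynomial.comp_eq_zero_iff] at h0
    rcases h0 with h0 | ⟨-, h0⟩
    · exact hp0 h0
    · have := congrArg (Polynomial.coeff · 1) h0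
      simp at this
  -- Eigenvalues of `κ` are covered by the choice of `n`, all other `z` by the lowest weight
  -- argument.
  have hstep : ∀ z, T.Regular Q (z - 1) → T.Regular Q z := by
    intro z hz
    by_cases hqz : q.eval z = 0
    · exact hbase z fun k hk => hn k hk z hqz
    · exact hz.step hT hq hqz fun k => ⟨g k, hg0 k, hgQ k⟩
  have hdesc : ∀ (j : ℕ) z, T.Regular Q (z - j) → T.Regular Q z := by
    intro j
    induction j with
    | zero => intro z hz; simpa using hz
    | succ j ih =>
      intro z hz
      refine ih z (hstep _ ?_)
      convert hz using 1
      push_cast; ring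
  -- Far enough below `z` no shift of `p` vanishes; from there regularity climbs back in unit steps.
  have hreg : ∀ z, T.Regular Q z := by
    intro z
    obtain ⟨b, hb⟩ := (finite_nat_roots hp0 z).bddAbove
    refine hdesc (b + 1) z (hbase _ fun k _ h0 => ?_)
    have : b + 1 + k ≤ b := hb (show p.eval _ = 0 by push_cast at h0 ⊢; rw [← h0]; ring_nf)
    omega
  -- Splitting into linear factors, every nonzero polynomial in `δ` is injective on `Q` modulo
  -- `𝔪ᵏM`. Taking `g k`, which maps `Q` into `𝔪ᵏM`, forces `Q ⊆ 𝔪ᵏM` for all `k`.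
  have hpeel : ∀ (d : ℕ) (f : Polynomial ℂ), f ≠ 0 → f.natDegree = d → ∀ k, ∀ v ∈ Q,
      Polynomial.aeval T.δ f • v ∈ fil ι M k → v ∈ fil ι M k := by
    intro d
    induction d with
    | zero =>
      intro f hf hd k v _ h
      rw [Polynomial.natDegree_eq_zero] at hd
      obtain ⟨z, rfl⟩ := hd
      rw [Polynomial.aeval_C, algebraMap_smul] at h
      exact fil_of_smul hT (by simpa using hf) h
    | succ d ih =>
      intro f hf hd k v hv h
      obtain ⟨z, hz⟩ := IsAlgClosed.exists_root f (by
        rw [Polynomial.degree_eq_natDegree hf, hd]; exact_mod_cast d.succ_ne_zero)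
      obtain ⟨f', rfl⟩ := Polynomial.dvd_iff_isRoot.2 hz
      have hf' : f' ≠ 0 := right_ne_zero_of_mul hf
      rw [Polynomial.natDegree_mul (Polynomial.X_sub_C_ne_zero z) hf',
        Polynomial.natDegree_X_sub_C] at hd
      refine ih f' hf' (by omega) k v hv (hreg z k _ (Q.smul_mem _ hv) ?_)
      rw [map_mul, mul_smul] at h
      simpa [sub_smul, algebraMap_smul] using h
  refine (Submodule.eq_bot_iff _).2 fun v hv => ?_
  have : v ∈ ⨅ n, fil ι M n :=
    (Submodule.mem_iInf _).2 fun k => hpeel _ (g k) (hg0 k) rfl k v hv (hgQ k v hv)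
  rwa [hT.iInf_fil] at this

theorem map_mem_fil {M' : Type*} [AddCommGroup M'] [Module ℂ M'] [Module A M'] [IsScalarTower ℂ A M']
    [Module (MvPolynomial ι ℂ) M'] (hT : T.Compatible M) (hT' : T.Compatible M')
    (f : M →ₗ[A] M') {n : ℕ} {m : M} (hm : m ∈ fil ι M n) : f m ∈ fil ι M' n := by
  induction n generalizing m with
  | zero => simp [fil_zero]
  | succ n ih =>
    obtain ⟨v, hv, rfl⟩ := hT.mem_fil_succ.1 hm
    rw [map_sum]
    refine Submodule.sum_mem _ fun i _ => ?_
    rw [map_smul]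
    exact hT'.φ_fil i (ih (hv i))

/-- Some polynomial in the Euler element maps `M` into `𝔪 M`. -/
theorem Compatible.exists_aeval_mem_fil (hT : T.Compatible M)
    [Module.Finite (MvPolynomial ι ℂ) M] :
    ∃ p : Polynomial ℂ, p ≠ 0 ∧ ∀ m : M, Polynomial.aeval T.δ p • m ∈ fil ι M 1 := by
  have := hT.isScalarTower
  have hfin : Module.Finite ℂ (M ⧸ fil ι M 1) := finite_quotient_augIdeal_pow_smul 1
  let FC : Submodule ℂ M := (fil ι M 1).restrictScalars ℂ
  let D : M →ₗ[ℂ] M := Algebra.lsmul ℂ ℂ M T.δ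
  let D' : Module.End ℂ (M ⧸ FC) := FC.mapQ FC D fun m hm => hT.δ_fil hm
  have hfin' : Module.Finite ℂ (M ⧸ FC) := hfin
  refine ⟨minpoly ℂ D', minpoly.ne_zero (Algebra.IsIntegral.isIntegral D'), fun m => ?_⟩
  have key : ∀ p : Polynomial ℂ, Polynomial.aeval D' p (FC.mkQ m) =
      FC.mkQ (Polynomial.aeval T.δ p • m) := by
    intro p
    induction p using Polynomial.induction_on with
    | C z => simp [Module.algebraMap_end_apply]
    | add p q hp hq => simp only [map_add, add_smul, LinearMap.add_apply, hp, hq]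
    | monomial k z ih =>
      rw [pow_succ', ← mul_assoc, mul_comm _ Polynomial.X, mul_assoc, map_mul,
        map_mul (Polynomial.aeval T.δ) Polynomial.X, Polynomial.aeval_X, Polynomial.aeval_X,
        Module.End.mul_apply, ih, mul_smul]
      rfl
  have h0 := key (minpoly ℂ D')
  rw [minpoly.aeval, LinearMap.zero_apply] at h0
  exact (Submodule.Quotient.mk_eq_zero FC).1 h0.symm

/-- A module which is finitely generated over the positive polynomial algebra has finite length. -/
theorem Compatible.isFiniteLength [Finite G] (hT : T.Compatible M)
    [Module.Finite (MvPolynomial ι ℂ) M] : IsFiniteLength A M := by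
  have := hT.isScalarTower
  obtain ⟨p, hp0, hp⟩ := hT.exists_aeval_mem_fil
  -- This `n` depends only on `p` and `κ`, and `p` keeps its property on quotients of `M`, so the
  -- same `n` serves every `M ⧸ N`.
  obtain ⟨n, hn⟩ := exists_forall_eval_sub_ne_zero hp0 (minpoly.ne_zero T.isIntegral_κ)
  have hfin : Module.Finite ℂ (M ⧸ fil ι M n) := finite_quotient_augIdeal_pow_smul n
  let FC : Submodule ℂ M := (fil ι M n).restrictScalars ℂ
  have hfin' : Module.Finite ℂ (M ⧸ FC) := hfin
  let F : Submodule A M → Submodule ℂ (M ⧸ FC) := fun N => (N.restrictScalars ℂ).map FC.mkQ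
  have hF : StrictMono F := by
    intro N N' h
    refine lt_of_le_of_ne (Submodule.map_mono (fun x hx => h.le hx)) fun heq => ?_
    let _ : Module (MvPolynomial ι ℂ) (M ⧸ N) := Module.compHom _ T.φ.toRingHom
    have hTN : T.Compatible (M ⧸ N) := fun _ _ => rfl
    have hfinN : Module.Finite (MvPolynomial ι ℂ) (M ⧸ N) := by
      let f : M →ₗ[MvPolynomial ι ℂ] M ⧸ N :=
        { toFun := N.mkQ, map_add' := map_add _
          map_smul' := fun p m => by rw [hT, hTN, map_smul]; rfl }
      exact Module.Finite.of_surjective f N.mkQ_surjective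
    -- Equal images in `M/𝔪ⁿM` put `N'/N` inside `𝔪ⁿ(M/N)`, where only the zero submodule fits.
    have hbot : N'.map N.mkQ = ⊥ := by
      refine hTN.eq_bot_of_le_fil hp0 (fun m => ?_) (minpoly.aeval ℂ T.κ) hn _ ?_
      · obtain ⟨m, rfl⟩ := N.mkQ_surjective m
        rw [← map_smul]
        exact map_mem_fil hT hTN N.mkQ (hp m)
      · rintro _ ⟨v, hv, rfl⟩
        have : FC.mkQ v ∈ F N := heq ▸ ⟨v, hv, rfl⟩
        obtain ⟨v', hv', hvv⟩ := this
        have hd : v - v' ∈ fil ι M n := (Submodule.Quotient.eq FC).1 hvv.symm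
        have h0 : N.mkQ v' = 0 := (Submodule.Quotient.mk_eq_zero N).2 hv'
        have := map_mem_fil hT hTN N.mkQ hd
        rwa [map_sub, h0, sub_zero] at this
    rw [← le_bot_iff, Submodule.map_le_iff_le_comap, ← LinearMap.ker, Submodule.ker_mkQ] at hbot
    exact not_le_of_gt h hbot
  rw [isFiniteLength_iff_isNoetherian_isArtinian]
  refine ⟨?_, ?_⟩
  · rw [isNoetherian_iff']
    exact hF.wellFoundedGT
  · exact hF.wellFoundedLT

end Module

end TriangularData

end

/-! ### Opposite algebras and tensor products -/

noncomputable section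

open MvPolynomial IsMulCommutative in
/-- The algebra map from the polynomial ring given by commuting elements. -/
def commLift {A ι : Type*} [Ring A] [Algebra ℂ A] (x : ι → A)
    (hx : ∀ i j, x i * x j = x j * x i) : MvPolynomial ι ℂ →ₐ[ℂ] A :=
  haveI : IsMulCommutative (Algebra.adjoin ℂ (Set.range x)) := Algebra.isMulCommutative_adjoin ℂ (by
    rintro _ ⟨i, rfl⟩ _ ⟨j, rfl⟩; exact hx i j)
  (Algebra.adjoin ℂ (Set.range x)).val.comp
    (aeval fun i => (⟨x i, Algebra.subset_adjoin ⟨i, rfl⟩⟩ : Algebra.adjoin ℂ (Set.range x)))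

@[simp]
theorem commLift_X {A ι : Type*} [Ring A] [Algebra ℂ A] (x : ι → A)
    (hx : ∀ i j, x i * x j = x j * x i) (i : ι) : commLift x hx (MvPolynomial.X i) = x i := by
  simp [commLift]

namespace TriangularData

open MvPolynomial

variable {A : Type*} [Ring A] [Algebra ℂ A] {ι G : Type*} [Fintype ι] [Group G]

open MulOpposite in
/-- The opposite algebra, with the two polynomial algebras exchanged. -/
def op (T : TriangularData A ι G) : TriangularData Aᵐᵒᵖ ι Gᵐᵒᵖ where
  -- Reversing products turns `ψ δ = (δ + 1) ψ` into the relation of a raising generator, so the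
  -- same Euler element works only after exchanging the roles.
  φ := T.ψ.toOpposite fun p q => by
    rw [Commute, SemiconjBy, ← map_mul, mul_comm, map_mul]
  ψ := T.φ.toOpposite fun p q => by
    rw [Commute, SemiconjBy, ← map_mul, mul_comm, map_mul]
  w := MonoidHom.op T.w
  κ := MulOpposite.op T.κ
  w_φ g i := by
    obtain ⟨m, hm⟩ := T.ψ_w g.unop i
    refine ⟨m, unop_injective ?_⟩
    simpa using hm
  w_ψ g i := by
    obtain ⟨m, hm⟩ := T.φ_w g.unop i
    refine ⟨m, unop_injective ?_⟩
    simpa using hm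
  comm i j := by
    have h := Submodule.mem_map_of_mem (f := (opLinearEquiv ℂ (M := A)).toLinearMap) (T.comm j i)
    rw [Submodule.map_span, ← Set.range_comp] at h
    have e : Set.range (MonoidHom.op T.w) =
        Set.range ((opLinearEquiv ℂ (M := A)).toLinearMap ∘ T.w) := by
      ext x
      constructor
      · rintro ⟨g, rfl⟩; exact ⟨g.unop, rfl⟩
      · rintro ⟨g, rfl⟩; exact ⟨MulOpposite.op g, rfl⟩
    rw [e]
    exact h
  κ_mem := by
    have h := Submodule.mem_map_of_mem (f := (opLinearEquiv ℂ (M := A)).toLinearMap) T.κ_mem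
    rw [Submodule.map_span, ← Set.range_comp] at h
    have e : Set.range (MonoidHom.op T.w) =
        Set.range ((opLinearEquiv ℂ (M := A)).toLinearMap ∘ T.w) := by
      ext x
      constructor
      · rintro ⟨g, rfl⟩; exact ⟨g.unop, rfl⟩
      · rintro ⟨g, rfl⟩; exact ⟨MulOpposite.op g, rfl⟩
    rw [e]
    exact h
  euler_φ i := by
    apply unop_injective
    simpa [δ, add_mul, mul_add] using T.ψ_δ i
  euler_ψ i := by
    apply unop_injective
    have := T.δ_φ i
    rw [mul_add, mul_one, ← sub_eq_iff_eq_add] at this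
    simpa [δ] using this.symm
  generate := by
    have h := congrArg Subalgebra.op T.generate
    rw [Subalgebra.op_adjoin, Subalgebra.op_top] at h
    rw [← h]
    congr 1
    ext x
    simp only [Set.mem_union, Set.mem_range, Set.mem_preimage]
    constructor
    · rintro ((⟨i, rfl⟩ | ⟨i, rfl⟩) | ⟨g, rfl⟩)
      · exact Or.inl (Or.inr ⟨i, rfl⟩)
      · exact Or.inl (Or.inl ⟨i, rfl⟩)
      · exact Or.inr ⟨g.unop, rfl⟩
    · rintro ((⟨i, hi⟩ | ⟨i, hi⟩) | ⟨g, hg⟩)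
      · exact Or.inl (Or.inr ⟨i, unop_injective hi⟩)
      · exact Or.inl (Or.inl ⟨i, unop_injective hi⟩)
      · exact Or.inr ⟨MulOpposite.op g, unop_injective hg⟩

section Tensor

set_option linter.unusedSectionVars false

variable {B : Type*} [Ring B] [Algebra ℂ B] {ι' G' : Type*} [Fintype ι'] [Group G']

/-- The pair of commuting polynomial algebras in a tensor product. -/
def tensorLift (f : MvPolynomial ι ℂ →ₐ[ℂ] A) (g : MvPolynomial ι' ℂ →ₐ[ℂ] B) :
    MvPolynomial (ι ⊕ ι') ℂ →ₐ[ℂ] A ⊗[ℂ] B :=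
  commLift (Sum.elim (fun i => f (X i) ⊗ₜ 1) (fun i => 1 ⊗ₜ g (X i))) (by
    rintro (i | i) (j | j) <;>
      simp [Algebra.TensorProduct.tmul_mul_tmul, ← map_mul, mul_comm])

@[simp]
theorem tensorLift_X_inl (f : MvPolynomial ι ℂ →ₐ[ℂ] A) (g : MvPolynomial ι' ℂ →ₐ[ℂ] B) (i : ι) :
    tensorLift f g (X (Sum.inl i)) = f (X i) ⊗ₜ 1 := by
  simp [tensorLift]

@[simp]
theorem tensorLift_X_inr (f : MvPolynomial ι ℂ →ₐ[ℂ] A) (g : MvPolynomial ι' ℂ →ₐ[ℂ] B) (i : ι') :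
    tensorLift f g (X (Sum.inr i)) = 1 ⊗ₜ g (X i) := by
  simp [tensorLift]

theorem tensorLift_rename_inl (f : MvPolynomial ι ℂ →ₐ[ℂ] A) (g : MvPolynomial ι' ℂ →ₐ[ℂ] B)
    (p : MvPolynomial ι ℂ) : tensorLift f g (rename Sum.inl p) = f p ⊗ₜ 1 := by
  have : (tensorLift f g).comp (rename Sum.inl) = Algebra.TensorProduct.includeLeft.comp f := by
    ext i; simp
  exact DFunLike.congr_fun this p

theorem tensorLift_rename_inr (f : MvPolynomial ι ℂ →ₐ[ℂ] A) (g : MvPolynomial ι' ℂ →ₐ[ℂ] B)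
    (p : MvPolynomial ι' ℂ) : tensorLift f g (rename Sum.inr p) = 1 ⊗ₜ g p := by
  have : (tensorLift f g).comp (rename Sum.inr) = Algebra.TensorProduct.includeRight.comp g := by
    ext i; simp
  exact DFunLike.congr_fun this p

/-- The group of a tensor product. -/
def tensorGroup (f : G →* A) (g : G' →* B) : G × G' →* A ⊗[ℂ] B where
  toFun k := f k.1 ⊗ₜ g k.2
  map_one' := by simp [Algebra.TensorProduct.one_def]
  map_mul' := by simp

@[simp]
theorem tensorGroup_apply (f : G →* A) (g : G' →* B) (k : G × G') :
    tensorGroup f g k = f k.1 ⊗ₜ g k.2 := rfl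

theorem tmul_one_mem_span {f : G →* A} {g : G' →* B} {k : A}
    (hk : k ∈ Submodule.span ℂ (Set.range f)) :
    k ⊗ₜ[ℂ] (1 : B) ∈ Submodule.span ℂ (Set.range (tensorGroup f g)) := by
  induction hk using Submodule.span_induction with
  | mem x hx =>
    obtain ⟨i, rfl⟩ := hx
    exact Submodule.subset_span ⟨(i, 1), by simp⟩
  | zero => simp
  | add x y _ _ hx hy => rw [TensorProduct.add_tmul]; exact add_mem hx hy
  | smul z x _ hx => rw [← TensorProduct.smul_tmul']; exact Submodule.smul_mem _ _ hx

theorem one_tmul_mem_span {f : G →* A} {g : G' →* B} {k : B}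
    (hk : k ∈ Submodule.span ℂ (Set.range g)) :
    (1 : A) ⊗ₜ[ℂ] k ∈ Submodule.span ℂ (Set.range (tensorGroup f g)) := by
  induction hk using Submodule.span_induction with
  | mem x hx =>
    obtain ⟨i, rfl⟩ := hx
    exact Submodule.subset_span ⟨(1, i), by simp⟩
  | zero => simp
  | add x y _ _ hx hy => rw [TensorProduct.tmul_add]; exact add_mem hx hy
  | smul z x _ hx => rw [TensorProduct.tmul_smul]; exact Submodule.smul_mem _ _ hx

/-- The two summands act on different tensor factors, so the commutation relations of the sum reduce
to those of each factor. -/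
theorem tensor_euler (T : TriangularData A ι G) (S : TriangularData B ι' G') :
    (∑ j, tensorLift T.φ S.φ (X j) * tensorLift T.ψ S.ψ (X j) +
      (T.κ ⊗ₜ[ℂ] (1 : B) + (1 : A) ⊗ₜ[ℂ] S.κ)) = T.δ ⊗ₜ 1 + 1 ⊗ₜ S.δ := by
  simp only [Fintype.sum_sum_type, tensorLift_X_inl, tensorLift_X_inr,
    Algebra.TensorProduct.tmul_mul_tmul, mul_one, δ, TensorProduct.add_tmul,
    TensorProduct.tmul_add, TensorProduct.sum_tmul, TensorProduct.tmul_sum]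
  abel

/-- The tensor product of two algebras with triangular data. -/
def tensor (T : TriangularData A ι G) (S : TriangularData B ι' G') :
    TriangularData (A ⊗[ℂ] B) (ι ⊕ ι') (G × G') where
  φ := tensorLift T.φ S.φ
  ψ := tensorLift T.ψ S.ψ
  w := tensorGroup T.w S.w
  κ := T.κ ⊗ₜ 1 + 1 ⊗ₜ S.κ
  w_φ := by
    rintro ⟨g, h⟩ (i | i)
    · obtain ⟨m, hm⟩ := T.w_φ g i
      refine ⟨Sum.elim m 0, ?_⟩
      simp only [map_sum, map_smul] at hm
      simp [hm, Finset.sum_mul, TensorProduct.sum_tmul, TensorProduct.smul_tmul']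
    · obtain ⟨m, hm⟩ := S.w_φ h i
      refine ⟨Sum.elim 0 m, ?_⟩
      simp only [map_sum, map_smul] at hm
      simp [hm, Finset.sum_mul, TensorProduct.tmul_sum]
  w_ψ := by
    rintro ⟨g, h⟩ (i | i)
    · obtain ⟨m, hm⟩ := T.w_ψ g i
      refine ⟨Sum.elim m 0, ?_⟩
      simp only [map_sum, map_smul] at hm
      simp [hm, Finset.sum_mul, TensorProduct.sum_tmul, TensorProduct.smul_tmul']
    · obtain ⟨m, hm⟩ := S.w_ψ h i
      refine ⟨Sum.elim 0 m, ?_⟩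
      simp only [map_sum, map_smul] at hm
      simp [hm, Finset.sum_mul, TensorProduct.tmul_sum]
  comm := by
    rintro (i | i) (j | j)
    · simpa [← TensorProduct.sub_tmul] using tmul_one_mem_span (T.comm i j)
    · simp
    · simp
    · simpa [← TensorProduct.tmul_sub] using one_tmul_mem_span (S.comm i j)
  κ_mem := add_mem (tmul_one_mem_span T.κ_mem) (one_tmul_mem_span S.κ_mem)
  euler_φ := by
    rw [tensor_euler]
    rintro (i | i)
    · simp only [tensorLift_X_inl, add_mul, mul_add, Algebra.TensorProduct.tmul_mul_tmul, T.δ_φ,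
        mul_one, one_mul, TensorProduct.add_tmul]
      abel
    · simp only [tensorLift_X_inr, add_mul, mul_add, Algebra.TensorProduct.tmul_mul_tmul, S.δ_φ,
        mul_one, one_mul, TensorProduct.tmul_add]
      abel
  euler_ψ := by
    rw [tensor_euler]
    rintro (i | i)
    · simp only [tensorLift_X_inl, add_mul, mul_add, Algebra.TensorProduct.tmul_mul_tmul, T.ψ_δ,
        mul_one, one_mul, TensorProduct.add_tmul]
      abel
    · simp only [tensorLift_X_inr, add_mul, mul_add, Algebra.TensorProduct.tmul_mul_tmul, S.ψ_δ,
        mul_one, one_mul, TensorProduct.tmul_add]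
      abel
  generate := by
    set U := Algebra.adjoin ℂ (Set.range (fun i => tensorLift T.φ S.φ (X i)) ∪
      Set.range (fun i => tensorLift T.ψ S.ψ (X i)) ∪ Set.range (tensorGroup T.w S.w)) with hU
    have hA : ∀ a : A, a ⊗ₜ[ℂ] (1 : B) ∈ U := by
      intro a
      have ha : a ∈ (⊤ : Subalgebra ℂ A) := Algebra.mem_top
      suffices (⊤ : Subalgebra ℂ A) ≤ U.comap Algebra.TensorProduct.includeLeft from this ha
      rw [← T.generate, Algebra.adjoin_le_iff]
      rintro _ ((⟨i, rfl⟩ | ⟨i, rfl⟩) | ⟨g, rfl⟩)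
      · exact Algebra.subset_adjoin (Or.inl (Or.inl ⟨Sum.inl i, by simp⟩))
      · exact Algebra.subset_adjoin (Or.inl (Or.inr ⟨Sum.inl i, by simp⟩))
      · exact Algebra.subset_adjoin (Or.inr ⟨(g, 1), by simp⟩)
    have hB : ∀ b : B, (1 : A) ⊗ₜ[ℂ] b ∈ U := by
      intro b
      have hb : b ∈ (⊤ : Subalgebra ℂ B) := Algebra.mem_top
      suffices (⊤ : Subalgebra ℂ B) ≤ U.comap Algebra.TensorProduct.includeRight from this hb
      rw [← S.generate, Algebra.adjoin_le_iff]
      rintro _ ((⟨i, rfl⟩ | ⟨i, rfl⟩) | ⟨g, rfl⟩)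
      · exact Algebra.subset_adjoin (Or.inl (Or.inl ⟨Sum.inr i, by simp⟩))
      · exact Algebra.subset_adjoin (Or.inl (Or.inr ⟨Sum.inr i, by simp⟩))
      · exact Algebra.subset_adjoin (Or.inr ⟨(1, g), by simp⟩)
    refine (eq_top_iff.2 fun t _ => ?_)
    induction t using TensorProduct.induction_on with
    | zero => exact U.zero_mem
    | tmul a b => simpa using U.mul_mem (hA a) (hB b)
    | add x y hx hy => exact U.add_mem (hx Algebra.mem_top) (hy Algebra.mem_top)

end Tensor

/-! ### The spanning half of the triangular decomposition -/

section Spanning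

variable (T : TriangularData A ι G)

theorem w_mul_φ (g : G) (p : MvPolynomial ι ℂ) : ∃ p', T.w g * T.φ p = T.φ p' * T.w g := by
  induction p using MvPolynomial.induction_on with
  | C z => exact ⟨C z, by rw [← algebraMap_eq, AlgHom.commutes, Algebra.commutes]⟩
  | add p q hp hq =>
    obtain ⟨p', hp⟩ := hp
    obtain ⟨q', hq⟩ := hq
    exact ⟨p' + q', by simp [mul_add, add_mul, hp, hq]⟩
  | mul_X p i hp =>
    obtain ⟨p', hp⟩ := hp
    obtain ⟨m, hm⟩ := T.w_φ g i
    exact ⟨p' * ∑ j, m j • X j, by rw [map_mul, ← mul_assoc, hp, mul_assoc, hm, map_mul, mul_assoc]⟩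

/-- The commutator obeys the Leibniz rule, and the group terms arising from single variables can be
moved to the right of all `φ`. -/
theorem ψ_mul_φ (i : ι) (p : MvPolynomial ι ℂ) : T.ψ (X i) * T.φ p - T.φ p * T.ψ (X i) ∈
    Submodule.span ℂ (Set.range fun x : MvPolynomial ι ℂ × G => T.φ x.1 * T.w x.2) := by
  set S := Submodule.span ℂ (Set.range fun x : MvPolynomial ι ℂ × G => T.φ x.1 * T.w x.2)
  have h1 : ∀ s ∈ S, ∀ j, s * T.φ (X j) ∈ S := by
    intro s hs j
    induction hs using Submodule.span_induction with
    | mem x hx =>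
      obtain ⟨⟨q, g⟩, rfl⟩ := hx
      obtain ⟨m, hm⟩ := T.w_φ g j
      exact Submodule.subset_span ⟨(q * ∑ j, m j • X j, g), by
        simp only; rw [map_mul, mul_assoc, mul_assoc, hm]⟩
    | zero => simp
    | add x y _ _ hx hy => rw [add_mul]; exact add_mem hx hy
    | smul z x _ hx => rw [smul_mul_assoc]; exact S.smul_mem _ hx
  have h2 : ∀ k ∈ Submodule.span ℂ (Set.range T.w), ∀ q, T.φ q * k ∈ S := by
    intro k hk q
    induction hk using Submodule.span_induction with
    | mem x hx => obtain ⟨g, rfl⟩ := hx; exact Submodule.subset_span ⟨(q, g), rfl⟩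
    | zero => simp
    | add x y _ _ hx hy => rw [mul_add]; exact add_mem hx hy
    | smul z x _ hx => rw [mul_smul_comm]; exact S.smul_mem _ hx
  induction p using MvPolynomial.induction_on with
  | C z => rw [← algebraMap_eq, AlgHom.commutes, Algebra.commutes, sub_self]; exact S.zero_mem
  | add p q hp hq =>
    have : T.ψ (X i) * T.φ (p + q) - T.φ (p + q) * T.ψ (X i) =
      (T.ψ (X i) * T.φ p - T.φ p * T.ψ (X i)) + (T.ψ (X i) * T.φ q - T.φ q * T.ψ (X i)) := by
      rw [map_add]; noncomm_ring
    rw [this]; exact add_mem hp hq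
  | mul_X p j hp =>
    have : T.ψ (X i) * T.φ (p * X j) - T.φ (p * X j) * T.ψ (X i) =
        (T.ψ (X i) * T.φ p - T.φ p * T.ψ (X i)) * T.φ (X j) +
        T.φ p * (T.ψ (X i) * T.φ (X j) - T.φ (X j) * T.ψ (X i)) := by
      rw [map_mul]; noncomm_ring
    rw [this]
    exact add_mem (h1 _ hp j) (h2 _ (T.comm i j) p)

/-- The spanning half of the triangular decomposition. -/
theorem span_triangular : Submodule.span ℂ (Set.range
    fun x : MvPolynomial ι ℂ × G × MvPolynomial ι ℂ => T.φ x.1 * (T.w x.2.1 * T.ψ x.2.2)) = ⊤ := by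
  set S := Submodule.span ℂ (Set.range
    fun x : MvPolynomial ι ℂ × G × MvPolynomial ι ℂ => T.φ x.1 * (T.w x.2.1 * T.ψ x.2.2))
  have hmem : ∀ p g q, T.φ p * (T.w g * T.ψ q) ∈ S := fun p g q =>
    Submodule.subset_span ⟨(p, g, q), rfl⟩
  have hst := T.smul_mem_of_generators S (fun i m hm => ?_) (fun i m hm => ?_) (fun g m hm => ?_)
  · refine eq_top_iff.2 fun a _ => ?_
    have := hst a 1 (by simpa using hmem 1 1 1)
    simpa using this
  · induction hm using Submodule.span_induction with
    | mem x hx =>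
      obtain ⟨⟨p, g, q⟩, rfl⟩ := hx
      simp only [smul_eq_mul]
      rw [← mul_assoc, ← map_mul]
      exact hmem _ _ _
    | zero => simp
    | add x y _ _ hx hy => rw [smul_add]; exact add_mem hx hy
    | smul z x _ hx => rw [smul_comm]; exact S.smul_mem _ hx
  · induction hm using Submodule.span_induction with
    | mem x hx =>
      obtain ⟨⟨p, g, q⟩, rfl⟩ := hx
      obtain ⟨m, hm⟩ := T.ψ_w g i
      have : T.ψ (X i) * (T.φ p * (T.w g * T.ψ q)) =
          T.φ p * (T.w g * T.ψ ((∑ j, m j • X j) * q)) +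
          (T.ψ (X i) * T.φ p - T.φ p * T.ψ (X i)) * (T.w g * T.ψ q) := by
        rw [map_mul, ← mul_assoc (T.w g), ← hm]; noncomm_ring
      simp only [smul_eq_mul]
      rw [this]
      refine add_mem (hmem _ _ _) ?_
      have hs := T.ψ_mul_φ i p
      generalize T.ψ (X i) * T.φ p - T.φ p * T.ψ (X i) = s at hs
      induction hs using Submodule.span_induction with
      | mem x hx =>
        obtain ⟨⟨p', g'⟩, rfl⟩ := hx
        simp only
        rw [mul_assoc, ← mul_assoc (T.w g'), ← map_mul]
        exact hmem _ _ _
      | zero => simp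
      | add x y _ _ hx hy => rw [add_mul]; exact add_mem hx hy
      | smul z x _ hx => rw [smul_mul_assoc]; exact S.smul_mem _ hx
    | zero => simp
    | add x y _ _ hx hy => rw [smul_add]; exact add_mem hx hy
    | smul z x _ hx => rw [smul_comm]; exact S.smul_mem _ hx
  · induction hm using Submodule.span_induction with
    | mem x hx =>
      obtain ⟨⟨p, g', q⟩, rfl⟩ := hx
      obtain ⟨p', hp'⟩ := T.w_mul_φ g p
      simp only [smul_eq_mul]
      rw [← mul_assoc, hp', mul_assoc, ← mul_assoc (T.w g), ← map_mul]
      exact hmem _ _ _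
    | zero => simp
    | add x y _ _ hx hy => rw [smul_add]; exact add_mem hx hy
    | smul z x _ hx => rw [smul_comm]; exact S.smul_mem _ hx

end Spanning

end TriangularData

end

/-! ### Simple quotients, prime ideals and sub-bimodules -/

noncomputable section

/-- The annihilators of the simple quotients of a module of finite length form a finite set. -/
theorem finite_annihilator_quotient {A M : Type*} [Ring A] [AddCommGroup M] [Module A M]
    (h : IsFiniteLength A M) :
    {I : Ideal A | ∃ N : Submodule A M, IsCoatom N ∧ I = Module.annihilator A (M ⧸ N)}.Finite := by
  induction h with
  | of_subsingleton =>
    refine Set.finite_empty.subset ?_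
    rintro _ ⟨N, hN, -⟩
    exact hN.1 (Subsingleton.elim _ _)
  | @of_simple_quotient M _ _ N hs hN ih =>
    refine (ih.union (Set.finite_singleton (Module.annihilator A (M ⧸ N)))).subset ?_
    rintro _ ⟨N', hN', rfl⟩
    by_cases heq : N' = N
    · subst heq; exact Or.inr rfl
    left
    have hNc : IsCoatom N := isSimpleModule_iff_isCoatom.1 hs
    -- Two distinct maximal submodules span `M`, so `M ⧸ N'` is already a simple quotient of `N` and
    -- falls under the induction hypothesis.
    have hsup : N ⊔ N' = ⊤ := by
      refine hN'.2 _ (lt_of_le_of_ne le_sup_right fun h => heq ?_)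
      have hle : N ≤ N' := h ▸ le_sup_left
      exact hNc.le_iff_eq hN'.1 |>.1 hle
    let f : N →ₗ[A] M ⧸ N' := N'.mkQ ∘ₗ N.subtype
    have hf : Function.Surjective f := by
      rw [← LinearMap.range_eq_top, LinearMap.range_comp, Submodule.range_subtype]
      have := congrArg (Submodule.map N'.mkQ) hsup
      rw [Submodule.map_sup, Submodule.map_top, Submodule.range_mkQ] at this
      simpa using this
    have e := f.quotKerEquivOfSurjective hf
    have : IsSimpleModule A (M ⧸ N') := isSimpleModule_iff_isCoatom.2 hN'
    have hs' : IsSimpleModule A (N ⧸ LinearMap.ker f) := IsSimpleModule.congr e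
    exact ⟨LinearMap.ker f, isSimpleModule_iff_isCoatom.1 hs', e.annihilator_eq.symm⟩

section Prime

variable {A : Type u} [Ring A]

theorem isPrimeTwoSidedIdeal_iff {I : Ideal A} (hI : I.IsTwoSided) (hI' : I ≠ ⊤) :
    IsPrimeTwoSidedIdeal I ↔ ∀ r s : A, (∀ t, r * t * s ∈ I) → r ∈ I ∨ s ∈ I := by
  constructor
  · rintro ⟨-, -, h⟩ r s hrs
    -- The elements `x` with `x A s ⊆ I` form a two-sided ideal containing `r`. The elements that
    -- `J` multiplies into `I` form one containing `s`.
    let J : Ideal A :=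
      { carrier := {x | ∀ t, x * t * s ∈ I}
        add_mem' := fun hx hy t => by rw [add_mul, add_mul]; exact I.add_mem (hx t) (hy t)
        zero_mem' := fun t => by simp
        smul_mem' := fun b x hx t => by
          rw [smul_eq_mul, mul_assoc, mul_assoc, ← mul_assoc x]; exact I.mul_mem_left b (hx t) }
    have hJ : J.IsTwoSided := ⟨fun {x} b hx t => by rw [mul_assoc x]; exact hx _⟩
    let J' : Ideal A :=
      { carrier := {y | ∀ x ∈ J, x * y ∈ I}
        add_mem' := fun hx hy t ht => by rw [mul_add]; exact I.add_mem (hx t ht) (hy t ht)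
        zero_mem' := fun t _ => by simp
        smul_mem' := fun b y hy x hx => by
          rw [smul_eq_mul, ← mul_assoc]; exact hy _ (J.mul_mem_right b hx) }
    have hJ' : J'.IsTwoSided := ⟨fun {y} b hy x hx => by
      rw [← mul_assoc]; exact I.mul_mem_right b (hy x hx)⟩
    have hs : s ∈ J' := fun x hx => by simpa using hx 1
    rcases h J J' hJ hJ' (Ideal.mul_le.2 fun x hx y hy => hy x hx) with h | h
    · exact Or.inl (h hrs)
    · exact Or.inr (h hs)
  · intro h
    refine ⟨hI, hI', fun J J' hJ hJ' hle => ?_⟩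
    by_contra! hcon
    obtain ⟨r, hrJ, hr⟩ := SetLike.not_le_iff_exists.1 hcon.1
    obtain ⟨s, hsJ, hs⟩ := SetLike.not_le_iff_exists.1 hcon.2
    rcases h r s fun t => hle (Ideal.mul_mem_mul (J.mul_mem_right t hrJ) hsJ) with h | h
    exacts [hr h, hs h]

/-- The annihilator of a simple module is prime. -/
theorem IsPrimeTwoSidedIdeal.annihilator (M : Type*) [AddCommGroup M] [Module A M]
    [IsSimpleModule A M] : IsPrimeTwoSidedIdeal (Module.annihilator A M) := by
  have hnt : Nontrivial M := IsSimpleModule.nontrivial A M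
  refine (isPrimeTwoSidedIdeal_iff inferInstance fun h => ?_).2 fun r s hrs => ?_
  · exact not_subsingleton M (Module.annihilator_eq_top_iff.1 h)
  · by_contra! hcon
    obtain ⟨hr, hs⟩ := hcon
    rw [Module.mem_annihilator] at hr hs
    push Not at hr hs
    obtain ⟨m, hm⟩ := hr
    obtain ⟨n, hn⟩ := hs
    obtain ⟨t, ht⟩ := (IsSimpleModule.toSpanSingleton_surjective A hn) m
    have := Module.mem_annihilator.1 (hrs t) n
    rw [mul_smul, mul_smul] at this
    rw [← ht] at hm
    exact hm this

theorem IsPrimeTwoSidedIdeal.le_of_pow_le {I K : Ideal A} (h : IsPrimeTwoSidedIdeal I)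
    (hK : K.IsTwoSided) {n : ℕ} (hn : K ^ n ≤ I) : K ≤ I := by
  induction n with
  | zero =>
    rw [Submodule.pow_zero, Ideal.one_eq_top, top_le_iff] at hn
    exact absurd hn h.2.1
  | succ n ih =>
    rw [Submodule.pow_succ] at hn
    rcases h.2.2 _ _ inferInstance hK hn with h | h
    exacts [ih h, h]

theorem IsPrimeTwoSidedIdeal.exists_le_of_sInf_le {I : Ideal A} (h : IsPrimeTwoSidedIdeal I)
    {S : Set (Ideal A)} (hS : S.Finite) (hS' : ∀ P ∈ S, P.IsTwoSided) (hle : sInf S ≤ I) :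
    ∃ P ∈ S, P ≤ I := by
  induction S, hS using Set.Finite.induction_on with
  | empty =>
    rw [sInf_empty, top_le_iff] at hle
    exact absurd hle h.2.1
  | @insert P S _ _ ih =>
    rw [sInf_insert] at hle
    have hP : P.IsTwoSided := hS' P (Set.mem_insert _ _)
    have hSt : (sInf S).IsTwoSided := ⟨fun {a} b ha => by
      rw [Submodule.mem_sInf] at ha ⊢
      intro Q hQ
      have := hS' Q (Set.mem_insert_of_mem _ hQ)
      exact Ideal.mul_mem_right b Q (ha Q hQ)⟩
    rcases h.2.2 P (sInf S) hP hSt (Ideal.mul_le_inf.trans hle) with h' | h'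
    · exact ⟨P, Set.mem_insert _ _, h'⟩
    · obtain ⟨Q, hQ, hQI⟩ := ih (fun Q hQ => hS' Q (Set.mem_insert_of_mem _ hQ)) h'
      exact ⟨Q, Set.mem_insert_of_mem _ hQ, hQI⟩

end Prime

section Bimodule

variable {A : Type*} [Ring A] [Algebra ℂ A]

attribute [local instance] TensorProduct.Algebra.module

theorem tmul_op_smul (a b x : A) : (a ⊗ₜ[ℂ] MulOpposite.op b) • x = a * x * b := by
  rw [TensorProduct.Algebra.smul_def, op_smul_eq_mul, smul_eq_mul, mul_assoc]

theorem isScalarTower_bimodule : IsScalarTower ℂ (A ⊗[ℂ] Aᵐᵒᵖ) A := by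
  refine ⟨fun z t x => ?_⟩
  induction t using TensorProduct.induction_on with
  | zero =>
    have h0 : (0 : A ⊗[ℂ] Aᵐᵒᵖ) • x = 0 := zero_smul (A ⊗[ℂ] Aᵐᵒᵖ) x
    rw [smul_zero]
    exact h0.trans ((congrArg (z • ·) h0).trans (smul_zero z)).symm
  | tmul a b =>
    rw [TensorProduct.smul_tmul', TensorProduct.Algebra.smul_def, TensorProduct.Algebra.smul_def,
      smul_assoc]
  | add s t hs ht => rw [smul_add, add_smul, hs, ht, add_smul, smul_add]

/-- A two-sided ideal as a sub-bimodule. -/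
def Ideal.toBimodule (I : Ideal A) (hI : I.IsTwoSided) : Submodule (A ⊗[ℂ] Aᵐᵒᵖ) A where
  carrier := I
  add_mem' := I.add_mem
  zero_mem' := I.zero_mem
  smul_mem' t x hx := by
    induction t using TensorProduct.induction_on with
    | zero =>
      have h0 : (0 : A ⊗[ℂ] Aᵐᵒᵖ) • x = 0 := zero_smul (A ⊗[ℂ] Aᵐᵒᵖ) x
      exact (congrArg (· ∈ I) h0).mpr I.zero_mem
    | tmul a b =>
      obtain ⟨b, rfl⟩ := MulOpposite.op_surjective b
      rw [tmul_op_smul]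
      exact I.mul_mem_right _ (I.mul_mem_left _ hx)
    | add s t hs ht => rw [add_smul]; exact I.add_mem hs ht

end Bimodule

/-! ### Locally nilpotent modules and annihilators of their simple quotients -/

namespace TriangularData

open MvPolynomial

section Quotients

set_option linter.unusedSectionVars false

variable {A : Type*} [Ring A] [Algebra ℂ A] {ι G : Type*} [Fintype ι] [Group G]
  (T : TriangularData A ι G)

/-- The negative polynomial algebra acts locally nilpotently. -/
def LocNil (M : Type*) [AddCommGroup M] [Module A M] : Prop :=
  ∀ m : M, ∃ n : ℕ, ∀ p ∈ augIdeal ι ^ n, T.ψ p • m = 0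

/-- The vectors killed by `ψ (𝔪 ^ n)`. -/
def killed (M : Type*) [AddCommGroup M] [Module A M] [Module ℂ M] [IsScalarTower ℂ A M] (n : ℕ) :
    Submodule ℂ M where
  carrier := {m | ∀ p ∈ augIdeal ι ^ n, T.ψ p • m = 0}
  add_mem' hx hy p hp := by rw [smul_add, hx p hp, hy p hp, add_zero]
  zero_mem' p _ := smul_zero _
  smul_mem' z x hx p hp := by rw [smul_algebra_smul_comm, hx p hp, smul_zero]

section

variable {M : Type*} [AddCommGroup M] [Module A M] [Module ℂ M] [IsScalarTower ℂ A M]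

theorem killed_zero : T.killed M 0 = ⊥ := by
  refine (Submodule.eq_bot_iff _).2 fun m hm => ?_
  simpa using hm 1 (by simp)

theorem mem_killed_succ {n : ℕ} {m : M} :
    m ∈ T.killed M (n + 1) ↔ ∀ i, T.ψ (X i) • m ∈ T.killed M n := by
  constructor
  · intro h i p hp
    rw [smul_smul, ← map_mul]
    exact h _ (by rw [pow_succ]; exact Ideal.mul_mem_mul hp (X_mem_augIdeal i))
  · intro h p hp
    rw [pow_succ', ← smul_eq_mul, mem_augIdeal_smul] at hp
    obtain ⟨f, hf, rfl⟩ := hp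
    rw [map_sum, Finset.sum_smul]
    refine Finset.sum_eq_zero fun i _ => ?_
    rw [smul_eq_mul, mul_comm, map_mul, mul_smul]
    exact h i _ (hf i)

theorem killed_mono : Monotone (T.killed M) := fun _ _ h _ hm p hp =>
  hm p (Ideal.pow_le_pow_right h hp)

theorem w_killed (g : G) {n : ℕ} {m : M} (hm : m ∈ T.killed M n) : T.w g • m ∈ T.killed M n := by
  induction n generalizing m with
  | zero => rw [killed_zero, Submodule.mem_bot] at hm ⊢; rw [hm, smul_zero]
  | succ n ih =>
    rw [mem_killed_succ] at hm ⊢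
    intro i
    obtain ⟨c, hc⟩ := T.ψ_w g i
    rw [smul_smul, hc, mul_smul]
    refine ih ?_
    rw [map_sum, Finset.sum_smul]
    refine Submodule.sum_mem _ fun j _ => ?_
    rw [map_smul, smul_assoc]
    exact Submodule.smul_mem _ _ (hm j)

theorem span_w_killed {k : A} (hk : k ∈ Submodule.span ℂ (Set.range T.w)) {n : ℕ} {m : M}
    (hm : m ∈ T.killed M n) : k • m ∈ T.killed M n := by
  induction hk using Submodule.span_induction with
  | mem x hx => obtain ⟨g, rfl⟩ := hx; exact T.w_killed g hm
  | zero => simp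
  | add x y _ _ hx hy => rw [add_smul]; exact add_mem hx hy
  | smul z x _ hx => rw [smul_assoc]; exact Submodule.smul_mem _ _ hx

/-- Dual to the behaviour of `ψ` on the adic filtration: the union of the killed spaces is therefore
a submodule, so local nilpotency can be tested on a generator. -/
theorem φ_killed (i : ι) {n : ℕ} {m : M} (hm : m ∈ T.killed M n) :
    T.φ (X i) • m ∈ T.killed M (n + 1) := by
  induction n generalizing m with
  | zero => rw [killed_zero, Submodule.mem_bot] at hm; simp [hm]
  | succ n ih =>
    rw [mem_killed_succ]
    intro j
    have : T.ψ (X j) • T.φ (X i) • m = T.φ (X i) • T.ψ (X j) • m +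
        (T.ψ (X j) * T.φ (X i) - T.φ (X i) * T.ψ (X j)) • m := by
      rw [sub_smul, mul_smul, mul_smul]; abel
    rw [this]
    exact add_mem (ih (T.mem_killed_succ.1 hm j)) (T.span_w_killed (T.comm j i) hm)

/-- A module generated by one vector killed by `ψ (𝔪 ^ n)` is locally nilpotent. -/
theorem locNil_of_span {n : ℕ} {v : M} (hv : v ∈ T.killed M n)
    (hspan : Submodule.span A {v} = ⊤) : T.LocNil M := by
  let N : Submodule ℂ M := ⨆ k, T.killed M k
  have hN : ∀ {m}, m ∈ N ↔ ∃ k, m ∈ T.killed M k :=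
    Submodule.mem_iSup_of_directed _ T.killed_mono.directed_le
  have hst := T.smul_mem_of_generators N
    (fun i m hm => by
      obtain ⟨k, hk⟩ := hN.1 hm
      exact hN.2 ⟨k + 1, T.φ_killed i hk⟩)
    (fun i m hm => by
      obtain ⟨k, hk⟩ := hN.1 hm
      exact hN.2 ⟨k, T.mem_killed_succ.1 (T.killed_mono k.le_succ hk) i⟩)
    (fun g m hm => by
      obtain ⟨k, hk⟩ := hN.1 hm
      exact hN.2 ⟨k, T.w_killed g hk⟩)
  intro m
  have hm : m ∈ Submodule.span A {v} := hspan ▸ Submodule.mem_top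
  obtain ⟨a, rfl⟩ := Submodule.mem_span_singleton.1 hm
  exact hN.1 (hst a v (hN.2 ⟨n, hv⟩))

end

/-- The left ideal `N` contains `ψ (𝔪 ^ n)`. -/
theorem quotient_killed {N : Ideal A} {n : ℕ} (hN : ∀ p ∈ augIdeal ι ^ n, T.ψ p ∈ N) :
    N.mkQ 1 ∈ T.killed (A ⧸ N) n := by
  intro p hp
  rw [← map_smul, smul_eq_mul, mul_one]
  exact (Submodule.Quotient.mk_eq_zero N).2 (hN p hp)

theorem span_mkQ_one (N : Ideal A) : Submodule.span A {N.mkQ 1} = ⊤ := by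
  refine eq_top_iff.2 fun x _ => ?_
  obtain ⟨a, rfl⟩ := N.mkQ_surjective x
  refine Submodule.mem_span_singleton.2 ⟨a, ?_⟩
  rw [← map_smul, smul_eq_mul, mul_one]

theorem locNil_quotient {N : Ideal A} {n : ℕ} (hN : ∀ p ∈ augIdeal ι ^ n, T.ψ p ∈ N) :
    T.LocNil (A ⧸ N) :=
  T.locNil_of_span (T.quotient_killed hN) (span_mkQ_one N)

/-- In a spanning element `φ p * (w g * ψ q)` only `q` modulo `𝔪ⁿ` matters, so finitely many
elements `w g * ψ q` generate the quotient over the positive polynomials. -/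
theorem isFiniteLength_quotient [Finite G] {N : Ideal A} {n : ℕ}
    (hN : ∀ p ∈ augIdeal ι ^ n, T.ψ p ∈ N) : IsFiniteLength A (A ⧸ N) := by
  let _ : Module (MvPolynomial ι ℂ) (A ⧸ N) := Module.compHom _ T.φ.toRingHom
  have hT : T.Compatible (A ⧸ N) := fun _ _ => rfl
  have := hT.isScalarTower
  suffices Module.Finite (MvPolynomial ι ℂ) (A ⧸ N) from hT.isFiniteLength
  obtain ⟨U, ⟨s, hs⟩, hU⟩ := exists_finite_complement_augIdeal_pow ι n
  let B : Set (A ⧸ N) := Set.range fun x : G × s => N.mkQ (T.w x.1 * T.ψ x.2)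
  have hB : B.Finite := Set.finite_range _
  refine ⟨⟨hB.toFinset, ?_⟩⟩
  rw [Set.Finite.coe_toFinset]
  refine eq_top_iff.2 fun x _ => ?_
  obtain ⟨a, rfl⟩ := N.mkQ_surjective x
  have ha : a ∈ (⊤ : Submodule ℂ A) := Submodule.mem_top
  rw [← T.span_triangular] at ha
  induction ha using Submodule.span_induction with
  | mem x hx =>
    obtain ⟨⟨p, g, q⟩, rfl⟩ := hx
    simp only
    rw [← smul_eq_mul, map_smul, ← hT]
    refine Submodule.smul_mem _ _ ?_
    obtain ⟨r, hr, hqr⟩ := hU q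
    have : N.mkQ (T.w g * T.ψ q) = N.mkQ (T.w g * T.ψ r) := by
      refine (Submodule.Quotient.eq N).2 ?_
      rw [← mul_sub, ← map_sub]
      exact N.mul_mem_left _ (hN _ hqr)
    rw [this]
    rw [← hs] at hr
    clear this hqr
    induction hr using Submodule.span_induction with
    | mem x hx => exact Submodule.subset_span ⟨(g, ⟨x, hx⟩), rfl⟩
    | zero => simp
    | add x y _ _ hx hy =>
      rw [map_add, mul_add, map_add]
      exact add_mem hx hy
    | smul z x _ hx =>
      rw [map_smul, mul_smul_comm]
      have : N.mkQ (z • (T.w g * T.ψ x)) = z • N.mkQ (T.w g * T.ψ x) := rfl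
      rw [this]
      exact Submodule.smul_of_tower_mem _ _ hx
  | zero => simp
  | add x y _ _ hx hy => rw [map_add]; exact add_mem (hx Submodule.mem_top) (hy Submodule.mem_top)
  | smul z x _ hx =>
    have : N.mkQ (z • x) = z • N.mkQ x := rfl
    rw [this]
    exact Submodule.smul_of_tower_mem _ _ (hx Submodule.mem_top)

/-- At the last power of `𝔪` that does not kill `m`, a nonzero value `ψ p • m` is killed by one more
variable. -/
theorem LocNil.exists_ne_zero {T : TriangularData A ι G} {M : Type*} [AddCommGroup M] [Module A M]
    [Nontrivial M] (h : T.LocNil M) : ∃ v : M, v ≠ 0 ∧ ∀ i, T.ψ (X i) • v = 0 := by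
  classical
  obtain ⟨m, hm⟩ := exists_ne (0 : M)
  have hex := h m
  have h0 : Nat.find hex ≠ 0 := by
    intro h0
    have := Nat.find_spec hex
    rw [h0] at this
    exact hm (by simpa using this 1 (by simp))
  obtain ⟨k, hk⟩ := Nat.exists_eq_succ_of_ne_zero h0
  have hlt := Nat.find_min hex (m := k) (by omega)
  push Not at hlt
  obtain ⟨p, hp, hpm⟩ := hlt
  refine ⟨_, hpm, fun i => ?_⟩
  rw [smul_smul, ← map_mul]
  refine Nat.find_spec hex _ ?_
  rw [hk, Nat.succ_eq_add_one, pow_succ']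
  exact Ideal.mul_mem_mul (X_mem_augIdeal i) hp

theorem ψ_mem_of_X_mem {N : Ideal A} (hN : ∀ i, T.ψ (X i) ∈ N) :
    ∀ p ∈ augIdeal ι ^ 1, T.ψ p ∈ N := by
  intro p hp
  rw [pow_one, ← Ideal.mul_top (augIdeal ι), ← smul_eq_mul, mem_augIdeal_smul] at hp
  obtain ⟨f, -, rfl⟩ := hp
  rw [map_sum]
  refine Submodule.sum_mem _ fun i _ => ?_
  rw [smul_eq_mul, mul_comm, map_mul]
  exact N.mul_mem_left _ (hN i)

/-- The annihilators of the simple locally nilpotent modules. -/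
def simpleAnn : Set (Ideal A) :=
  {I | ∃ N : Ideal A, IsCoatom N ∧ (∀ i, T.ψ (X i) ∈ N) ∧ I = Module.annihilator A (A ⧸ N)}

theorem LocNil.annihilator_mem {T : TriangularData A ι G} {M : Type*} [AddCommGroup M] [Module A M]
    [IsSimpleModule A M] (h : T.LocNil M) : Module.annihilator A M ∈ T.simpleAnn := by
  have hnt : Nontrivial M := IsSimpleModule.nontrivial A M
  obtain ⟨v, hv0, hv⟩ := h.exists_ne_zero
  let f := LinearMap.toSpanSingleton A M v
  have e := f.quotKerEquivOfSurjective (IsSimpleModule.toSpanSingleton_surjective A hv0)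
  have : IsSimpleModule A (A ⧸ LinearMap.ker f) := IsSimpleModule.congr e
  exact ⟨LinearMap.ker f, isSimpleModule_iff_isCoatom.1 this, hv, e.annihilator_eq.symm⟩

/-- All these simple modules are quotients of the single finite length module `A/Aψ(𝔪)`. -/
theorem finite_simpleAnn [Finite G] : T.simpleAnn.Finite := by
  let J : Ideal A := Ideal.span (Set.range fun i => T.ψ (X i))
  have hJ := T.isFiniteLength_quotient (T.ψ_mem_of_X_mem (N := J)
    fun i => Ideal.subset_span ⟨i, rfl⟩)
  refine (finite_annihilator_quotient hJ).subset ?_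
  rintro _ ⟨N, hN, hψ, rfl⟩
  have hle : J ≤ N := Ideal.span_le.2 (by rintro _ ⟨i, rfl⟩; exact hψ i)
  let f : A ⧸ J →ₗ[A] A ⧸ N := Submodule.mapQ J N LinearMap.id hle
  have hf : Function.Surjective f := fun x => by
    obtain ⟨a, rfl⟩ := N.mkQ_surjective x
    exact ⟨J.mkQ a, rfl⟩
  have e := f.quotKerEquivOfSurjective hf
  have : IsSimpleModule A (A ⧸ N) := isSimpleModule_iff_isCoatom.2 hN
  have hs : IsSimpleModule A ((A ⧸ J) ⧸ LinearMap.ker f) := IsSimpleModule.congr e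
  exact ⟨LinearMap.ker f, isSimpleModule_iff_isCoatom.1 hs, e.annihilator_eq.symm⟩

/-- Every composition factor is simple, locally nilpotent and killed by `I`, so the intersection
kills each factor and one power kills the module. -/
theorem exists_pow_le_annihilator {M : Type*} [AddCommGroup M] [Module A M]
    (h : IsFiniteLength A M) (hM : T.LocNil M) {I : Ideal A} (hI : I ≤ Module.annihilator A M) :
    ∃ n, sInf {P ∈ T.simpleAnn | I ≤ P} ^ n ≤ Module.annihilator A M := by
  induction h with
  | of_subsingleton =>
    rw [Module.annihilator_eq_top_iff.2 inferInstance]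
    exact ⟨0, le_top⟩
  | @of_simple_quotient M _ _ N hs hN ih =>
    obtain ⟨n, hn⟩ := ih (fun m => by
        obtain ⟨k, hk⟩ := hM m
        exact ⟨k, fun p hp => Subtype.ext (hk p hp)⟩)
      (hI.trans (N.subtype.annihilator_le_of_injective N.injective_subtype))
    refine ⟨n + 1, ?_⟩
    -- In `Kⁿ K` the right factor acts first: it sends `M` into `N`, which `Kⁿ` kills.
    rw [Submodule.pow_succ, Ideal.mul_le]
    intro r hr s hs'
    rw [Module.mem_annihilator]
    intro m
    have hq : T.LocNil (M ⧸ N) := fun x => by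
      obtain ⟨m, rfl⟩ := N.mkQ_surjective x
      obtain ⟨k, hk⟩ := hM m
      exact ⟨k, fun p hp => by rw [← map_smul, hk p hp, map_zero]⟩
    have hsm : s ∈ Module.annihilator A (M ⧸ N) := Submodule.mem_sInf.1 hs' _
      ⟨hq.annihilator_mem, hI.trans (N.mkQ.annihilator_le_of_surjective N.mkQ_surjective)⟩
    have h1 : s • m ∈ N := by
      rw [← Submodule.Quotient.mk_eq_zero, Submodule.Quotient.mk_smul]
      exact Module.mem_annihilator.1 hsm _
    rw [mul_smul]
    exact congrArg Subtype.val (Module.mem_annihilator.1 (hn hr) ⟨s • m, h1⟩)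

end Quotients

end TriangularData

end

/-! ### Finite length as a bimodule, and primes as annihilators -/

noncomputable section

namespace TriangularData

open MvPolynomial

attribute [local instance] TensorProduct.Algebra.module

section

variable {A : Type*} [Ring A] [Algebra ℂ A] {ι G : Type*} [Fintype ι] [Group G]
  (T : TriangularData A ι G)

theorem tensor_op_φ (p q : MvPolynomial ι ℂ) (a : A) :
    (T.tensor T.op).φ (rename Sum.inl p * rename Sum.inr q) • a = T.φ p * a * T.ψ q := by
  have : (T.tensor T.op).φ (rename Sum.inl p * rename Sum.inr q) =
      T.φ p ⊗ₜ[ℂ] MulOpposite.op (T.ψ q) := by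
    rw [map_mul]
    change tensorLift _ _ _ * tensorLift _ _ _ = _
    rw [tensorLift_rename_inl, tensorLift_rename_inr, Algebra.TensorProduct.tmul_mul_tmul, mul_one,
      one_mul]
    rfl
  rw [this, tmul_op_smul]

/-- The algebra is a finitely generated module over the two polynomial algebras. -/
theorem finite_bimodule [Finite G] [Module (MvPolynomial (ι ⊕ ι) ℂ) A]
    (hT : (T.tensor T.op).Compatible A) : Module.Finite (MvPolynomial (ι ⊕ ι) ℂ) A := by
  have htower : IsScalarTower ℂ (A ⊗[ℂ] Aᵐᵒᵖ) A := isScalarTower_bimodule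
  have := hT.isScalarTower
  have hB : (Set.range T.w).Finite := Set.finite_range _
  refine ⟨⟨hB.toFinset, ?_⟩⟩
  rw [Set.Finite.coe_toFinset]
  refine eq_top_iff.2 fun a _ => ?_
  have ha : a ∈ (⊤ : Submodule ℂ A) := Submodule.mem_top
  rw [← T.span_triangular] at ha
  induction ha using Submodule.span_induction with
  | mem x hx =>
    obtain ⟨⟨p, g, q⟩, rfl⟩ := hx
    have := T.tensor_op_φ p q (T.w g)
    rw [← hT] at this
    simp only
    rw [← mul_assoc, ← this]
    exact Submodule.smul_mem _ _ (Submodule.subset_span ⟨g, rfl⟩)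
  | zero => exact zero_mem _
  | add x y _ _ hx hy => exact add_mem (hx Submodule.mem_top) (hy Submodule.mem_top)
  | smul z x _ hx => exact Submodule.smul_of_tower_mem _ _ (hx Submodule.mem_top)

/-- The algebra has finite length as a bimodule. -/
theorem isFiniteLength_bimodule (T : TriangularData A ι G) [Finite G] : IsFiniteLength (A ⊗[ℂ] Aᵐᵒᵖ) A := by
  let _ : Module (MvPolynomial (ι ⊕ ι) ℂ) A := Module.compHom _ (T.tensor T.op).φ.toRingHom
  have hT : (T.tensor T.op).Compatible A := fun _ _ => rfl
  have htower : IsScalarTower ℂ (A ⊗[ℂ] Aᵐᵒᵖ) A := isScalarTower_bimodule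
  have := T.finite_bimodule hT
  have : Finite Gᵐᵒᵖ := Finite.of_equiv G MulOpposite.opEquiv
  exact hT.isFiniteLength

/-- Right multiplication by `ψ` belongs to the positive part of `A ⊗ Aᵒᵖ`. Thus `Aψ(𝔪ⁿ)` lies in
step `n` of the adic filtration of the bimodule, and separatedness of `A/I` applies. -/
theorem mem_of_forall_mem_sup [Finite G] {I : Ideal A} (hI : I.IsTwoSided) {a : A}
    (ha : ∀ n, a ∈ I ⊔ Ideal.span (T.ψ '' (augIdeal ι ^ n : Ideal (MvPolynomial ι ℂ)))) :
    a ∈ I := by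
  let _ : Module (MvPolynomial (ι ⊕ ι) ℂ) A := Module.compHom _ (T.tensor T.op).φ.toRingHom
  have hT : (T.tensor T.op).Compatible A := fun _ _ => rfl
  have htower : IsScalarTower ℂ (A ⊗[ℂ] Aᵐᵒᵖ) A := isScalarTower_bimodule
  have hfin := T.finite_bimodule hT
  let I' := I.toBimodule hI
  let _ : Module (MvPolynomial (ι ⊕ ι) ℂ) (A ⧸ I') :=
    Module.compHom _ (T.tensor T.op).φ.toRingHom
  have hTN : (T.tensor T.op).Compatible (A ⧸ I') := fun _ _ => rfl
  have hfinN : Module.Finite (MvPolynomial (ι ⊕ ι) ℂ) (A ⧸ I') := by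
    let f : A →ₗ[MvPolynomial (ι ⊕ ι) ℂ] A ⧸ I' :=
      { toFun := I'.mkQ, map_add' := map_add _
        map_smul' := fun p m => by rw [hT, hTN, map_smul]; rfl }
    exact Module.Finite.of_surjective f I'.mkQ_surjective
  have hmap : ∀ n : ℕ, ∀ q ∈ augIdeal ι ^ n,
      rename (Sum.inr : ι → ι ⊕ ι) q ∈ augIdeal (ι ⊕ ι) ^ n := by
    intro n q hq
    have h1 : (augIdeal ι).map (rename (R := ℂ) (Sum.inr : ι → ι ⊕ ι)) ≤ augIdeal (ι ⊕ ι) := by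
      rw [augIdeal, Ideal.map_span, Ideal.span_le]
      rintro _ ⟨_, ⟨i, rfl⟩, rfl⟩
      rw [rename_X]
      exact X_mem_augIdeal _
    have h2 := Ideal.mem_map_of_mem (rename (R := ℂ) (Sum.inr : ι → ι ⊕ ι)) hq
    rw [Ideal.map_pow] at h2
    exact Ideal.pow_right_mono h1 n h2
  have h0 : I'.mkQ a ∈ ⨅ n, fil (ι ⊕ ι) (A ⧸ I') n := by
    refine (Submodule.mem_iInf _).2 fun n => ?_
    obtain ⟨b, hb, d, hd, rfl⟩ := Submodule.mem_sup.1 (ha n)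
    have hb' : I'.mkQ b = 0 := (Submodule.Quotient.mk_eq_zero I').2 hb
    rw [map_add, hb', zero_add]
    refine map_mem_fil hT hTN I'.mkQ ?_
    suffices ∀ e, e * d ∈ fil (ι ⊕ ι) A n by simpa using this 1
    clear ha
    induction hd using Submodule.span_induction with
    | mem x hx =>
      obtain ⟨q, hq, rfl⟩ := hx
      intro e
      have := T.tensor_op_φ 1 q e
      simp only [map_one, one_mul] at this
      rw [← this, ← hT]
      exact Submodule.smul_mem_smul (hmap n q hq) Submodule.mem_top
    | zero => intro e; rw [mul_zero]; exact zero_mem _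
    | add x y _ _ hx hy => intro e; rw [mul_add]; exact add_mem (hx e) (hy e)
    | smul z x _ hx => intro e; rw [smul_eq_mul, ← mul_assoc]; exact hx _
  rw [hTN.iInf_fil, Submodule.mem_bot] at h0
  exact (Submodule.Quotient.mk_eq_zero I').1 h0

end

section

variable {A : Type u} [Ring A] [Algebra ℂ A] {ι G : Type*} [Fintype ι] [Group G] [Finite G]
  (T : TriangularData A ι G)

/-- Every prime ideal is the annihilator of a simple locally nilpotent module. -/
theorem mem_simpleAnn_of_isPrime {I : Ideal A} (h : IsPrimeTwoSidedIdeal I) :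
    I ∈ T.simpleAnn := by
  have hI := h.1
  set S := {P ∈ T.simpleAnn | I ≤ P} with hS
  have hSt : ∀ P ∈ S, P.IsTwoSided := by
    rintro _ ⟨⟨N, -, -, rfl⟩, -⟩
    infer_instance
  have hKt : (sInf S).IsTwoSided := ⟨fun {a} b ha => by
    rw [Submodule.mem_sInf] at ha ⊢
    intro Q hQ
    have := hSt Q hQ
    exact Ideal.mul_mem_right b Q (ha Q hQ)⟩
  have hsupt : ∀ n, (sInf S ^ n ⊔ I).IsTwoSided := fun n => ⟨fun {a} b ha => by
    obtain ⟨x, hx, y, hy, rfl⟩ := Submodule.mem_sup.1 ha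
    rw [add_mul]
    exact Submodule.add_mem_sup (Ideal.mul_mem_right b _ hx) (Ideal.mul_mem_right b _ hy)⟩
  have hanti : ∀ m n, m ≤ n → sInf S ^ n ≤ sInf S ^ m := by
    intro m n hmn
    induction n, hmn using Nat.le_induction with
    | base => exact le_rfl
    | succ n _ ih => rw [Submodule.pow_succ]; exact Ideal.mul_le_left.trans ih
  have hart := (isFiniteLength_iff_isNoetherian_isArtinian.1 T.isFiniteLength_bimodule).2
  -- The power of `K = sInf S` killing `A/(I + Aψ(𝔪ᵏ))` grows with `k`; stabilization of the
  -- two-sided ideals `Kⁿ + I` provides one exponent for all `k`.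
  obtain ⟨n, hn⟩ := IsArtinian.monotone_stabilizes (R := A ⊗[ℂ] Aᵐᵒᵖ) (M := A)
    ⟨fun n => OrderDual.toDual ((sInf S ^ n ⊔ I).toBimodule (hsupt n)), fun m k hmk x hx =>
      (sup_le_sup_right (hanti m k hmk) I : sInf S ^ k ⊔ I ≤ sInf S ^ m ⊔ I) hx⟩
  have hstab : ∀ m, n ≤ m → sInf S ^ n ≤ sInf S ^ m ⊔ I := by
    intro m hm x hx
    have h1 : x ∈ (sInf S ^ n ⊔ I).toBimodule (hsupt n) := Submodule.mem_sup_left hx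
    have h2 : (sInf S ^ n ⊔ I).toBimodule (hsupt n) = (sInf S ^ m ⊔ I).toBimodule (hsupt m) :=
      hn m hm
    rw [h2] at h1
    exact h1
  have hle : sInf S ^ n ≤ I := by
    intro a ha
    refine T.mem_of_forall_mem_sup hI fun k => ?_
    set N := I ⊔ Ideal.span (T.ψ '' (augIdeal ι ^ k : Ideal (MvPolynomial ι ℂ))) with hN
    have hψ : ∀ p ∈ augIdeal ι ^ k, T.ψ p ∈ N := fun p hp =>
      Submodule.mem_sup_right (Ideal.subset_span ⟨p, hp, rfl⟩)
    have hIann : I ≤ Module.annihilator A (A ⧸ N) := by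
      intro r hr
      rw [Module.mem_annihilator]
      intro x
      obtain ⟨b, rfl⟩ := N.mkQ_surjective x
      rw [← map_smul]
      exact (Submodule.Quotient.mk_eq_zero N).2 (Submodule.mem_sup_left (I.mul_mem_right b hr))
    obtain ⟨l, hl⟩ := T.exists_pow_le_annihilator (T.isFiniteLength_quotient hψ)
      (T.locNil_quotient hψ) hIann
    have h1 : a ∈ Module.annihilator A (A ⧸ N) :=
      (sup_le ((hanti l (max n l) (le_max_right _ _)).trans hl) hIann)
        (hstab (max n l) (le_max_left _ _) ha)
    have h2 := Module.mem_annihilator.1 h1 (N.mkQ 1)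
    rw [← map_smul, smul_eq_mul, mul_one] at h2
    exact (Submodule.Quotient.mk_eq_zero N).1 h2
  -- From `Kⁿ ⊆ I` primeness gives `K ⊆ I`, and finiteness of `S` gives a member `P ⊆ I`, which
  -- contains `I` by the definition of `S`.
  obtain ⟨P, hP, hPI⟩ := h.exists_le_of_sInf_le (T.finite_simpleAnn.subset (Set.sep_subset _ _)) hSt
    (h.le_of_pow_le hKt hle)
  exact le_antisymm hPI hP.2 ▸ hP.1

end

end TriangularData

end

/-! ### Local nilpotency tested on invariants -/

noncomputable section

set_option linter.unusedSectionVars false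

section Invariants

open MvPolynomial

variable {A V ι G : Type*} [Ring A] [Algebra ℂ A] [AddCommGroup V] [Module ℂ V] [Fintype ι]
  [Group G] (e : Module.Basis ι ℂ V) (f : V →ₗ[ℂ] A) (θ : MvPolynomial ι ℂ →ₐ[ℂ] A)

/-- The linear form in the polynomial ring given by a vector. -/
def linForm : V →ₗ[ℂ] MvPolynomial ι ℂ := e.constr ℂ X

theorem linForm_basis (i : ι) : linForm e (e i) = X i := e.constr_basis ℂ X i

variable {e f θ}

theorem map_linForm (hθ : ∀ i, θ (X i) = f (e i)) (v : V) : θ (linForm e v) = f v := by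
  have : θ.toLinearMap ∘ₗ linForm e = f := e.ext fun i => by simp [linForm_basis, hθ]
  exact DFunLike.congr_fun this v

theorem linForm_mem_augIdeal (v : V) : linForm e v ∈ augIdeal ι := by
  rw [linForm, Module.Basis.constr_apply_fintype]
  exact Submodule.sum_mem _ fun i _ => Submodule.smul_of_tower_mem _ _ (X_mem_augIdeal i)

theorem exists_mem_augIdeal_of_mem_adjoin (hθ : ∀ i, θ (X i) = f (e i)) {t : A}
    (ht : t ∈ NonUnitalAlgebra.adjoin ℂ (Set.range f)) : ∃ p ∈ augIdeal ι, θ p = t := by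
  induction ht using NonUnitalAlgebra.adjoin_induction with
  | mem x hx =>
    obtain ⟨v, rfl⟩ := hx
    exact ⟨linForm e v, linForm_mem_augIdeal v, map_linForm hθ v⟩
  | add x y _ _ hx hy =>
    obtain ⟨p, hp, rfl⟩ := hx
    obtain ⟨q, hq, rfl⟩ := hy
    exact ⟨p + q, add_mem hp hq, map_add _ _ _⟩
  | zero => exact ⟨0, zero_mem _, map_zero _⟩
  | mul x y _ _ hx hy =>
    obtain ⟨p, hp, rfl⟩ := hx
    obtain ⟨q, hq, rfl⟩ := hy
    exact ⟨p * q, Ideal.mul_mem_left _ _ hq, map_mul _ _ _⟩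
  | smul z x _ hx =>
    obtain ⟨p, hp, rfl⟩ := hx
    exact ⟨z • p, Submodule.smul_of_tower_mem _ _ hp, map_smul _ _ _⟩

theorem mem_adjoin_of_mem_augIdeal (hθ : ∀ i, θ (X i) = f (e i)) {p : MvPolynomial ι ℂ}
    (hp : p ∈ augIdeal ι) : θ p ∈ NonUnitalAlgebra.adjoin ℂ (Set.range f) := by
  have hX : ∀ i, θ (X i) ∈ NonUnitalAlgebra.adjoin ℂ (Set.range f) := fun i => by
    rw [hθ]; exact NonUnitalAlgebra.subset_adjoin ℂ ⟨_, rfl⟩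
  have key : ∀ (q : MvPolynomial ι ℂ) (i : ι),
      θ (X i * q) ∈ NonUnitalAlgebra.adjoin ℂ (Set.range f) := by
    intro q i
    induction q using MvPolynomial.induction_on with
    | C z =>
      rw [mul_comm, ← smul_eq_C_mul, map_smul]
      exact SMulMemClass.smul_mem _ (hX i)
    | add p q hp hq => rw [mul_add, map_add]; exact add_mem hp hq
    | mul_X p j hp => rw [← mul_assoc, map_mul]; exact mul_mem hp (hX j)
  rw [← Ideal.mul_top (augIdeal ι), ← smul_eq_mul, mem_augIdeal_smul] at hp
  obtain ⟨g, -, rfl⟩ := hp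
  rw [map_sum]
  exact sum_mem fun i _ => key _ _

/-- Every variable is integral over the invariants without constant term. -/
theorem X_mem_radical_invariants [Finite G] (hθ : ∀ i, θ (X i) = f (e i)) (w : G →* A)
    (ρ : Representation ℂ G V) (hw : ∀ g v, w g * f v = f (ρ g v) * w g) (i : ι) :
    (X i : MvPolynomial ι ℂ) ∈ (Ideal.span {p | θ p ∈ NonUnitalAlgebra.adjoin ℂ (Set.range f) ⊓
      NonUnitalSubalgebra.centralizer ℂ (Set.range w)}).radical := by
  classical
  have := Fintype.ofFinite G
  set I := Ideal.span {p | θ p ∈ NonUnitalAlgebra.adjoin ℂ (Set.range f) ⊓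
      NonUnitalSubalgebra.centralizer ℂ (Set.range w)}
  let act : G → MvPolynomial ι ℂ →ₐ[ℂ] MvPolynomial ι ℂ := fun u =>
    aeval fun j => linForm e (ρ u (e j))
  have hact : ∀ u v, act u (linForm e v) = linForm e (ρ u v) := by
    intro u v
    have : (act u).toLinearMap ∘ₗ linForm e = linForm e ∘ₗ ρ u :=
      e.ext fun i => by simp [linForm_basis, act]
    exact DFunLike.congr_fun this v
  have hwθ : ∀ u p, w u * θ p = θ (act u p) * w u := by
    intro u p
    induction p using MvPolynomial.induction_on with
    | C z =>
      have : act u (C z) = C z := by simp [act]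
      rw [this, ← algebraMap_eq, AlgHom.commutes, Algebra.commutes]
    | add p q hp hq => simp only [map_add, mul_add, add_mul, hp, hq]
    | mul_X p j hp =>
      have hj : w u * θ (X j) = θ (act u (X j)) * w u := by
        rw [← linForm_basis e, hact, map_linForm hθ, map_linForm hθ, hw]
      rw [map_mul, ← mul_assoc, hp, mul_assoc, hj, ← mul_assoc, ← map_mul, ← map_mul]
  -- The orbit polynomial of the variable: the factor `g = 1` makes `X i` a root. Its lower
  -- coefficients are invariants without constant term, so a power of `X i` lies in the ideal they
  -- generate.
  let F : Polynomial (MvPolynomial ι ℂ) :=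
    ∏ g : G, (Polynomial.X - Polynomial.C (linForm e (ρ g (e i))))
  have hmonic : F.Monic := Polynomial.monic_prod_of_monic _ _ fun g _ => Polynomial.monic_X_sub_C _
  have hroot : F.eval (X i) = 0 := by
    rw [Polynomial.eval_prod]
    refine Finset.prod_eq_zero (Finset.mem_univ 1) ?_
    simp [linForm_basis]
  have hconst : F.map constantCoeff = Polynomial.X ^ Fintype.card G := by
    simp only [F, Polynomial.map_prod, Polynomial.map_sub, Polynomial.map_X, Polynomial.map_C,
      mem_augIdeal_iff.1 (linForm_mem_augIdeal _)]
    simp [Finset.card_univ]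
  have hdeg : F.natDegree = Fintype.card G := by
    simp only [F]
    rw [Polynomial.natDegree_prod_of_monic _ _ fun g _ => Polynomial.monic_X_sub_C _]
    simp
  have hinv : ∀ u, F.map (act u : MvPolynomial ι ℂ →+* MvPolynomial ι ℂ) = F := by
    intro u
    simp only [F, Polynomial.map_prod, Polynomial.map_sub, Polynomial.map_X, Polynomial.map_C,
      RingHom.coe_coe, hact]
    refine Fintype.prod_equiv (Equiv.mulLeft u) _ _ fun g => ?_
    simp
  have hcoeff : ∀ k < Fintype.card G, F.coeff k ∈ I := by
    intro k hk
    refine Ideal.subset_span ⟨mem_adjoin_of_mem_augIdeal hθ (mem_augIdeal_iff.2 ?_), ?_⟩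
    · have := congrArg (Polynomial.coeff · k) hconst
      simpa [Polynomial.coeff_X_pow, hk.ne] using this
    · change _ ∈ NonUnitalSubalgebra.centralizer ℂ (Set.range w)
      rw [NonUnitalSubalgebra.mem_centralizer_iff]
      rintro _ ⟨u, rfl⟩
      have := congrArg (Polynomial.coeff · k) (hinv u)
      simp only [Polynomial.coeff_map, RingHom.coe_coe] at this
      rw [hwθ, this]
  refine ⟨Fintype.card G, ?_⟩
  rw [Polynomial.eval_eq_sum_range, Finset.sum_range_succ, hmonic.coeff_natDegree, one_mul, hdeg,
    add_comm] at hroot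
  rw [eq_neg_of_add_eq_zero_left hroot]
  exact neg_mem (Submodule.sum_mem _ fun k hk =>
    Ideal.mul_mem_right _ _ (hcoeff k (Finset.mem_range.1 hk)))

end Invariants

section LocallyNilpotent

open MvPolynomial

variable {A : Type u} [Ring A] [Algebra ℂ A] {ι : Type*} [Fintype ι]

/-- Passing to the opposite ring reverses products, which is harmless since all lists of a given
length are tested. -/
theorem rightLocallyNilpotent_iff {S : Set A} {M : Type u} [AddCommGroup M] [Module Aᵐᵒᵖ M] :
    RightLocallyNilpotent S M ↔ LeftLocallyNilpotent (MulOpposite.op '' S) M := by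
  refine forall_congr' fun m => exists_congr fun n => ⟨fun h l hl hlS => ?_, fun h l hl hlS => ?_⟩
  · have := h (l.map MulOpposite.unop).reverse (by simpa using hl) (by
      simp only [List.mem_reverse, List.mem_map]
      rintro _ ⟨b, hb, rfl⟩
      obtain ⟨s, hs, rfl⟩ := hlS b hb
      exact hs)
    rw [MulOpposite.op_list_prod] at this
    simpa [List.map_reverse, Function.comp_def] using this
  · rw [MulOpposite.op_list_prod]
    refine h _ (by simpa using hl) ?_
    simp only [List.mem_reverse, List.mem_map]
    rintro _ ⟨b, hb, rfl⟩
    exact ⟨b, hlS b hb, rfl⟩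

/-- Local nilpotency of a set `S` of values of polynomials without constant term over which the
variables are integral amounts to local nilpotency of all such polynomials. -/
theorem leftLocallyNilpotent_iff {θ : MvPolynomial ι ℂ →ₐ[ℂ] A} {S : Set A}
    (h1 : ∀ s ∈ S, ∃ p ∈ augIdeal ι, θ p = s)
    (h2 : ∀ i, (X i : MvPolynomial ι ℂ) ∈ (Ideal.span {p | θ p ∈ S}).radical)
    {M : Type u} [AddCommGroup M] [Module A M] :
    LeftLocallyNilpotent S M ↔ ∀ m : M, ∃ n : ℕ, ∀ p ∈ augIdeal ι ^ n, θ p • m = 0 := by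
  constructor
  · intro h m
    obtain ⟨n, hn⟩ := h m
    have key : ∀ (k : ℕ) (m : M),
        (∀ l : List A, l.length = k → (∀ a ∈ l, a ∈ S) → l.prod • m = 0) →
        ∀ p ∈ Ideal.span {p | θ p ∈ S} ^ k, θ p • m = 0 := by
      intro k
      induction k with
      | zero =>
        intro m hm p _
        have : m = 0 := by simpa using hm [] rfl (by simp)
        rw [this, smul_zero]
      | succ k ih =>
        intro m hm p hp
        rw [pow_succ] at hp
        induction hp using Submodule.mul_induction_on' with
        | mem_mul_mem p hp q hq =>
          induction hq using Submodule.span_induction with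
          | mem q hq =>
            rw [map_mul, mul_smul]
            refine ih _ (fun l hl hlS => ?_) p hp
            rw [smul_smul]
            -- The factor `θ q` acts on `m` first, hence stands last in the list.
            have := hm (l ++ [θ q]) (by simp [hl]) (by
              intro a ha
              rcases List.mem_append.1 ha with ha | ha
              · exact hlS a ha
              · rw [List.mem_singleton.1 ha]; exact hq)
            simpa using this
          | zero => simp
          | add x y _ _ hx hy => rw [mul_add, map_add, add_smul, hx, hy, add_zero]
          | smul r x _ hx =>
            rw [smul_eq_mul, mul_left_comm, map_mul, mul_smul, hx, smul_zero]
        | add x _ y _ hx hy => rw [map_add, add_smul, hx, hy, add_zero]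
    have hle : augIdeal ι ≤ (Ideal.span {p | θ p ∈ S}).radical := by
      rw [augIdeal, Ideal.span_le]
      rintro _ ⟨i, rfl⟩
      exact h2 i
    -- As `𝔪` is finitely generated, a single power `𝔪ᵏ` lies in the ideal generated by `S`; then
    -- `𝔪ᵏⁿ` lies in its `n`-th power.
    obtain ⟨k, hk⟩ := Ideal.exists_pow_le_of_le_radical_of_fg hle
      (IsNoetherian.noetherian (augIdeal ι))
    refine ⟨k * n, fun p hp => key n m hn p ?_⟩
    rw [pow_mul] at hp
    exact Ideal.pow_right_mono hk n hp
  · intro h m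
    obtain ⟨n, hn⟩ := h m
    refine ⟨n, fun l hl hlS => ?_⟩
    have : ∀ l : List A, (∀ a ∈ l, a ∈ S) → ∃ p ∈ augIdeal ι ^ l.length, θ p = l.prod := by
      intro l
      induction l with
      | nil => exact fun _ => ⟨1, by simp⟩
      | cons b l ih =>
        intro hl
        obtain ⟨p, hp, hpb⟩ := h1 b (hl b List.mem_cons_self)
        obtain ⟨q, hq, hql⟩ := ih fun a ha => hl a (List.mem_cons_of_mem _ ha)
        refine ⟨p * q, ?_, by rw [map_mul, hpb, hql, List.prod_cons]⟩
        rw [List.length_cons, pow_succ']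
        exact Ideal.mul_mem_mul hp hq
    obtain ⟨p, hp, hpl⟩ := this l hlS
    rw [← hpl]
    exact hn p (hl ▸ hp)

end LocallyNilpotent

end

/-! ### The rational Cherednik algebra carries triangular data -/

noncomputable section

namespace Cherednik

set_option linter.unusedSectionVars false

variable {E : Type u} [NormedAddCommGroup E] [InnerProductSpace ℝ E] [FiniteDimensional ℝ E]
  {W : Subgroup (E ≃ₗᵢ[ℝ] E)} {a : Refl W → E} {c : Refl W → ℂ}

theorem mk_rel {p q : FreeAlgebra ℂ (Gen W)} (h : Rel W a c p q) : mk W a c p = mk W a c q :=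
  RingQuot.mkAlgHom_rel ℂ h

variable (W a c) in
/-- The linear map from `𝔥` to the Cherednik algebra. -/
def ofYₗ : 𝔥 E →ₗ[ℂ] H W a c where
  toFun := ofY W a c
  map_add' y₁ y₂ := (mk_rel (.y_add y₁ y₂)).trans (map_add _ _ _)
  map_smul' z y := (mk_rel (.y_smul z y)).trans (map_smul _ _ _)

variable (W a c) in
/-- The linear map from `𝔥*` to the Cherednik algebra. -/
def ofXₗ : 𝔥Dual E →ₗ[ℂ] H W a c where
  toFun := ofX W a c
  map_add' y₁ y₂ := (mk_rel (.x_add y₁ y₂)).trans (map_add _ _ _)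
  map_smul' z y := (mk_rel (.x_smul z y)).trans (map_smul _ _ _)

variable (W a c) in
/-- The homomorphism from `W` to the Cherednik algebra. -/
def ofWₘ : W →* H W a c where
  toFun := ofW W a c
  map_one' := (mk_rel .w_one).trans (map_one _)
  map_mul' u v := (mk_rel (.w_mul u v)).trans (map_mul _ _ _)

theorem ofXₗ_comm (x₁ x₂ : 𝔥Dual E) :
    ofXₗ W a c x₁ * ofXₗ W a c x₂ = ofXₗ W a c x₂ * ofXₗ W a c x₁ := by
  have := mk_rel (a := a) (c := c) (.x_comm x₁ x₂)
  rwa [map_mul, map_mul] at this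

theorem ofYₗ_comm (y₁ y₂ : 𝔥 E) :
    ofYₗ W a c y₁ * ofYₗ W a c y₂ = ofYₗ W a c y₂ * ofYₗ W a c y₁ := by
  have := mk_rel (a := a) (c := c) (.y_comm y₁ y₂)
  rwa [map_mul, map_mul] at this

theorem ofWₘ_inv_mul (w : W) : ofWₘ W a c w⁻¹ * ofWₘ W a c w = 1 := by
  rw [← map_mul, inv_mul_cancel, map_one]

theorem ofWₘ_mul_ofXₗ (w : W) (x : 𝔥Dual E) :
    ofWₘ W a c w * ofXₗ W a c x = ofXₗ W a c (actDual w.1 x) * ofWₘ W a c w := by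
  have : ofWₘ W a c w * ofXₗ W a c x * ofWₘ W a c w⁻¹ = ofXₗ W a c (actDual w.1 x) := by
    have := mk_rel (a := a) (c := c) (.w_x w x)
    rwa [map_mul, map_mul] at this
  rw [← this, mul_assoc, ofWₘ_inv_mul, mul_one]

theorem ofWₘ_mul_ofYₗ (w : W) (y : 𝔥 E) :
    ofWₘ W a c w * ofYₗ W a c y = ofYₗ W a c (act w.1 y) * ofWₘ W a c w := by
  have : ofWₘ W a c w * ofYₗ W a c y * ofWₘ W a c w⁻¹ = ofYₗ W a c (act w.1 y) := by
    have := mk_rel (a := a) (c := c) (.w_y w y)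
    rwa [map_mul, map_mul] at this
  rw [← this, mul_assoc, ofWₘ_inv_mul, mul_one]

theorem ofYₗ_mul_ofXₗ_sub [Fintype (Refl W)] (y : 𝔥 E) (x : 𝔥Dual E) :
    ofYₗ W a c y * ofXₗ W a c x - ofXₗ W a c x * ofYₗ W a c y =
      algebraMap ℂ _ (x y) +
        ∑ s : Refl W, (c s * root (a s) y * x (coroot (a s))) • ofWₘ W a c s.1 := by
  have := mk_rel (a := a) (c := c) (.y_x y x)
  rw [finsum_eq_sum_of_fintype] at this
  simp only [map_sub, map_mul, map_add, map_sum, map_smul, AlgHom.commutes] at this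
  exact this

/-- The representation of `W` on `𝔥`. -/
def repY (W : Subgroup (E ≃ₗᵢ[ℝ] E)) : Representation ℂ W (𝔥 E) where
  toFun w := act w.1
  map_one' := by
    ext e
    simp [act]
  map_mul' u v := by
    ext e
    simp [act]

theorem act_mul (u v : E ≃ₗᵢ[ℝ] E) : act (u * v) = act u ∘ₗ act v := by
  ext e
  simp [act]

/-- The representation of `W` on `𝔥*`. -/
def repX (W : Subgroup (E ≃ₗᵢ[ℝ] E)) : Representation ℂ W (𝔥Dual E) where
  toFun w := { toFun := actDual w.1, map_add' := fun _ _ => rfl, map_smul' := fun _ _ => rfl }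
  map_one' := by
    ext x e
    simp [actDual, act]
  map_mul' u v := by
    refine LinearMap.ext fun x => ?_
    change x ∘ₗ act (u.1 * v.1)⁻¹ = (x ∘ₗ act v.1⁻¹) ∘ₗ act u.1⁻¹
    rw [mul_inv_rev, act_mul, LinearMap.comp_assoc]

theorem act_refl (ha : IsRootChoice W a) (s : Refl W) (y : 𝔥 E) :
    act s.1.1 y = y - root (a s) y • coroot (a s) := by
  induction y using TensorProduct.induction_on with
  | zero => simp
  | tmul z e =>
    have h : s.1.1 e = e - (2 * inner ℝ (a s) e / inner ℝ (a s) (a s)) • a s := by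
      rw [(ha s).2, Submodule.reflection_orthogonal_apply, Submodule.reflection_singleton_apply,
        real_inner_self_eq_norm_sq]
      simp only [RCLike.ofReal_real_eq_id, id_eq, smul_smul, ← Nat.cast_smul_eq_nsmul ℝ]
      rw [neg_sub]
      congr 2
      push_cast
      ring
    simp only [act, LinearMap.baseChange_tmul, root, Module.Dual.baseChange_apply_tmul, coroot]
    change z ⊗ₜ[ℝ] (s.1.1 e) = _
    rw [h, TensorProduct.tmul_sub, TensorProduct.smul_tmul', smul_eq_mul, mul_one,
      ← TensorProduct.smul_tmul', ← TensorProduct.tmul_smul, smul_smul]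
    congr 3
    simp only [innerₛₗ_apply_apply]
    ring
  | add y₁ y₂ h₁ h₂ => rw [map_add, h₁, h₂, map_add, add_smul]; abel

theorem refl_inv (ha : IsRootChoice W a) (s : Refl W) : s.1⁻¹ = s.1 := by
  apply Subtype.ext
  rw [Subgroup.coe_inv, (ha s).2]
  exact Submodule.reflection_inv

theorem actDual_refl (ha : IsRootChoice W a) (s : Refl W) (x : 𝔥Dual E) :
    actDual s.1.1 x = x - x (coroot (a s)) • root (a s) := by
  refine LinearMap.ext fun y => ?_
  have h : s.1.1⁻¹ = s.1.1 := congrArg Subtype.val (refl_inv ha s)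
  rw [actDual, h, LinearMap.comp_apply, act_refl ha]
  simp [mul_comm]

variable (E) in
/-- A basis of `𝔥`. -/
def basisY : Module.Basis (Fin (Module.finrank ℝ E)) ℂ (𝔥 E) :=
  Algebra.TensorProduct.basis ℂ (Module.finBasis ℝ E)

variable (E) in
/-- The dual basis of `𝔥*`. -/
def basisX : Module.Basis (Fin (Module.finrank ℝ E)) ℂ (𝔥Dual E) := (basisY E).dualBasis

theorem sum_basisX_smul_basisY (y : 𝔥 E) : ∑ i, basisX E i y • basisY E i = y := by
  simp [basisX, (basisY E).sum_repr y]

theorem sum_smul_basisX (x : 𝔥Dual E) : ∑ i, x (basisY E i) • basisX E i = x := by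
  refine (basisY E).ext fun j => ?_
  simp [basisX]

variable (W a c) in
/-- The group part of the Euler element. -/
def kappa : H W a c := ∑ᶠ s : Refl W, c s • ofWₘ W a c s.1

/-- Summing over dual bases, `∑ xᵢ[yᵢ, x]` equals `x` plus `∑ cₛ⟨αₛ^∨, x⟩ αₛ s`. Since `s(x) = x -
⟨αₛ^∨, x⟩αₛ`, the commutator of `∑ cₛ s` with `x` cancels the second sum. -/
theorem euler_X [Fintype (Refl W)] (ha : IsRootChoice W a) (x : 𝔥Dual E) :
    (∑ i, ofXₗ W a c (basisX E i) * ofYₗ W a c (basisY E i) + kappa W a c) * ofXₗ W a c x =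
      ofXₗ W a c x * (∑ i, ofXₗ W a c (basisX E i) * ofYₗ W a c (basisY E i) + kappa W a c) +
        ofXₗ W a c x := by
  have h1 : (∑ i, ofXₗ W a c (basisX E i) * ofYₗ W a c (basisY E i)) * ofXₗ W a c x =
      ofXₗ W a c x * (∑ i, ofXₗ W a c (basisX E i) * ofYₗ W a c (basisY E i)) + ofXₗ W a c x +
        ∑ s : Refl W, (c s * x (coroot (a s))) • (ofXₗ W a c (root (a s)) * ofWₘ W a c s.1) := by
    have hi : ∀ i, ofXₗ W a c (basisX E i) * ofYₗ W a c (basisY E i) * ofXₗ W a c x =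
        ofXₗ W a c x * (ofXₗ W a c (basisX E i) * ofYₗ W a c (basisY E i)) +
        (ofXₗ W a c (x (basisY E i) • basisX E i) +
        ∑ s : Refl W, (c s * x (coroot (a s))) •
          (ofXₗ W a c (root (a s) (basisY E i) • basisX E i) * ofWₘ W a c s.1)) := by
      intro i
      rw [mul_assoc, sub_eq_iff_eq_add'.1 (ofYₗ_mul_ofXₗ_sub (basisY E i) x), mul_add, ← mul_assoc,
        ofXₗ_comm, mul_assoc, mul_add, ← Algebra.commutes, ← Algebra.smul_def, map_smul,
        Finset.mul_sum]
      congr 2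
      refine Finset.sum_congr rfl fun s _ => ?_
      rw [mul_smul_comm, map_smul, smul_mul_assoc, smul_smul]
      congr 1
      ring
    rw [Finset.sum_mul, Finset.sum_congr rfl fun i _ => hi i, Finset.sum_add_distrib,
      ← Finset.mul_sum, Finset.sum_add_distrib, ← map_sum, sum_smul_basisX, Finset.sum_comm,
      add_assoc]
    congr 2
    refine Finset.sum_congr rfl fun s _ => ?_
    rw [← Finset.smul_sum, ← Finset.sum_mul, ← map_sum, sum_smul_basisX]
  have h2 : kappa W a c * ofXₗ W a c x = ofXₗ W a c x * kappa W a c -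
      ∑ s : Refl W, (c s * x (coroot (a s))) • (ofXₗ W a c (root (a s)) * ofWₘ W a c s.1) := by
    rw [kappa, finsum_eq_sum_of_fintype, Finset.sum_mul, Finset.mul_sum, ← Finset.sum_sub_distrib]
    refine Finset.sum_congr rfl fun s _ => ?_
    rw [smul_mul_assoc, ofWₘ_mul_ofXₗ, actDual_refl ha, map_sub, map_smul, sub_mul, smul_sub,
      mul_smul_comm, smul_mul_assoc, smul_smul]
  rw [add_mul, h1, h2, mul_add]
  abel

theorem euler_Y [Fintype (Refl W)] (ha : IsRootChoice W a) (y : 𝔥 E) :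
    (∑ i, ofXₗ W a c (basisX E i) * ofYₗ W a c (basisY E i) + kappa W a c) * ofYₗ W a c y =
      ofYₗ W a c y * (∑ i, ofXₗ W a c (basisX E i) * ofYₗ W a c (basisY E i) + kappa W a c) -
        ofYₗ W a c y := by
  have h1 : ofYₗ W a c y * (∑ i, ofXₗ W a c (basisX E i) * ofYₗ W a c (basisY E i)) =
      (∑ i, ofXₗ W a c (basisX E i) * ofYₗ W a c (basisY E i)) * ofYₗ W a c y + ofYₗ W a c y +
        ∑ s : Refl W, (c s * root (a s) y) • (ofWₘ W a c s.1 * ofYₗ W a c (coroot (a s))) := by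
    have hi : ∀ i, ofYₗ W a c y * (ofXₗ W a c (basisX E i) * ofYₗ W a c (basisY E i)) =
        ofXₗ W a c (basisX E i) * ofYₗ W a c (basisY E i) * ofYₗ W a c y +
        (ofYₗ W a c (basisX E i y • basisY E i) +
        ∑ s : Refl W, (c s * root (a s) y) •
          (ofWₘ W a c s.1 * ofYₗ W a c (basisX E i (coroot (a s)) • basisY E i))) := by
      intro i
      rw [← mul_assoc, sub_eq_iff_eq_add'.1 (ofYₗ_mul_ofXₗ_sub y (basisX E i)), add_mul, mul_assoc,
        ofYₗ_comm, ← mul_assoc, add_mul, ← Algebra.smul_def, map_smul,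
        Finset.sum_mul]
      congr 2
      refine Finset.sum_congr rfl fun s _ => ?_
      rw [smul_mul_assoc, map_smul, mul_smul_comm, smul_smul]
    rw [Finset.mul_sum, Finset.sum_congr rfl fun i _ => hi i, Finset.sum_add_distrib,
      ← Finset.sum_mul, Finset.sum_add_distrib, ← map_sum, sum_basisX_smul_basisY, Finset.sum_comm,
      add_assoc]
    congr 2
    refine Finset.sum_congr rfl fun s _ => ?_
    rw [← Finset.smul_sum, ← Finset.mul_sum, ← map_sum, sum_basisX_smul_basisY]
  have h2 : ofYₗ W a c y * kappa W a c = kappa W a c * ofYₗ W a c y -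
      ∑ s : Refl W, (c s * root (a s) y) • (ofWₘ W a c s.1 * ofYₗ W a c (coroot (a s))) := by
    rw [kappa, finsum_eq_sum_of_fintype, Finset.sum_mul, Finset.mul_sum, ← Finset.sum_sub_distrib]
    refine Finset.sum_congr rfl fun s _ => ?_
    -- Moving `y` to the right of `s` involves `s⁻¹`, which is `s` itself.
    have h3 : ofYₗ W a c y * ofWₘ W a c s.1 = ofWₘ W a c s.1 * ofYₗ W a c (act s.1.1 y) := by
      rw [ofWₘ_mul_ofYₗ]
      congr 2
      have h : s.1 * s.1 = 1 := mul_eq_one_iff_inv_eq.2 (refl_inv ha s)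
      have := DFunLike.congr_fun (act_mul s.1.1 s.1.1) y
      rw [← Subgroup.coe_mul, h] at this
      rw [← LinearMap.comp_apply, ← this]
      exact (DFunLike.congr_fun (map_one (repY W)) y).symm
    rw [mul_smul_comm, h3, act_refl ha, map_sub, map_smul, mul_sub, smul_sub,
      mul_smul_comm, smul_mul_assoc, smul_smul]
  rw [add_mul, mul_add, h1, h2]
  abel

theorem adjoin_generators : Algebra.adjoin ℂ
    (Set.range (fun i => ofXₗ W a c (basisX E i)) ∪ Set.range (fun i => ofYₗ W a c (basisY E i)) ∪
      Set.range (ofWₘ W a c)) = ⊤ := by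
  set U := Algebra.adjoin ℂ
    (Set.range (fun i => ofXₗ W a c (basisX E i)) ∪ Set.range (fun i => ofYₗ W a c (basisY E i)) ∪
      Set.range (ofWₘ W a c))
  have hU : (⊤ : Subalgebra ℂ (FreeAlgebra ℂ (Gen W))) ≤ U.comap (mk W a c) := by
    rw [← FreeAlgebra.adjoin_range_ι, Algebra.adjoin_le_iff]
    rintro _ ⟨y | x | w, rfl⟩
    · change ofYₗ W a c y ∈ U
      rw [← sum_basisX_smul_basisY y, map_sum]
      refine sum_mem fun i _ => ?_
      rw [map_smul]
      exact U.smul_mem (Algebra.subset_adjoin (Or.inl (Or.inr ⟨i, rfl⟩))) _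
    · change ofXₗ W a c x ∈ U
      rw [← sum_smul_basisX x, map_sum]
      refine sum_mem fun i _ => ?_
      rw [map_smul]
      exact U.smul_mem (Algebra.subset_adjoin (Or.inl (Or.inl ⟨i, rfl⟩))) _
    · exact Algebra.subset_adjoin (Or.inr ⟨w, rfl⟩)
  refine eq_top_iff.2 fun h _ => ?_
  obtain ⟨p, rfl⟩ := RingQuot.mkAlgHom_surjective ℂ (Rel W a c) h
  exact hU Algebra.mem_top

/-- The triangular structure of the Cherednik algebra. -/
def triangularData [Finite W] (ha : IsRootChoice W a) :
    TriangularData (H W a c) (Fin (Module.finrank ℝ E)) W where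
  φ := commLift (fun i => ofXₗ W a c (basisX E i)) fun _ _ => ofXₗ_comm _ _
  ψ := commLift (fun i => ofYₗ W a c (basisY E i)) fun _ _ => ofYₗ_comm _ _
  w := ofWₘ W a c
  κ := kappa W a c
  w_φ w i := by
    refine ⟨fun j => actDual w.1 (basisX E i) (basisY E j), ?_⟩
    simp only [map_sum, map_smul, commLift_X, ofWₘ_mul_ofXₗ]
    congr 1
    conv_lhs => rw [← sum_smul_basisX (actDual w.1 (basisX E i))]
    simp only [map_sum, map_smul]
  w_ψ w i := by
    refine ⟨fun j => basisX E j (act w.1 (basisY E i)), ?_⟩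
    simp only [map_sum, map_smul, commLift_X, ofWₘ_mul_ofYₗ]
    congr 1
    conv_lhs => rw [← sum_basisX_smul_basisY (act w.1 (basisY E i))]
    simp only [map_sum, map_smul]
  comm i j := by
    have := Fintype.ofFinite (Refl W)
    simp only [commLift_X]
    rw [ofYₗ_mul_ofXₗ_sub, Algebra.algebraMap_eq_smul_one, ← map_one (ofWₘ W a c)]
    exact add_mem (Submodule.smul_mem _ _ (Submodule.subset_span ⟨1, rfl⟩))
      (sum_mem fun s _ => Submodule.smul_mem _ _ (Submodule.subset_span ⟨s.1, rfl⟩))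
  κ_mem := by
    have := Fintype.ofFinite (Refl W)
    rw [kappa, finsum_eq_sum_of_fintype]
    exact sum_mem fun s _ => Submodule.smul_mem _ _ (Submodule.subset_span ⟨s.1, rfl⟩)
  euler_φ i := by
    have := Fintype.ofFinite (Refl W)
    simpa only [commLift_X] using euler_X ha (basisX E i)
  euler_ψ i := by
    have := Fintype.ofFinite (Refl W)
    simpa only [commLift_X] using euler_Y ha (basisY E i)
  generate := by simpa only [commLift_X] using adjoin_generators

end Cherednik

end

/-! ### Weights of the Euler element and the largest proper submodule -/

noncomputable section

namespace TriangularData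

open MvPolynomial

variable {A : Type*} [Ring A] [Algebra ℂ A] {ι G : Type*} [Fintype ι] [Group G]
  (T : TriangularData A ι G) {M : Type*} [AddCommGroup M] [Module ℂ M] [Module A M]
  [IsScalarTower ℂ A M]

/-- The polynomial with the roots `z, z + 1, …, z + n - 1`. -/
def weightPoly (z : ℂ) (n : ℕ) : Polynomial ℂ :=
  ∏ k ∈ Finset.range n, (Polynomial.X - Polynomial.C (z + k))

theorem weightPoly_dvd (z : ℂ) {m n : ℕ} (h : m ≤ n) : weightPoly z m ∣ weightPoly z n :=
  Finset.prod_dvd_prod_of_subset _ _ _ (Finset.range_mono h)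

theorem weightPoly_succ (z : ℂ) (n : ℕ) :
    weightPoly z (n + 1) = (Polynomial.X - Polynomial.C z) * weightPoly (z + 1) n := by
  rw [weightPoly, Finset.prod_range_succ', mul_comm, weightPoly]
  congr 1
  · simp
  · refine Finset.prod_congr rfl fun k _ => ?_
    congr 2
    push_cast
    ring

/-- The span of the eigenvectors of the Euler element with eigenvalues in `z + ℕ`. -/
def weights (M : Type*) [AddCommGroup M] [Module ℂ M] [Module A M] [IsScalarTower ℂ A M] (z : ℂ) :
    Submodule ℂ M where
  carrier := {m | ∃ n, Polynomial.aeval T.δ (weightPoly z n) • m = 0}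
  zero_mem' := ⟨0, smul_zero _⟩
  add_mem' := by
    rintro x y ⟨m, hm⟩ ⟨n, hn⟩
    obtain ⟨f, hf⟩ := weightPoly_dvd z (le_max_left m n)
    obtain ⟨g, hg⟩ := weightPoly_dvd z (le_max_right m n)
    refine ⟨max m n, ?_⟩
    rw [smul_add]
    nth_rewrite 1 [hf]
    rw [hg, mul_comm, map_mul, mul_smul, hm, mul_comm, map_mul, mul_smul, hn]
    simp
  smul_mem' := by
    rintro t x ⟨n, hn⟩
    exact ⟨n, by rw [smul_algebra_smul_comm, hn, smul_zero]⟩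

variable {T}

theorem weights_succ_le {z : ℂ} {m : M} (hm : m ∈ T.weights M (z + 1)) : m ∈ T.weights M z := by
  obtain ⟨n, hn⟩ := hm
  exact ⟨n + 1, by rw [weightPoly_succ, map_mul, mul_smul, hn, smul_zero]⟩

theorem φ_weights {z : ℂ} {m : M} (hm : m ∈ T.weights M z) (i : ι) :
    T.φ (X i) • m ∈ T.weights M (z + 1) := by
  obtain ⟨n, hn⟩ := hm
  refine ⟨n, ?_⟩
  have h : Polynomial.aeval (T.δ + 1) (weightPoly (z + 1) n) =
      Polynomial.aeval T.δ (weightPoly z n) := by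
    have h1 : (weightPoly (z + 1) n).comp (Polynomial.X + 1) = weightPoly z n := by
      simp only [weightPoly, Polynomial.prod_comp]
      refine Finset.prod_congr rfl fun k _ => ?_
      rw [Polynomial.sub_comp, Polynomial.X_comp, Polynomial.C_comp]
      simp only [map_add, map_one]
      ring
    rw [← h1, Polynomial.aeval_comp]
    simp
  rw [smul_smul, T.aeval_δ_φ, h, mul_smul, hn, smul_zero]

theorem φ_smul_weights {z : ℂ} {m : M} (hm : T.δ • m = z • m) (p : MvPolynomial ι ℂ) :
    T.φ p • m ∈ T.weights M z := by
  induction p using MvPolynomial.induction_on with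
  | C t =>
    rw [← algebraMap_eq, AlgHom.commutes, algebraMap_smul]
    refine Submodule.smul_mem _ _ ⟨1, ?_⟩
    simp [weightPoly, sub_smul, algebraMap_smul, hm]
  | add p q hp hq => rw [map_add, add_smul]; exact add_mem hp hq
  | mul_X p i hp =>
    rw [mul_comm, map_mul, mul_smul]
    exact weights_succ_le (φ_weights hp i)

theorem φ_smul_weights_succ {z : ℂ} {m : M} (hm : T.δ • m = z • m) {p : MvPolynomial ι ℂ}
    (hp : p ∈ augIdeal ι) : T.φ p • m ∈ T.weights M (z + 1) := by
  rw [← Ideal.mul_top (augIdeal ι), ← smul_eq_mul, mem_augIdeal_smul] at hp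
  obtain ⟨f, -, rfl⟩ := hp
  rw [map_sum, Finset.sum_smul]
  refine sum_mem fun i _ => ?_
  rw [smul_eq_mul, map_mul, mul_smul]
  exact φ_weights (φ_smul_weights hm _) i

theorem aeval_smul_of_eigenvector {z : ℂ} {m : M} (hm : T.δ • m = z • m) (p : Polynomial ℂ) :
    Polynomial.aeval T.δ p • m = p.eval z • m := by
  induction p using Polynomial.induction_on with
  | C t => rw [Polynomial.aeval_C, algebraMap_smul, Polynomial.eval_C]
  | add p q hp hq => rw [map_add, add_smul, hp, hq, Polynomial.eval_add, add_smul]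
  | monomial k t ih =>
    rw [pow_succ', ← mul_assoc, mul_comm _ Polynomial.X, mul_assoc, map_mul, Polynomial.aeval_X,
      mul_smul, ih, smul_algebra_smul_comm, hm, smul_smul,
      Polynomial.eval_mul (p := Polynomial.X), Polynomial.eval_X, mul_comm]

/-- The roots start at `z + 1`, so the lowest weight `z` is separated from all higher ones. -/
theorem weightPoly_eval_ne_zero (z : ℂ) (n : ℕ) : (weightPoly (z + 1) n).eval z ≠ 0 := by
  rw [weightPoly, Polynomial.eval_prod, Finset.prod_ne_zero_iff]
  intro k _ h
  simp only [Polynomial.eval_sub, Polynomial.eval_X, Polynomial.eval_C] at h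
  have h1 : ((k + 1 : ℕ) : ℂ) = 0 := by push_cast; linear_combination -h
  exact Nat.cast_ne_zero.2 k.succ_ne_zero h1

/-- A module generated by lowest weight vectors of weight `z` has a largest proper submodule
if these vectors form an irreducible representation. -/
theorem sSup_ne_top [Nontrivial M] {V : Type*} [AddCommGroup V] [Module ℂ V]
    (σ : Representation ℂ G V) [σ.IsIrreducible] (j : V →ₗ[ℂ] M)
    (hw : ∀ g v, T.w g • j v = j (σ g v)) (hψ : ∀ i v, T.ψ (X i) • j v = 0)
    {z : ℂ} (hδ : ∀ v, T.δ • j v = z • j v) (hspan : Submodule.span A (Set.range j) = ⊤) :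
    sSup {N : Submodule A M | N ≠ ⊤} ≠ ⊤ := by
  -- Modulo higher weights only the constant terms of `p` and `q` in `φ p * (w g * ψ q)` contribute,
  -- so the lowest layer is the image of `j`.
  have hdec : ∀ m : M, ∃ v, m - j v ∈ T.weights M (z + 1) := by
    have hadd : ∀ x y : M, (∃ v, x - j v ∈ T.weights M (z + 1)) →
        (∃ v, y - j v ∈ T.weights M (z + 1)) → ∃ v, x + y - j v ∈ T.weights M (z + 1) := by
      rintro x y ⟨v, hv⟩ ⟨u, hu⟩
      refine ⟨v + u, ?_⟩
      rw [map_add, add_sub_add_comm]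
      exact add_mem hv hu
    have hgen : ∀ (b : A) v, ∃ u, b • j v - j u ∈ T.weights M (z + 1) := by
      intro b v
      have hb : b ∈ (⊤ : Submodule ℂ A) := Submodule.mem_top
      rw [← T.span_triangular] at hb
      induction hb using Submodule.span_induction with
      | mem x hx =>
        obtain ⟨⟨p, g, q⟩, rfl⟩ := hx
        have hq : T.ψ q • j v = constantCoeff q • j v := by
          have h1 : q - C (constantCoeff q) ∈ augIdeal ι := by rw [mem_augIdeal_iff]; simp
          rw [← Ideal.mul_top (augIdeal ι), ← smul_eq_mul, mem_augIdeal_smul] at h1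
          obtain ⟨f, -, hf⟩ := h1
          rw [sub_eq_iff_eq_add.1 hf, map_add, ← algebraMap_eq, AlgHom.commutes, add_smul,
            algebraMap_smul, map_sum, Finset.sum_smul, Finset.sum_eq_zero, zero_add]
          · congr 1
            simp
          · intro i _
            rw [smul_eq_mul, mul_comm, map_mul, mul_smul, hψ, smul_zero]
        refine ⟨constantCoeff p • σ g (constantCoeff q • v), ?_⟩
        have h2 : p - C (constantCoeff p) ∈ augIdeal ι := by rw [mem_augIdeal_iff]; simp
        have h3 := φ_smul_weights_succ (hδ (σ g (constantCoeff q • v))) h2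
        rw [map_sub, sub_smul, ← algebraMap_eq, AlgHom.commutes, algebraMap_smul] at h3
        simp only
        rw [mul_smul, mul_smul, hq, ← map_smul, hw, map_smul j]
        exact h3
      | zero => exact ⟨0, by simp⟩
      | add x y _ _ hx hy => rw [add_smul]; exact hadd _ _ hx hy
      | smul t x _ hx =>
        obtain ⟨u, hu⟩ := hx
        refine ⟨t • u, ?_⟩
        rw [smul_assoc, map_smul, ← smul_sub]
        exact Submodule.smul_mem _ _ hu
    have hsmul : ∀ (b : A) (m : M), ∃ v, b • m - j v ∈ T.weights M (z + 1) := by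
      intro b m
      have hm : m ∈ Submodule.span A (Set.range j) := hspan ▸ Submodule.mem_top
      induction hm using Submodule.span_induction generalizing b with
      | mem x hx => obtain ⟨v, rfl⟩ := hx; exact hgen b v
      | zero => exact ⟨0, by simp⟩
      | add x y _ _ hx hy => rw [smul_add]; exact hadd _ _ (hx b) (hy b)
      | smul r x _ hx => rw [smul_smul]; exact hx _
    exact fun m => by simpa using hsmul 1 m
  -- A polynomial in `δ` extracts the lowest component `j v` of `m` inside `N`. By irreducibility
  -- either `v = 0` or `N` contains all of `j` and is everything.
  have hproper : ∀ N : Submodule A M, N ≠ ⊤ → ∀ m ∈ N, m ∈ T.weights M (z + 1) := by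
    intro N hN m hm
    obtain ⟨v, hv⟩ := hdec m
    have hvN : j v ∈ N := by
      obtain ⟨n, hn⟩ := hv
      have h1 := N.smul_mem (Polynomial.aeval T.δ (weightPoly (z + 1) n)) hm
      rw [smul_sub, sub_eq_zero] at hn
      rw [hn, aeval_smul_of_eigenvector (hδ v)] at h1
      have h2 := (N.restrictScalars ℂ).smul_mem ((weightPoly (z + 1) n).eval z)⁻¹ h1
      rwa [smul_smul, inv_mul_cancel₀ (weightPoly_eval_ne_zero z n), one_smul] at h2
    let U : Subrepresentation σ :=
      { toSubmodule := (N.restrictScalars ℂ).comap j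
        apply_mem_toSubmodule := fun g u hu => by
          change j (σ g u) ∈ N
          rw [← hw]
          exact N.smul_mem _ hu }
    have hvU : v ∈ U.toSubmodule := hvN
    rcases eq_bot_or_eq_top U with hU | hU
    · rw [hU] at hvU
      have : v = 0 := hvU
      simpa [this] using hv
    · refine absurd (top_le_iff.1 ?_) hN
      rw [← hspan, Submodule.span_le]
      rintro _ ⟨u, rfl⟩
      have : u ∈ U.toSubmodule := by rw [hU]; exact Submodule.mem_top (R := ℂ) (x := u)
      exact this
  -- Containment in the higher weights, unlike properness, survives sums; if the sum were
  -- everything, `j` would vanish.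
  intro htop
  have hall : ∀ m : M, m ∈ T.weights M (z + 1) := by
    intro m
    have hm : m ∈ sSup {N : Submodule A M | N ≠ ⊤} := by rw [htop]; exact Submodule.mem_top
    rw [sSup_eq_iSup'] at hm
    induction hm using Submodule.iSup_induction' with
    | mem N x hx => exact hproper N.1 N.2 x hx
    | zero => exact zero_mem _
    | add x y _ _ hx hy => exact add_mem hx hy
  have hj : ∀ v, j v = 0 := by
    intro v
    obtain ⟨n, hn⟩ := hall (j v)
    rw [aeval_smul_of_eigenvector (hδ v)] at hn
    exact (smul_eq_zero.1 hn).resolve_left (weightPoly_eval_ne_zero z n)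
  have : (⊤ : Submodule A M) = ⊥ := by
    rw [← hspan, Submodule.span_eq_bot]
    rintro _ ⟨v, rfl⟩
    exact hj v
  exact top_ne_bot this

end TriangularData

end

/-! ### Simple locally nilpotent modules as quotients of standard modules -/

noncomputable section

namespace Cherednik

set_option linter.unusedSectionVars false

open MvPolynomial

variable {E : Type u} [NormedAddCommGroup E] [InnerProductSpace ℝ E] [FiniteDimensional ℝ E]
  {W : Subgroup (E ≃ₗᵢ[ℝ] E)} {a : Refl W → E} {c : Refl W → ℂ}

theorem reflection_conj (w : E ≃ₗᵢ[ℝ] E) (v : E) :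
    w * (Submodule.span ℝ {v})ᗮ.reflection * w⁻¹ = (Submodule.span ℝ {w v})ᗮ.reflection := by
  ext e
  have h1 : inner ℝ v (w⁻¹ e) = inner ℝ (w v) e := by
    rw [← w.inner_map_map v (w⁻¹ e)]
    congr 1
    exact w.apply_symm_apply e
  change w ((Submodule.span ℝ {v})ᗮ.reflection (w⁻¹ e)) = _
  rw [Submodule.reflection_orthogonal_apply, Submodule.reflection_orthogonal_apply,
    Submodule.reflection_singleton_apply, Submodule.reflection_singleton_apply, h1,
    w.norm_map]
  simp

/-- Conjugation of reflections. -/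
def conjRefl (w : W) (s : Refl W) : Refl W :=
  ⟨w * s.1 * w⁻¹, by
    obtain ⟨v, hv, hs⟩ := s.2
    refine ⟨w.1 v, by simpa using hv, ?_⟩
    rw [← reflection_conj, ← hs]
    rfl⟩

/-- Conjugation of reflections as a permutation. -/
def conjReflEquiv (w : W) : Refl W ≃ Refl W where
  toFun := conjRefl w
  invFun := conjRefl w⁻¹
  left_inv s := Subtype.ext (by simp [conjRefl, mul_assoc])
  right_inv s := Subtype.ext (by simp [conjRefl, mul_assoc])

/-- The class sum acts on an irreducible representation by a scalar. -/
theorem exists_scalar [Fintype (Refl W)] (hc : IsInvariant W c) {V : Type*} [AddCommGroup V]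
    [Module ℂ V] [FiniteDimensional ℂ V] (σ : Representation ℂ W V) [hσ : σ.IsIrreducible] :
    ∃ z : ℂ, ∀ v, ∑ s : Refl W, c s • σ s.1 v = z • v := by
  -- Conjugation permutes the reflections and preserves `c`, so `K` commutes with `W` and an
  -- eigenspace of `K` is a nonzero subrepresentation.
  let K : Module.End ℂ V := ∑ s : Refl W, c s • σ s.1
  have hK : ∀ v, K v = ∑ s : Refl W, c s • σ s.1 v := fun v => by simp [K]
  have hcomm : ∀ w v, K (σ w v) = σ w (K v) := by
    intro w v
    rw [hK, hK, map_sum, ← Equiv.sum_comp (conjReflEquiv w)]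
    refine Finset.sum_congr rfl fun s _ => ?_
    have h1 : c (conjReflEquiv w s) = c s := hc w s _ rfl
    have h2 : σ (conjReflEquiv w s).1 (σ w v) = σ w (σ s.1 v) := by
      rw [← Module.End.mul_apply, ← map_mul, ← Module.End.mul_apply, ← map_mul]
      congr 2
      simp [conjReflEquiv, conjRefl]
    rw [h1, h2, map_smul]
  have hnt : Nontrivial V := by
    by_contra h
    rw [not_nontrivial_iff_subsingleton] at h
    obtain ⟨x, y, hxy⟩ := hσ.exists_pair_ne
    exact hxy (Subrepresentation.toSubmodule_injective (Subsingleton.elim _ _))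
  obtain ⟨z, hz⟩ := Module.End.exists_eigenvalue K
  refine ⟨z, fun v => ?_⟩
  let U : Subrepresentation σ :=
    { toSubmodule := K.eigenspace z
      apply_mem_toSubmodule := fun w u hu => by
        rw [Module.End.mem_eigenspace_iff] at hu ⊢
        rw [hcomm, hu, map_smul] }
  have hU : U = ⊤ := (eq_bot_or_eq_top U).resolve_left fun h => hz (congrArg (·.toSubmodule) h)
  have hv : v ∈ U.toSubmodule := by rw [hU]; exact Submodule.mem_top (R := ℂ) (x := v)
  rw [← hK]
  exact Module.End.mem_eigenspace_iff.1 hv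

/-- A nonzero finite-dimensional representation inside a module contains an irreducible one. -/
theorem exists_irreducible {G M : Type*} [Group G] [AddCommGroup M] [Module ℂ M]
    (ρ : Representation ℂ G M) (N : Submodule ℂ M) [FiniteDimensional ℂ N]
    (hN : ∀ g, ∀ m ∈ N, ρ g m ∈ N) (hN0 : N ≠ ⊥) :
    ∃ (V : Submodule ℂ M) (σ : Representation ℂ G V), V ≤ N ∧
      (∀ g v, (σ g v : M) = ρ g v) ∧ σ.IsIrreducible ∧ V ≠ ⊥ := by
  classical
  -- A nonzero invariant subspace of least dimension is irreducible.
  have hex : ∃ d, ∃ V : Submodule ℂ M, V ≤ N ∧ V ≠ ⊥ ∧ (∀ g, ∀ m ∈ V, ρ g m ∈ V) ∧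
      Module.finrank ℂ V = d := ⟨_, N, le_rfl, hN0, hN, rfl⟩
  obtain ⟨V, hVN, hV0, hV, hVd⟩ := Nat.find_spec hex
  have hfin : FiniteDimensional ℂ V := Submodule.finiteDimensional_of_le hVN
  let σ : Representation ℂ G V :=
    { toFun := fun g => (ρ g).restrict (hV g)
      map_one' := by ext; simp
      map_mul' := fun g h => by ext; simp }
  refine ⟨V, σ, hVN, fun _ _ => rfl, ?_, hV0⟩
  have hnt : Nontrivial (Subrepresentation σ) := by
    obtain ⟨u, hu, hu0⟩ := Submodule.exists_mem_ne_zero_of_ne_bot hV0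
    refine ⟨⊥, ⊤, fun h => hu0 ?_⟩
    have h' : (⊥ : Submodule ℂ V) = ⊤ := congrArg (·.toSubmodule) h
    have hmem : (⟨u, hu⟩ : V) ∈ (⊥ : Submodule ℂ V) := by rw [h']; exact Submodule.mem_top
    exact congrArg Subtype.val ((Submodule.mem_bot ℂ).1 hmem)
  refine { exists_pair_ne := hnt.exists_pair_ne, eq_bot_or_eq_top := fun U => ?_ }
  by_cases hU : U.toSubmodule = ⊥
  · exact Or.inl (Subrepresentation.toSubmodule_injective hU)
  right
  let V' := U.toSubmodule.map V.subtype
  have hle : V' ≤ V := Submodule.map_subtype_le _ _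
  have hmin := Nat.find_min' hex ⟨V', hle.trans hVN, fun h => hU
      (Submodule.map_injective_of_injective V.injective_subtype
        (h.trans (Submodule.map_bot _).symm)), (by
      rintro g _ ⟨v, hv, rfl⟩
      exact ⟨σ g v, U.apply_mem_toSubmodule g hv, rfl⟩), rfl⟩
  rw [← hVd] at hmin
  have heq : V' = V := Submodule.eq_of_le_of_finrank_le hle hmin
  have htop : ∀ v : V, v ∈ U.toSubmodule := by
    intro v
    have hv : (v : M) ∈ V' := by rw [heq]; exact v.2
    obtain ⟨u, hu, huv⟩ := hv
    have : u = v := Subtype.ext huv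
    exact this ▸ hu
  have htop' : U.toSubmodule = ⊤ := Submodule.eq_top_iff'.2 htop
  exact Subrepresentation.toSubmodule_injective htop'

variable [Finite W]

theorem ofY_smul_eq_zero (ha : IsRootChoice W a) {M : Type*} [AddCommGroup M]
    [Module (H W a c) M] {m : M} (hm : ∀ i, (triangularData (c := c) ha).ψ (X i) • m = 0)
    (y : 𝔥 E) : ofY W a c y • m = 0 := by
  change ofYₗ W a c y • m = 0
  rw [← sum_basisX_smul_basisY y, map_sum, Finset.sum_smul]
  refine Finset.sum_eq_zero fun i _ => ?_
  have : ofYₗ W a c (basisY E i) • m = 0 := by simpa [triangularData] using hm i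
  rw [map_smul, Algebra.smul_def, mul_smul, this, smul_zero]

/-- A simple locally nilpotent module is a simple highest weight module. -/
theorem exists_L_equiv (ha : IsRootChoice W a) (hc : IsInvariant W c) (M : Type u) [AddCommGroup M]
    [Module (H W a c) M] [IsSimpleModule (H W a c) M]
    (hM : (triangularData (c := c) ha).LocNil M) :
    ∃ (V : Type u) (_ : AddCommGroup V) (_ : Module ℂ V) (σ : Representation ℂ W V),
      σ.IsIrreducible ∧ Nonempty (L a c σ ≃ₗ[H W a c] M) := by
  have hnt : Nontrivial M := IsSimpleModule.nontrivial (H W a c) M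
  have := Fintype.ofFinite (Refl W)
  let _ : Module ℂ M := Module.compHom M (algebraMap ℂ (H W a c))
  have htower : IsScalarTower ℂ (H W a c) M := ⟨fun z h m => by
    rw [Algebra.smul_def, mul_smul]; rfl⟩
  set T := triangularData (c := c) ha with hT
  obtain ⟨v, hv0, hv⟩ := hM.exists_ne_zero
  let ρ : Representation ℂ W M :=
    { toFun := fun w => Algebra.lsmul ℂ ℂ M (ofWₘ W a c w)
      map_one' := by rw [map_one, map_one]
      map_mul' := fun u w => by rw [map_mul, map_mul] }
  -- The orbit of a vector killed by `𝔥` spans a finite-dimensional representation still killed by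
  -- `𝔥`.
  let N : Submodule ℂ M := Submodule.span ℂ (Set.range fun w : W => ρ w v)
  have hfin : FiniteDimensional ℂ N := FiniteDimensional.span_of_finite ℂ (Set.finite_range _)
  have hNst : ∀ g, ∀ m ∈ N, ρ g m ∈ N := by
    intro g m hm
    induction hm using Submodule.span_induction with
    | mem x hx =>
      obtain ⟨w, rfl⟩ := hx
      refine Submodule.subset_span ⟨g * w, ?_⟩
      simp only [map_mul, Module.End.mul_apply]
    | zero => simp
    | add x y _ _ hx hy => rw [map_add]; exact add_mem hx hy
    | smul z x _ hx => rw [map_smul]; exact N.smul_mem _ hx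
  have hN0 : N ≠ ⊥ := fun h => hv0 (by
    have : v ∈ N := Submodule.subset_span ⟨1, by simp⟩
    rwa [h, Submodule.mem_bot] at this)
  have hNk : N ≤ T.killed M 1 := by
    rw [Submodule.span_le]
    rintro _ ⟨w, rfl⟩
    refine T.w_killed w ?_
    rw [T.mem_killed_succ, T.killed_zero]
    exact hv
  obtain ⟨V, σ, hVN, hσ, hirr, hV0⟩ := exists_irreducible ρ N hNst hN0
  have hVfin : FiniteDimensional ℂ V := Submodule.finiteDimensional_of_le hVN
  have hψV : ∀ i (u : V), T.ψ (X i) • (u : M) = 0 := by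
    intro i u
    have := (T.mem_killed_succ.1 (hNk (hVN u.2))) i
    rwa [T.killed_zero] at this
  refine ⟨V, inferInstance, inferInstance, σ, hirr, ?_⟩
  let f : H W a c ⊗[ℂ] V →ₗ[H W a c] M := TensorProduct.AlgebraTensorModule.lift
    (LinearMap.toSpanSingleton (H W a c) (V →ₗ[ℂ] M) V.subtype)
  have hf : ∀ h (u : V), f (h ⊗ₜ u) = h • (u : M) := fun h u => by simp [f]
  have hfker : standardRel a c σ ≤ LinearMap.ker f := by
    rw [standardRel, Submodule.span_le]
    rintro _ (⟨w, u, rfl⟩ | ⟨y, u, rfl⟩)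
    · rw [SetLike.mem_coe, LinearMap.mem_ker, map_sub, hf, hf, hσ, one_smul, sub_eq_zero]
      rfl
    · rw [SetLike.mem_coe, LinearMap.mem_ker, hf]
      exact ofY_smul_eq_zero ha (fun i => hψV i u) y
  let π : Standard a c σ →ₗ[H W a c] M := (standardRel a c σ).liftQ f hfker
  let j : V →ₗ[ℂ] Standard a c σ :=
    { toFun := fun u => (standardRel a c σ).mkQ (1 ⊗ₜ u)
      map_add' := fun u u' => by rw [TensorProduct.tmul_add, map_add]
      map_smul' := fun z u => by rw [TensorProduct.tmul_smul]; rfl }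
  have hπj : ∀ u, π (j u) = u := fun u => by
    change f (1 ⊗ₜ u) = u
    rw [hf, one_smul]
  obtain ⟨u0, hu0, hu00⟩ := Submodule.exists_mem_ne_zero_of_ne_bot hV0
  have hπ0 : π ≠ 0 := fun h => hu00 ((hπj ⟨u0, hu0⟩).symm.trans (by rw [h]; rfl))
  have hπs : Function.Surjective π := LinearMap.surjective_of_ne_zero hπ0
  have hntS : Nontrivial (Standard a c σ) := hπs.nontrivial
  have hjw : ∀ (g : W) u, T.w g • j u = j (σ g u) := by
    intro g u
    change (standardRel a c σ).mkQ (ofW W a c g • (1 ⊗ₜ u)) = _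
    refine (Submodule.Quotient.eq _).2 ?_
    rw [TensorProduct.smul_tmul', smul_eq_mul, mul_one]
    exact Submodule.subset_span (Or.inl ⟨g, u, rfl⟩)
  have hjψ : ∀ i u, T.ψ (X i) • j u = 0 := by
    intro i u
    have : T.ψ (X i) = ofY W a c (basisY E i) := by
      simp only [hT, triangularData, commLift_X]; rfl
    rw [this]
    change (standardRel a c σ).mkQ (ofY W a c (basisY E i) • (1 ⊗ₜ u)) = _
    refine (Submodule.Quotient.mk_eq_zero _).2 ?_
    rw [TensorProduct.smul_tmul', smul_eq_mul, mul_one]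
    exact Submodule.subset_span (Or.inr ⟨basisY E i, u, rfl⟩)
  obtain ⟨z, hz⟩ := exists_scalar hc σ
  have hδ : ∀ u, T.δ • j u = z • j u := by
    intro u
    have hk : T.κ • j u = z • j u := by
      change kappa W a c • j u = _
      rw [kappa, finsum_eq_sum_of_fintype, Finset.sum_smul, ← map_smul, ← hz, map_sum]
      refine Finset.sum_congr rfl fun s _ => ?_
      rw [map_smul, ← hjw, smul_assoc]
      rfl
    rw [TriangularData.δ, add_smul, hk, Finset.sum_smul, Finset.sum_eq_zero, zero_add]
    intro i _
    rw [mul_smul, hjψ, smul_zero]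
  have hspan : Submodule.span (H W a c) (Set.range j) = ⊤ := by
    refine eq_top_iff.2 fun x _ => ?_
    obtain ⟨t, rfl⟩ := (standardRel a c σ).mkQ_surjective x
    induction t using TensorProduct.induction_on with
    | zero => rw [map_zero]; exact zero_mem _
    | tmul h u =>
      have : (standardRel a c σ).mkQ (h ⊗ₜ u) = h • j u := by
        change _ = (standardRel a c σ).mkQ (h • (1 ⊗ₜ u))
        rw [TensorProduct.smul_tmul', smul_eq_mul, mul_one]
      rw [this]
      exact Submodule.smul_mem _ _ (Submodule.subset_span ⟨u, rfl⟩)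
    | add s t hs ht =>
      rw [map_add]; exact add_mem (hs Submodule.mem_top) (ht Submodule.mem_top)
  have hne := TriangularData.sSup_ne_top (T := T) σ j hjw hjψ hδ hspan
  have hsimple : IsSimpleModule (H W a c) (Standard a c σ ⧸ LinearMap.ker π) :=
    IsSimpleModule.congr (π.quotKerEquivOfSurjective hπs)
  have hco : IsCoatom (LinearMap.ker π) := isSimpleModule_iff_isCoatom.1 hsimple
  -- The kernel is maximal, and the sum of the proper submodules is itself proper, so the two
  -- coincide.
  have hle : LinearMap.ker π ≤ sSup {N : Submodule (H W a c) (Standard a c σ) | N ≠ ⊤} :=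
    le_sSup hco.1
  have heq := (hco.le_iff_eq hne).1 hle
  exact ⟨(Submodule.quotEquivOfEq _ _ heq).trans (π.quotKerEquivOfSurjective hπs)⟩

end Cherednik

end

/-! ### Left-right symmetry and the conclusion -/

noncomputable section

/-- A two-sided ideal as an ideal of the opposite ring. -/
def Ideal.opposite {A : Type*} [Ring A] (I : Ideal A) (hI : I.IsTwoSided) : Ideal Aᵐᵒᵖ where
  carrier := {x | x.unop ∈ I}
  add_mem' := I.add_mem
  zero_mem' := I.zero_mem
  smul_mem' r _ hx := I.mul_mem_right r.unop hx

/-- The elementwise criterion `r A s ⊆ I` only exchanges `r` and `s` under reversal, which lets the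
left-module theorem for `Aᵐᵒᵖ` describe right annihilators. -/
theorem isPrimeTwoSidedIdeal_opposite {A : Type u} [Ring A] {I : Ideal A} (hI : I.IsTwoSided)
    (hI' : I ≠ ⊤) : IsPrimeTwoSidedIdeal (I.opposite hI) ↔ IsPrimeTwoSidedIdeal I := by
  have h1 : (I.opposite hI).IsTwoSided := ⟨fun {x} b hx => I.mul_mem_left b.unop hx⟩
  have h2 : I.opposite hI ≠ ⊤ := fun h => hI' ((Ideal.eq_top_iff_one I).2 (by
    have : (1 : Aᵐᵒᵖ) ∈ I.opposite hI := by rw [h]; exact Submodule.mem_top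
    exact this))
  rw [isPrimeTwoSidedIdeal_iff hI hI', isPrimeTwoSidedIdeal_iff h1 h2]
  constructor
  · intro h r s hrs
    refine (h (MulOpposite.op s) (MulOpposite.op r) fun t => ?_).symm
    change r * (t.unop * s) ∈ I
    rw [← mul_assoc]
    exact hrs _
  · intro h r s hrs
    refine (h s.unop r.unop fun t => ?_).symm
    have := hrs (MulOpposite.op t)
    change s.unop * (t * r.unop) ∈ I at this
    rwa [← mul_assoc] at this

namespace Cherednik

open MvPolynomial

variable {E : Type u} [NormedAddCommGroup E] [InnerProductSpace ℝ E] [FiniteDimensional ℝ E]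
  {W : Subgroup (E ≃ₗᵢ[ℝ] E)} {a : Refl W → E} {c : Refl W → ℂ} [Finite W]

theorem locNil_iff_AMinus (ha : IsRootChoice W a) {M : Type u} [AddCommGroup M]
    [Module (H W a c) M] :
    LeftLocallyNilpotent (AMinus W a c : Set (H W a c)) M ↔
      (triangularData (c := c) ha).LocNil M := by
  have hθ : ∀ i, (triangularData (c := c) ha).ψ (X i) = ofYₗ W a c (basisY E i) := fun i => by
    simp [triangularData]
  exact leftLocallyNilpotent_iff (fun s hs => exists_mem_augIdeal_of_mem_adjoin hθ hs.1)
    (X_mem_radical_invariants hθ (ofWₘ W a c) (repY W) ofWₘ_mul_ofYₗ)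

theorem locNil_iff_APlus (ha : IsRootChoice W a) {M : Type u} [AddCommGroup M]
    [Module (H W a c)ᵐᵒᵖ M] :
    RightLocallyNilpotent (APlus W a c : Set (H W a c)) M ↔
      (triangularData (c := c) ha).op.LocNil M := by
  have hθ : ∀ i, (triangularData (c := c) ha).φ (X i) = ofXₗ W a c (basisX E i) := fun i => by
    simp [triangularData]
  rw [rightLocallyNilpotent_iff]
  refine leftLocallyNilpotent_iff ?_ fun i => ?_
  · rintro _ ⟨s, hs, rfl⟩
    obtain ⟨p, hp, rfl⟩ := exists_mem_augIdeal_of_mem_adjoin hθ hs.1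
    exact ⟨p, hp, rfl⟩
  · refine Ideal.radical_mono (Ideal.span_mono ?_)
      (X_mem_radical_invariants hθ (ofWₘ W a c) (repX W) ofWₘ_mul_ofXₗ i)
    intro p hp
    exact ⟨_, hp, rfl⟩

end Cherednik

theorem mainTheorem9 {E : Type u} [NormedAddCommGroup E] [InnerProductSpace ℝ E]
    [FiniteDimensional ℝ E] (W : Subgroup (E ≃ₗᵢ[ℝ] E))
    (hW : Cherednik.IsFiniteCoxeterGroup W)
    (a : Cherednik.Refl W → E) (ha : Cherednik.IsRootChoice W a)
    (c : Cherednik.Refl W → ℂ) (hc : Cherednik.IsInvariant W c) :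
    -- the generalized Duflo theorem
    (∀ I : Ideal (Cherednik.H W a c), I.IsTwoSided → I ≠ ⊤ →
      List.TFAE [
        IsPrimitiveIdeal I,
        IsPrimeTwoSidedIdeal I,
        ∃ (M : Type u) (_ : AddCommGroup M) (_ : Module (Cherednik.H W a c) M),
          Cherednik.InOUp W a c M ∧ IsSimpleModule (Cherednik.H W a c) M ∧
            I = Module.annihilator (Cherednik.H W a c) M,
        ∃ (M : Type u) (_ : AddCommGroup M) (_ : Module (Cherednik.H W a c)ᵐᵒᵖ M),
          Cherednik.InODown W a c M ∧ IsSimpleModule (Cherednik.H W a c)ᵐᵒᵖ M ∧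
            ∀ r : Cherednik.H W a c, r ∈ I ↔ ∀ m : M, MulOpposite.op r • m = 0]) ∧
    -- every primitive ideal is the annihilator of a simple highest weight module
    (∀ I : Ideal (Cherednik.H W a c), IsPrimitiveIdeal I →
      ∃ (V : Type u) (_ : AddCommGroup V) (_ : Module ℂ V) (σ : Representation ℂ W V),
        σ.IsIrreducible ∧ IsSimpleModule (Cherednik.H W a c) (Cherednik.L a c σ) ∧
          I = Module.annihilator (Cherednik.H W a c) (Cherednik.L a c σ)) ∧
    -- there are finitely many primitive ideals
    {I : Ideal (Cherednik.H W a c) | IsPrimitiveIdeal I}.Finite ∧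
    -- finite length as a bimodule
    HasFiniteLengthAsBimodule (Cherednik.H W a c) := by
  have hfin : Finite W := hW.1
  have hfin' : Finite Wᵐᵒᵖ := Finite.of_equiv W MulOpposite.opEquiv
  let T := Cherednik.triangularData (c := c) ha
  have hprime : ∀ I : Ideal (Cherednik.H W a c), IsPrimitiveIdeal I → IsPrimeTwoSidedIdeal I := by
    rintro _ ⟨L, _, _, hL, rfl⟩
    exact IsPrimeTwoSidedIdeal.annihilator L
  refine ⟨fun I hI hI' => ?_, fun I h => ?_, ?_, T.isFiniteLength_bimodule⟩
  · tfae_have 1 → 2 := hprime I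
    tfae_have 2 → 3 := by
      intro h
      obtain ⟨N, hN, hψ, hIN⟩ := T.mem_simpleAnn_of_isPrime h
      exact ⟨_, _, _, ⟨inferInstance, (Cherednik.locNil_iff_AMinus ha).2
        (T.locNil_quotient (T.ψ_mem_of_X_mem hψ))⟩, isSimpleModule_iff_isCoatom.2 hN, hIN⟩
    tfae_have 3 → 1 := fun ⟨M, i, j, _, hs, hIM⟩ => ⟨M, i, j, hs, hIM⟩
    -- The same theorem for the opposite triangular data, where the generators from `𝔥*` play the
    -- lowering part.
    tfae_have 2 → 4 := by
      intro h
      obtain ⟨N, hN, hψ, hIN⟩ :=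
        T.op.mem_simpleAnn_of_isPrime ((isPrimeTwoSidedIdeal_opposite hI hI').2 h)
      refine ⟨_, _, _, ⟨inferInstance, (Cherednik.locNil_iff_APlus ha).2
        (T.op.locNil_quotient (T.op.ψ_mem_of_X_mem hψ))⟩, isSimpleModule_iff_isCoatom.2 hN,
        fun r => ?_⟩
      rw [← Module.mem_annihilator, ← hIN]
      rfl
    tfae_have 4 → 2 := by
      rintro ⟨M, _, _, -, hs, hIM⟩
      rw [← isPrimeTwoSidedIdeal_opposite hI hI']
      have : I.opposite hI = Module.annihilator (Cherednik.H W a c)ᵐᵒᵖ M := by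
        ext x
        rw [Module.mem_annihilator]
        exact hIM x.unop
      rw [this]
      exact IsPrimeTwoSidedIdeal.annihilator M
    tfae_finish
  · obtain ⟨N, hN, hψ, rfl⟩ := T.mem_simpleAnn_of_isPrime (hprime I h)
    have hs : IsSimpleModule (Cherednik.H W a c) (Cherednik.H W a c ⧸ N) :=
      isSimpleModule_iff_isCoatom.2 hN
    obtain ⟨V, i, j, σ, hσ, ⟨e⟩⟩ := Cherednik.exists_L_equiv ha hc _
      (T.locNil_quotient (T.ψ_mem_of_X_mem hψ))
    exact ⟨V, i, j, σ, hσ, IsSimpleModule.congr e, e.annihilator_eq.symm⟩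
  · exact T.finite_simpleAnn.subset fun I h => T.mem_simpleAnn_of_isPrime (hprime I h)

end
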